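/- Identify the plane with $\mathbb C$. For masses $m_0=1$, $m_i=\varepsilon\mu_i$ ($1\le i\le n$, $\mu_i>0$, $\varepsilon>0$), a relative equilibrium of the planar Newtonian $(n+1)$-body problem is a collisionless configuration with centre of mass $0$ that is at rest in the frame rotating with angular velocity $1$. It is called linearly stable if all solutions (on $\mathbb R$) of the linearized equations of motion in the rotating frame, with fixed centre of mass and vanishing first variation of the angular momentum, are bounded. A relative equilibrium of the $(1+n)$-body problem with infinitesimal masses $\mu_1,\dots,\mu_n$ is a configuration $\bar x=(0,e^{\mathrm i\vartheta_1},\dots,e^{\mathrm i\vartheta_n})$ that is the limit of relative equilibria of the $(n+1)$-body problem with masses $1,\varepsilon\mu_1,\dots,\varepsilon\mu_n$ along some sequence $\varepsilon\to0^+$. Hall's potential is $$V(\vartheta)=\sum_{i<k}\mu_i\mu_k\Big(\frac1{r_{k,i}}+\frac{r_{k,i}^2}{2}\Big),\qquad r_{k,i}=2\Big|\sin\frac{\vartheta_k-\vartheta_i}{2}\Big| ,$$ and $\bar x$ is nondegenerate if the kernel of the Hessian $V_{\vartheta\vartheta}$ consists only of the multiples of $(1,\dots,1)$. A relative equilibrium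 $\bar x$ of the $(1+n)$-body problem is called linearly stable if it is nondegenerate and all relative equilibria of the $(n+1)$-body problem with masses $1,\varepsilon\mu_1,\dots,\varepsilon\mu_n$ that are sufficiently close to $\bar x$, with $\varepsilon>0$ sufficiently small, are linearly stable. Put $f(\varphi)=\frac{1}{8|\sin(\varphi/2)|}\big(\frac{2}{\sin^2(\varphi/2)}-1\big)+\cos\varphi$ and $$g_1(j,l)=\sum_{k=1}^{j-1}f\Big(\frac{2k\pi}{j}\Big)\Big(1-\cos\frac{2(l-1)k\pi}{j}\Big),\qquad g_2(j)=\sum_{k=1}^{j}f\Big(\frac{2k-1}{j}\pi\Big),$$ $$g_3(j,l)=\sum_{k=1}^{j}f\Big(\frac{2k-1}{j}\pi\Big)\cos\frac{(l-1)(2k-1)\pi}{j},$$ $h_5=g_1(j,2)^2+g_2(j)^2-g_3(j,2)^2$, $h_4=h_5^2-4\,(g_1(j,2)g_2(j))^2$ and $\chi(j,2)=\mu_1\mu_2h_5+(\mu_1^2+\mu_2^2)g_1(j,2)g_2(j)$. **Theorem.** Let $n=2j$ with $j\ge2$, and $\vartheta_k=2\pi(k-1)/n$ for $1\le k\le n$.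 (a) For positive infinitesimal masses at the vertices, the regular $n$-gon is a relative equilibrium of the $(1+n)$-body problem if and only if the masses are placed alternately: one value at all odd-numbered vertices, one value at all even-numbered vertices. (b) With alternating masses $\mu_1,\mu_2>0$ ($\mu_1$ at the odd-numbered vertices), the regular $n$-gon is linearly stable if and only if $j\ge7$, or $j\in\{4,5,6\}$ and $$\frac{\mu_1}{\mu_2}\in\left(\frac{-h_5+\sqrt{h_4}}{2g_1(j,2)g_2(j)},\ \frac{-h_5-\sqrt{h_4}}{2g_1(j,2)g_2(j)}\right).$$ In particular it is never linearly stable for $j=2,3$. Moreover it is linearly stable if and only if it is nondegenerate and $V_{\vartheta\vartheta}$ has no negative eigenvalue. (c) For $j=4,5,6$ one has $h_4>0$, and for $\mu_1,\mu_2>0$ the equation $\chi(j,2)=0$ holds exactly when $\mu_1/\mu_2$ is one of the two end points of the interval. Up to an error less than $10^{-13}$ the end points are $0.39601454048825$ and $2.525159805412902$ for $j=4$, $0.16709497914366$ and $5.984620274797297$ for $j=5$, $0.061964963348688$ and $16.13815204525851$ for $j=6$. -/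

import Mathlib

open Filter Topology

noncomputable section

/-! The plane is identified with `ℂ`; gravitational constant one; uniformly rotating frame with
angular velocity one. -/

/-- Newtonian acceleration of each body, for point masses `m` at positions `z`. -/
def gravAccel {N : ℕ} (m : Fin N → ℝ) (z : Fin N → ℂ) : Fin N → ℂ :=
  fun i => ∑ k ∈ Finset.univ.erase i, (m k / ‖z k - z i‖ ^ 3) • (z k - z i)

/-- Relative equilibrium of the planar `N`-body problem: a collisionless configuration, with
centre of mass at the origin, that is at rest in the frame rotating with angular velocity one.
(In this frame the equations of motion read `z'' + 2 i z' - z = gravAccel m z`.) -/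
def IsRelativeEquilibrium {N : ℕ} (m : Fin N → ℝ) (z : Fin N → ℂ) : Prop :=
  Function.Injective z ∧ ∑ i, (m i : ℂ) * z i = 0 ∧ ∀ i, z i + gravAccel m z i = 0

/-- Total (inertial) angular momentum, as a function of the positions `p.1` and of the velocities
`p.2` in the rotating frame; the inertial velocity of body `i` is `p.2 i + i * p.1 i`. -/
def angularMomentum {N : ℕ} (m : Fin N → ℝ) (p : (Fin N → ℂ) × (Fin N → ℂ)) : ℝ :=
  ∑ i, m i * (star (p.1 i) * (p.2 i + Complex.I * p.1 i)).im

/-- `(ξ, η)` solves the equations of motion in the rotating frame, linearized at the rest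
point `(z, 0)`: `ξ' = η` and `η' = -2 i η + ξ + D(gravAccel)(z) ξ`. -/
def IsLinearizedSolution {N : ℕ} (m : Fin N → ℝ) (z : Fin N → ℂ) (ξ η : ℝ → Fin N → ℂ) : Prop :=
  ∀ t : ℝ, HasDerivAt ξ (η t) t ∧
    HasDerivAt η (fun i => -2 * Complex.I * η t i + ξ t i +
      fderiv ℝ (gravAccel m) z (ξ t) i) t

/-- Linear stability of a relative equilibrium of the `N`-body problem. The linearized system is
considered with the centre of mass fixed, and with vanishing first variation of the angular
momentum (this removes the secular drift along the family of rotating rescaled configurations,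
which is present at every relative equilibrium); all its solutions have to be bounded. -/
def IsLinearlyStable {N : ℕ} (m : Fin N → ℝ) (z : Fin N → ℂ) : Prop :=
  ∀ ξ η : ℝ → Fin N → ℂ, IsLinearizedSolution m z ξ η →
    (∀ t, ∑ i, (m i : ℂ) * ξ t i = 0) →
    (∀ t, fderiv ℝ (angularMomentum m) (z, 0) (ξ t, η t) = 0) →
    ∃ K : ℝ, ∀ t, ‖ξ t‖ ≤ K ∧ ‖η t‖ ≤ K

/-- The masses `m₀ = 1` and `mᵢ = ε μᵢ`. -/
def smallMasses {n : ℕ} (μ : Fin n → ℝ) (ε : ℝ) : Fin (n + 1) → ℝ :=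
  Fin.cons 1 (fun i => ε * μ i)

/-- The dominant body at the origin and the others on the unit circle at the angles `θ`. -/
def circleConfig {n : ℕ} (θ : Fin n → ℝ) : Fin (n + 1) → ℂ :=
  Fin.cons 0 (fun i => Complex.exp (θ i * Complex.I))

/-- Relative equilibrium of the `(1+n)`-body problem with infinitesimal masses `μ`: a limit of
relative equilibria of the `N`-body problem, `N = n + 1`, with masses `1, ε μ₁, …, ε μₙ`,
as `ε → 0⁺`. -/
def IsRelEqOneN {n : ℕ} (μ : Fin n → ℝ) (θ : Fin n → ℝ) : Prop :=
  ∃ (ε : ℕ → ℝ) (z : ℕ → Fin (n + 1) → ℂ), (∀ s, 0 < ε s) ∧ Tendsto ε atTop (𝓝 0) ∧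
    Tendsto z atTop (𝓝 (circleConfig θ)) ∧
    ∀ s, IsRelativeEquilibrium (smallMasses μ (ε s)) (z s)

/-- Chord between the points of the unit circle at angles `a` and `b`. -/
def chord (a b : ℝ) : ℝ := 2 * |Real.sin ((b - a) / 2)|

/-- Hall's potential function. -/
def hallPotential {n : ℕ} (μ : Fin n → ℝ) (θ : Fin n → ℝ) : ℝ :=
  ∑ i, ∑ k ∈ Finset.Ioi i, μ i * μ k * (1 / chord (θ i) (θ k) + chord (θ i) (θ k) ^ 2 / 2)

/-- Hessian matrix of Hall's potential function (second partial derivatives in the angles). -/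
def hallHessian {n : ℕ} (μ : Fin n → ℝ) (θ : Fin n → ℝ) : Matrix (Fin n) (Fin n) ℝ :=
  Matrix.of fun i k =>
    fderiv ℝ (fun φ => fderiv ℝ (hallPotential μ) φ (Pi.single i 1)) θ (Pi.single k 1)

/-- The Hessian is degenerate only along the direction of common rotations. -/
def IsNondegenerate {n : ℕ} (μ : Fin n → ℝ) (θ : Fin n → ℝ) : Prop :=
  ∀ v : Fin n → ℝ, (hallHessian μ θ).mulVec v = 0 → ∃ c : ℝ, v = fun _ => c

/-- Linear stability of a relative equilibrium of the `(1+n)`-body problem: it is nondegenerate,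
and the relative equilibria of the `N`-body problem, `N = n + 1`, with masses `1, ε μ₁, …, ε μₙ`
that converge to it as `ε → 0⁺` are linearly stable once `ε` is sufficiently small. -/
def IsLinearlyStableOneN {n : ℕ} (μ : Fin n → ℝ) (θ : Fin n → ℝ) : Prop :=
  IsRelEqOneN μ θ ∧ IsNondegenerate μ θ ∧
    ∀ᶠ p : ℝ × (Fin (n + 1) → ℂ) in 𝓝[>] 0 ×ˢ 𝓝 (circleConfig θ),
      IsRelativeEquilibrium (smallMasses μ p.1) p.2 → IsLinearlyStable (smallMasses μ p.1) p.2

/-- Angles of the vertices of the regular `n`-gon. -/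
def ngonAngles (n : ℕ) : Fin n → ℝ := fun k => 2 * k * Real.pi / n

/-- Masses `a, b, a, b, …` placed alternately. -/
def alternatingMasses (n : ℕ) (a b : ℝ) : Fin n → ℝ :=
  fun k => if Even (k : ℕ) then a else b

/-- The function `f(φ)`, the derivative of `sin φ * (1 - 1 / (8 |sin (φ/2)|³))`. -/
def hallF (φ : ℝ) : ℝ :=
  1 / (8 * |Real.sin (φ / 2)|) * (2 / Real.sin (φ / 2) ^ 2 - 1) + Real.cos φ

def g₁ (j l : ℕ) : ℝ :=
  ∑ k ∈ Finset.Ico 1 j, hallF (2 * k * Real.pi / j) *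
    (1 - Real.cos (2 * ((l : ℝ) - 1) * k * Real.pi / j))

def g₂ (j : ℕ) : ℝ :=
  ∑ k ∈ Finset.Icc 1 j, hallF ((2 * (k : ℝ) - 1) / j * Real.pi)

def g₃ (j l : ℕ) : ℝ :=
  ∑ k ∈ Finset.Icc 1 j, hallF ((2 * (k : ℝ) - 1) / j * Real.pi) *
    Real.cos (((l : ℝ) - 1) * (2 * k - 1) / j * Real.pi)

def h₅ (j : ℕ) : ℝ := g₁ j 2 ^ 2 + g₂ j ^ 2 - g₃ j 2 ^ 2

def h₄ (j : ℕ) : ℝ := h₅ j ^ 2 - 4 * (g₁ j 2 * g₂ j) ^ 2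

/-- End points of the interval of stable mass ratios: the two solutions `ρ` of
`g₁ g₂ ρ² + h₅ ρ + g₁ g₂ = 0`. -/
def ratioLower (j : ℕ) : ℝ := (-h₅ j + √(h₄ j)) / (2 * g₁ j 2 * g₂ j)

def ratioUpper (j : ℕ) : ℝ := (-h₅ j - √(h₄ j)) / (2 * g₁ j 2 * g₂ j)

/-- `χ(j, l)` for the masses `a` and `b`. -/
def chi (a b : ℝ) (j l : ℕ) : ℝ :=
  a * b * (g₁ j l ^ 2 + g₂ j ^ 2 - g₃ j l ^ 2) + (a ^ 2 + b ^ 2) * (g₁ j l * g₂ j)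

end

/-! Stability is reduced to Hall's Hessian. In positions relative to the dominant body the
linearized equations read `x'' = -2 i x' + K x`, where `K` is symmetric for the kinetic energy form.
Hence the energy `E(x, x')` is a quadratic first integral, and so is `E(x', x'')`, the energy of the
differentiated solution. As `ε → 0`, `K` has radial stiffness 3 and tangential stiffness of order
`ε`. If tangential displacements are measured in units of `1/√ε`, the integral `2 E(x', x'') - E(x,
x')` tends to a positive definite Kepler form plus the Hessian form of `V`. At a nondegenerate
minimum it is therefore positive definite up to the rotation direction, which a linear integral
controls, and solutions are bounded (`eventually_pos`, `isLinearlyStable_of_pos`). Conversely,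
stability puts the spectrum on the imaginary axis. This yields a determinant inequality that
survives the limit `ε → 0` after rescaling, and a negative eigenvalue of the Hessian would violate
it (`posSemidef_of_isLinearlyStable`).

Limits of relative equilibria are critical points of `V`, so on the polygon the convolution of the
masses with the pair force vanishes on `ZMod (2j)`. The sine transform of the pair force vanishes
only at the frequencies `0` and `j` (`sum_pairForce_mul_sin_ne_zero`), which forces period two.
Conversely, alternating masses can be placed on two concentric `j`-gons whose radii are found with
the intermediate value theorem (`isRelEqOneN_alternatingMasses`).

For the Hessian, write `f` as a positive kernel plus `cos`. The kernel gives a form that is positive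
modulo constants. Since the centre of mass is zero, the cosine subtracts two squares, of the
functionals `∑ μ cos θ v` and `∑ μ sin θ v`. On the first harmonic the kernel reduces to a 2 by 2
matrix, and for `j ≥ 3` positivity becomes `χ(j, 2) > 0`
(`posSemidef_and_isNondegenerate_iff_chi_pos`); the square is treated by two test vectors.

Finally `χ` is `μ₁μ₂` times a positive factor times `chordSum (2j) / 4 - j`, plus `(μ₁ - μ₂)²` times
a positive factor times `chordSum j / 4 - j / 2` (`chi_eq`). Since `chordSum N > 2 N` for `N ≥ 7`,
`χ` is positive for `j ≥ 7`; for `j = 3` both brackets are nonpositive. For `j = 4, 5, 6` it is a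
concave quadratic in the mass ratio that is positive at ratio one, and its roots are enclosed
numerically. -/

namespace HallRing

/-! ### The Newtonian force, its derivative and the linearized equations. -/

/-- The force field of a unit mass at the origin, up to sign: `w / |w|³`. -/
noncomputable def newton (w : ℂ) : ℂ := (‖w‖ ^ 3)⁻¹ • w

/-- The derivative of `newton`. -/
noncomputable def tidal (w : ℂ) : ℂ →L[ℝ] ℂ :=
  (‖w‖ ^ 3)⁻¹ • ContinuousLinearMap.id ℝ ℂ - (3 / ‖w‖ ^ 5) • (innerSL ℝ w).smulRight w

theorem tidal_apply (w h : ℂ) :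
    tidal w h = (‖w‖ ^ 3)⁻¹ • h - (3 / ‖w‖ ^ 5 * inner ℝ w h) • w := by
  simp [tidal, mul_assoc]

-- With the convention `0⁻¹ = 0` the self-interaction is zero, so sums over the other bodies may run
-- over all bodies.
@[simp] theorem newton_zero : newton 0 = 0 := by simp [newton]

@[simp] theorem tidal_zero : tidal 0 = 0 := by
  ext h; simp [tidal_apply]

theorem newton_neg (w : ℂ) : newton (-w) = -newton w := by simp [newton]

theorem tidal_neg (w : ℂ) : tidal (-w) = tidal w := by
  refine ContinuousLinearMap.ext fun h => ?_
  simp only [tidal_apply, norm_neg, inner_neg_left, smul_neg, mul_neg, neg_smul, neg_neg]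

theorem hasFDerivAt_newton {w : ℂ} (hw : w ≠ 0) : HasFDerivAt newton (tidal w) w := by
  have hn : ‖w‖ ≠ 0 := norm_ne_zero_iff.2 hw
  have h1 : HasFDerivAt (fun x : ℂ => ‖x‖) ((1 / ‖w‖) • innerSL ℝ w) w := by
    have h := (hasStrictFDerivAt_norm_sq w).hasFDerivAt.sqrt (pow_ne_zero 2 hn)
    simp only [Real.sqrt_sq (norm_nonneg _)] at h
    refine h.congr_fderiv ?_
    ext x
    simp only [smul_apply, smul_eq_mul, nsmul_eq_mul]
    field_simp
    simp
  have h2 : HasDerivAt (fun r : ℝ => (r ^ 3)⁻¹) (-(3 * ‖w‖ ^ 2) / (‖w‖ ^ 3) ^ 2) ‖w‖ := by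
    simpa using (hasDerivAt_pow 3 ‖w‖).fun_inv (pow_ne_zero 3 hn)
  have h3 := (h2.comp_hasFDerivAt w h1).smul (hasFDerivAt_id w)
  refine h3.congr_fderiv ?_
  refine ContinuousLinearMap.ext fun x => ?_
  simp only [tidal_apply, add_apply, smul_apply,
    ContinuousLinearMap.smulRight_apply, Function.comp, id, ContinuousLinearMap.id_apply,
    innerSL_apply_apply, sub_eq_add_neg, ← neg_smul, smul_eq_mul]
  congr 2
  field_simp

theorem continuousAt_newton {w : ℂ} (hw : w ≠ 0) : ContinuousAt newton w :=
  (hasFDerivAt_newton hw).continuousAt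

theorem continuousAt_tidal_uncurry {w : ℂ} (hw : w ≠ 0) (h : ℂ) :
    ContinuousAt (fun p : ℂ × ℂ => tidal p.1 p.2) (w, h) := by
  have hn : ‖w‖ ≠ 0 := norm_ne_zero_iff.2 hw
  simp only [tidal_apply]
  have h1 : ContinuousAt (fun p : ℂ × ℂ => ‖p.1‖ ^ 3) (w, h) := by fun_prop
  have h2 : ContinuousAt (fun p : ℂ × ℂ => ‖p.1‖ ^ 5) (w, h) := by fun_prop
  have h3 : ContinuousAt (fun p : ℂ × ℂ => inner ℝ p.1 p.2) (w, h) := by fun_prop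
  exact ((h1.inv₀ (pow_ne_zero 3 hn)).smul continuousAt_snd).sub
    (((continuousAt_const.div h2 (pow_ne_zero 5 hn)).mul h3).smul continuousAt_fst)

/-- `tidal` is the Hessian of `-1/|w|`, whose gradient is `newton`. -/
theorem tidal_symm (w x y : ℂ) : inner ℝ x (tidal w y) = inner ℝ (tidal w x) y := by
  simp only [tidal_apply, inner_sub_left, inner_sub_right, inner_smul_left, inner_smul_right]
  rw [real_inner_comm w x]
  simp
  ring

/-- Euler's relation: `newton` is homogeneous of degree `-2`. -/
theorem tidal_self (w : ℂ) : tidal w w = -(2 : ℝ) • newton w := by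
  rcases eq_or_ne w 0 with rfl | hw
  · simp
  have hn : ‖w‖ ≠ 0 := norm_ne_zero_iff.2 hw
  rw [tidal_apply, newton, real_inner_self_eq_norm_sq, smul_smul, ← sub_smul]
  congr 1
  field_simp
  norm_num

/-- The infinitesimal form of the rotation equivariance of `newton`. -/
theorem tidal_I_mul (w : ℂ) : tidal w (Complex.I * w) = Complex.I * newton w := by
  rw [tidal_apply, newton, Complex.inner]
  have : (Complex.I * w * (starRingEnd ℂ) w).re = 0 := by simp; ring
  rw [this]
  simp
  ring

theorem gravAccel_eq {N : ℕ} (m : Fin N → ℝ) (z : Fin N → ℂ) (i : Fin N) :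
    gravAccel m z i = ∑ k, m k • newton (z k - z i) := by
  rw [gravAccel, ← Finset.sum_erase (a := i) Finset.univ (f := fun k => m k • newton (z k - z i))
    (by simp)]
  refine Finset.sum_congr rfl fun k _ => ?_
  rw [newton, smul_smul, div_eq_mul_inv]

theorem fderiv_gravAccel {N : ℕ} (m : Fin N → ℝ) {z : Fin N → ℂ} (hz : Function.Injective z)
    (ξ : Fin N → ℂ) (i : Fin N) :
    fderiv ℝ (gravAccel m) z ξ i = ∑ k, m k • tidal (z k - z i) (ξ k - ξ i) := by
  have h : HasFDerivAt (gravAccel m) (ContinuousLinearMap.pi fun i => ∑ k,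
      m k • (tidal (z k - z i)).comp (ContinuousLinearMap.proj (R := ℝ) (φ := fun _ : Fin N => ℂ) k
        - ContinuousLinearMap.proj i)) z := by
    rw [hasFDerivAt_pi]
    intro i
    have : (fun x => gravAccel m x i) = fun x => ∑ k, m k • newton (x k - x i) :=
      funext fun x => gravAccel_eq m x i
    rw [this]
    refine HasFDerivAt.fun_sum fun k _ => HasFDerivAt.fun_const_smul ?_ _
    by_cases hk : k = i
    · subst hk
      simpa using hasFDerivAt_const (0 : ℂ) z
    · exact (hasFDerivAt_newton (sub_ne_zero.2 fun h => hk (hz h))).comp z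
        ((hasFDerivAt_apply (𝕜 := ℝ) (F' := fun _ : Fin N => ℂ) k z).fun_sub (hasFDerivAt_apply i z))
  rw [h.fderiv]
  simp

theorem fderiv_angularMomentum {N : ℕ} (m : Fin N → ℝ) (z ξ η : Fin N → ℂ) :
    fderiv ℝ (angularMomentum m) (z, 0) (ξ, η) =
      ∑ i, m i * (2 * inner ℝ (ξ i) (z i) + inner ℝ (η i) (Complex.I * z i)) := by
  -- In terms of continuous linear maps differentiability is automatic; the value of the derivative
  -- is then read off along the line `(z, 0) + t (ξ, η)`.
  have e : angularMomentum m = fun p : (Fin N → ℂ) × (Fin N → ℂ) =>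
      ∑ i, m i * (Complex.reCLM (p.1 i) * (Complex.imCLM (p.2 i) + Complex.reCLM (p.1 i))
        - Complex.imCLM (p.1 i) * (Complex.reCLM (p.2 i) - Complex.imCLM (p.1 i))) := by
    funext p
    refine Finset.sum_congr rfl fun i _ => ?_
    simp
    left; ring
  have hd : DifferentiableAt ℝ (angularMomentum m) (z, 0) := by
    rw [e]; fun_prop
  have hl : HasDerivAt (fun t : ℝ => ((z, 0) : (Fin N → ℂ) × (Fin N → ℂ)) + t • (ξ, η)) (ξ, η) 0 := by
    simpa using ((hasDerivAt_id (0 : ℝ)).smul_const (ξ, η)).const_add ((z, 0) : (Fin N → ℂ) × (Fin N → ℂ))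
  have h1 := HasFDerivAt.comp_hasDerivAt (0 : ℝ) (by simpa using hd.hasFDerivAt) hl
  refine h1.unique ?_
  rw [e]
  simp only [Function.comp_def]
  refine HasDerivAt.fun_sum fun i _ => HasDerivAt.const_mul _ ?_
  have ha (x y : ℝ) : HasDerivAt (fun t : ℝ => x + t * y) y 0 := by
    simpa using ((hasDerivAt_id (0 : ℝ)).mul_const y).const_add x
  have h5 := ((ha (z i).re (ξ i).re).fun_mul ((ha 0 (η i).im).fun_add (ha (z i).re (ξ i).re))).fun_sub
    ((ha (z i).im (ξ i).im).fun_mul ((ha 0 (η i).re).fun_sub (ha (z i).im (ξ i).im)))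
  have h6 := h5.congr_deriv (g' := 2 * inner ℝ (ξ i) (z i) + inner ℝ (η i) (Complex.I * z i))
    (by simp [Complex.inner]; ring)
  simpa using h6

end HallRing

/-! ### Coordinates relative to the dominant body. -/

namespace HallRing

/-- Linearized right-hand side of the equations of motion relative to the dominant body. -/
noncomputable def helioOp {n : ℕ} (ε : ℝ) (μ : Fin n → ℝ) (q : Fin n → ℂ) :
    (Fin n → ℂ) →L[ℝ] (Fin n → ℂ) :=
  ContinuousLinearMap.pi fun k => ContinuousLinearMap.proj (R := ℝ) (φ := fun _ : Fin n => ℂ) k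
    - (tidal (q k)).comp (ContinuousLinearMap.proj k)
    + ε • ∑ l, μ l • ((tidal (q l - q k)).comp
        (ContinuousLinearMap.proj (R := ℝ) (φ := fun _ : Fin n => ℂ) l - ContinuousLinearMap.proj k)
      - (tidal (q l)).comp (ContinuousLinearMap.proj l))

theorem helioOp_apply {n : ℕ} (ε : ℝ) (μ : Fin n → ℝ) (q x : Fin n → ℂ) (k : Fin n) :
    helioOp ε μ q x k = x k - tidal (q k) (x k)
      + ε • ∑ l, μ l • (tidal (q l - q k) (x l - x k) - tidal (q l) (x l)) := by
  simp [helioOp]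

/-- Kinetic energy form, relative to the dominant body and divided by `ε`. -/
noncomputable def massForm {n : ℕ} (ε : ℝ) (μ : Fin n → ℝ) (x y : Fin n → ℂ) : ℝ :=
  ∑ k, μ k * inner ℝ (x k) (y k)
    - ε / (1 + ε * ∑ k, μ k) * inner ℝ (∑ k, μ k • x k) (∑ k, μ k • y k)

/-- Relative equilibria in coordinates relative to the dominant body. -/
structure IsHelioEq {n : ℕ} (ε : ℝ) (μ : Fin n → ℝ) (q : Fin n → ℂ) : Prop where
  ne_zero : ∀ k, q k ≠ 0
  inj : Function.Injective q
  eq : ∀ k, q k - newton (q k) + ε • ∑ l, μ l • (newton (q l - q k) - newton (q l)) = 0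

theorem IsHelioEq.of_isRelativeEquilibrium {n : ℕ} {ε : ℝ} {μ : Fin n → ℝ} {z : Fin (n + 1) → ℂ}
    (h : IsRelativeEquilibrium (smallMasses μ ε) z) :
    IsHelioEq ε μ (fun k => z k.succ - z 0) where
  ne_zero k := sub_ne_zero.2 fun e => Fin.succ_ne_zero k (h.1 e)
  inj k l e := Fin.succ_injective _ (h.1 (sub_left_injective e))
  eq k := by
    have h1 := h.2.2 k.succ
    have h0 := h.2.2 0
    rw [gravAccel_eq, Fin.sum_univ_succ] at h1 h0
    simp only [smallMasses, Fin.cons_zero, Fin.cons_succ, sub_self, newton_zero, one_smul,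
      zero_add] at h1 h0
    rw [← neg_sub (z k.succ) (z 0), newton_neg] at h1
    have e : ∀ l : Fin n, z l.succ - z 0 - (z k.succ - z 0) = z l.succ - z k.succ := fun l => by ring
    simp only [e, smul_sub, Finset.sum_sub_distrib, Finset.smul_sum, smul_smul]
    linear_combination h1 - h0

variable {n : ℕ} {ε : ℝ} {μ : Fin n → ℝ}

theorem massForm_add_left (x y w : Fin n → ℂ) :
    massForm ε μ (x + y) w = massForm ε μ x w + massForm ε μ y w := by
  simp only [massForm, Pi.add_apply, inner_add_left, smul_add, mul_add, Finset.sum_add_distrib]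
  ring

theorem massForm_symm (x y : Fin n → ℂ) : massForm ε μ x y = massForm ε μ y x := by
  simp only [massForm]
  rw [real_inner_comm]
  congr 1
  exact Finset.sum_congr rfl fun k _ => by rw [real_inner_comm]

theorem massForm_add_right (x y w : Fin n → ℂ) :
    massForm ε μ w (x + y) = massForm ε μ w x + massForm ε μ w y := by
  rw [massForm_symm, massForm_add_left, massForm_symm x, massForm_symm y]

theorem massForm_smul_left (c : ℝ) (x y : Fin n → ℂ) :
    massForm ε μ (c • x) y = c * massForm ε μ x y := by
  simp only [massForm, Pi.smul_apply, smul_comm _ c, ← Finset.smul_sum, inner_smul_left,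
    mul_sub, Finset.mul_sum]
  congr 1
  · exact Finset.sum_congr rfl fun k _ => by simp; ring
  · simp; ring

theorem massForm_smul_right (c : ℝ) (x y : Fin n → ℂ) :
    massForm ε μ x (c • y) = c * massForm ε μ x y := by
  rw [massForm_symm, massForm_smul_left, massForm_symm]

theorem massForm_I_left (x y : Fin n → ℂ) :
    massForm ε μ (fun k => Complex.I * x k) y = -massForm ε μ x (fun k => Complex.I * y k) := by
  have e : ∀ a b : ℂ, inner ℝ (Complex.I * a) b = -inner ℝ a (Complex.I * b) := fun a b => by
    simp [Complex.inner]; ring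
  simp only [massForm, ← mul_smul_comm, ← Finset.mul_sum, e]
  simp only [mul_neg, Finset.sum_neg_distrib]
  ring

/-- The acceleration of the dominant body makes `helioOp` asymmetric for the plain mass-weighted
product. The rank-two correction in `massForm` removes exactly this asymmetry, and what is left is a
sum of manifestly symmetric tidal terms. -/
theorem helioOp_symm (hM : 1 + ε * ∑ k, μ k ≠ 0) (q x y : Fin n → ℂ) :
    massForm ε μ x (helioOp ε μ q y) = massForm ε μ (helioOp ε μ q x) y := by
  have key : ∀ x y : Fin n → ℂ, massForm ε μ x (helioOp ε μ q y) = massForm ε μ x y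
      - ∑ k, μ k * inner ℝ (x k) (tidal (q k) (y k))
      - ε / 2 * ∑ k, ∑ l, μ k * μ l * inner ℝ (x l - x k) (tidal (q l - q k) (y l - y k)) := by
    intro x y
    -- Newton's third law: the linearized forces between the light bodies sum to zero.
    have anti : ∑ k, ∑ l, (μ k * μ l) • tidal (q l - q k) (y l - y k) = 0 := by
      have h : ∑ k, ∑ l, (μ k * μ l) • tidal (q l - q k) (y l - y k)
          = -∑ k, ∑ l, (μ k * μ l) • tidal (q l - q k) (y l - y k) := by
        conv_lhs => rw [Finset.sum_comm]
        rw [← Finset.sum_neg_distrib]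
        refine Finset.sum_congr rfl fun k _ => ?_
        rw [← Finset.sum_neg_distrib]
        refine Finset.sum_congr rfl fun l _ => ?_
        rw [← neg_sub (q l), tidal_neg, ← neg_sub (y l), map_neg, smul_neg, mul_comm]
      exact self_eq_neg.1 h
    have hsum : ∑ k, μ k • helioOp ε μ q y k = ∑ k, μ k • y k
        - (1 + ε * ∑ k, μ k) • ∑ k, μ k • tidal (q k) (y k) := by
      have h1 : ∑ k, μ k • ε • ∑ l, μ l • (tidal (q l - q k) (y l - y k) - tidal (q l) (y l))
          = ε • (∑ k, ∑ l, (μ k * μ l) • tidal (q l - q k) (y l - y k))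
            - (ε * ∑ k, μ k) • ∑ l, μ l • tidal (q l) (y l) := by
        simp only [smul_sub, Finset.sum_sub_distrib, Finset.smul_sum, smul_smul, Finset.sum_mul,
          Finset.mul_sum, Finset.sum_smul]
        congr 1
        · exact Finset.sum_congr rfl fun k _ => Finset.sum_congr rfl fun l _ => by
            congr 1; ring
        · rw [Finset.sum_comm]
          exact Finset.sum_congr rfl fun k _ => Finset.sum_congr rfl fun l _ => by
            congr 1; ring
      simp only [helioOp_apply, smul_add, Finset.sum_add_distrib, h1, anti]
      simp only [smul_sub, Finset.sum_sub_distrib]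
      module
    -- Exchanging `k` and `l` symmetrizes the pair interaction.
    have hdouble : ∑ k, ∑ l, μ k * μ l * inner ℝ (x k) (tidal (q l - q k) (y l - y k))
        = -(1 / 2) * ∑ k, ∑ l, μ k * μ l * inner ℝ (x l - x k) (tidal (q l - q k) (y l - y k)) := by
      have h : ∑ k, ∑ l, μ k * μ l * inner ℝ (x l) (tidal (q l - q k) (y l - y k))
          = -∑ k, ∑ l, μ k * μ l * inner ℝ (x k) (tidal (q l - q k) (y l - y k)) := by
        rw [Finset.sum_comm, ← Finset.sum_neg_distrib]
        refine Finset.sum_congr rfl fun k _ => ?_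
        rw [← Finset.sum_neg_distrib]
        refine Finset.sum_congr rfl fun l _ => ?_
        rw [← neg_sub (q l), tidal_neg, ← neg_sub (y l), map_neg, inner_neg_right]
        ring
      simp only [inner_sub_left, mul_sub, Finset.sum_sub_distrib, h]
      ring
    have hfirst : ∑ k, μ k * inner ℝ (x k) (helioOp ε μ q y k) = ∑ k, μ k * inner ℝ (x k) (y k)
        - ∑ k, μ k * inner ℝ (x k) (tidal (q k) (y k))
        + ε * ∑ k, ∑ l, μ k * μ l * inner ℝ (x k) (tidal (q l - q k) (y l - y k))
        - ε * inner ℝ (∑ k, μ k • x k) (∑ k, μ k • tidal (q k) (y k)) := by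
      simp only [helioOp_apply, inner_add_right, inner_sub_right, inner_smul_right, inner_sum,
        sum_inner, mul_add, mul_sub, Finset.sum_add_distrib, Finset.sum_sub_distrib,
        Finset.mul_sum, real_inner_smul_left]
      have e1 : ∀ k l, μ k * (ε * (μ l * inner ℝ (x k) (tidal (q l - q k) (y l - y k))))
        = ε * (μ k * μ l * inner ℝ (x k) (tidal (q l - q k) (y l - y k))) := fun k l => by ring
      have e2 : ∀ k l, μ k * (ε * (μ l * inner ℝ (x k) (tidal (q l) (y l))))
        = ε * (μ l * (μ k * inner ℝ (x k) (tidal (q l) (y l)))) := fun k l => by ring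
      simp only [e1, e2]
      rw [Finset.sum_comm (f := fun k l => ε * (μ l * (μ k * inner ℝ (x k) (tidal (q l) (y l)))))]
      ring
    rw [massForm, hfirst, hsum, hdouble, inner_sub_right, inner_smul_right, massForm]
    field_simp
    ring
  rw [key, massForm_symm (helioOp ε μ q x) y, key, massForm_symm y x]
  congr 1
  · congr 1
    exact Finset.sum_congr rfl fun k _ => by rw [tidal_symm, real_inner_comm]
  · congr 1
    exact Finset.sum_congr rfl fun k _ => Finset.sum_congr rfl fun l _ => by
      rw [tidal_symm, real_inner_comm]

/-- By homogeneity the tidal terms are `-2` times the Newtonian ones, and the equilibrium equation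
turns these into `2 q`. -/
theorem helioOp_self {q : Fin n → ℂ} (h : IsHelioEq ε μ q) : helioOp ε μ q q = (3 : ℝ) • q := by
  funext k
  have h1 := h.eq k
  rw [helioOp_apply]
  simp only [tidal_self, ← smul_sub, smul_comm (μ _) (-(2 : ℝ)), ← Finset.smul_sum,
    Pi.smul_apply]
  rw [smul_comm ε]
  simp only [Complex.real_smul] at h1 ⊢
  push_cast
  linear_combination -2 * h1

/-- Turning all bodies by the common angle `s k` exerts no force, so the force on body `k` depends
only on the differences `s l - s k`. The dominant body does not enter them, which produces the
factor `ε`. -/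
theorem helioOp_I_smul {q : Fin n → ℂ} (h : IsHelioEq ε μ q) (s : Fin n → ℝ) (k : Fin n) :
    helioOp ε μ q (fun k => s k • (Complex.I * q k)) k =
      ε • ∑ l, (μ l * (s l - s k)) • (tidal (q l - q k) (Complex.I * q l)
        - Complex.I * newton (q l)) := by
  have h1 := h.eq k
  have e : ∀ l, tidal (q l - q k) (s l • (Complex.I * q l) - s k • (Complex.I * q k))
      - tidal (q l) (s l • (Complex.I * q l))
      = (s l - s k) • (tidal (q l - q k) (Complex.I * q l) - Complex.I * newton (q l))
        + s k • (Complex.I * (newton (q l - q k) - newton (q l))) := by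
    intro l
    have h2 := tidal_I_mul (q l - q k)
    rw [mul_sub, map_sub, sub_eq_iff_eq_add] at h2
    rw [map_sub, map_smul, map_smul, map_smul, tidal_I_mul, h2, mul_sub]
    module
  rw [helioOp_apply]
  simp only [e]
  simp only [smul_add, Finset.sum_add_distrib, map_smul, tidal_I_mul, smul_smul]
  have h3 : ∑ l, (μ l * s k) • (Complex.I * (newton (q l - q k) - newton (q l)))
      = s k • (Complex.I * ∑ l, μ l • (newton (q l - q k) - newton (q l))) := by
    rw [Finset.mul_sum, Finset.smul_sum]
    refine Finset.sum_congr rfl fun l _ => ?_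
    rw [mul_smul_comm, smul_smul, mul_comm]
  rw [h3]
  simp only [Complex.real_smul] at h1 ⊢
  linear_combination s k * Complex.I * h1

theorem helioOp_I_self {q : Fin n → ℂ} (h : IsHelioEq ε μ q) :
    helioOp ε μ q (fun k => Complex.I * q k) = 0 := by
  have h1 := fun k => helioOp_I_smul h (fun _ => 1) k
  funext k
  simpa using h1 k

/-- König's decomposition: eliminating the dominant body through the centre of mass condition
produces the subtracted term of `massForm`. -/
theorem sum_mass_mul_inner (hM : 1 + ε * ∑ k, μ k ≠ 0) {x y : Fin (n + 1) → ℂ}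
    (hx : ∑ i, (smallMasses μ ε i : ℂ) * x i = 0) (hy : ∑ i, (smallMasses μ ε i : ℂ) * y i = 0) :
    ∑ i, smallMasses μ ε i * inner ℝ (x i) (y i) =
      ε * massForm ε μ (fun k => x k.succ - x 0) (fun k => y k.succ - y 0) := by
  rw [Fin.sum_univ_succ] at hx hy ⊢
  simp only [smallMasses, Fin.cons_zero, Fin.cons_succ] at hx hy ⊢
  have hs : ∀ x : Fin (n + 1) → ℂ,
      ((1 : ℝ) : ℂ) * x 0 + ∑ i : Fin n, ((ε * μ i : ℝ) : ℂ) * x i.succ = 0 →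
      ε • ∑ k, μ k • (x k.succ - x 0) = -(1 + ε * ∑ k, μ k) • x 0 ∧
      ε • ∑ k, μ k • x k.succ = -x 0 := by
    intro x hx
    have h2 : ε • ∑ k, μ k • x k.succ = -x 0 := by
      rw [← eq_neg_iff_add_eq_zero, eq_comm, neg_eq_iff_eq_neg] at hx
      rw [Finset.smul_sum]
      have : ∀ k, ε • μ k • x (Fin.succ k) = ((ε * μ k : ℝ) : ℂ) * x k.succ := fun k => by
        rw [smul_smul, Complex.real_smul]
      simp only [this, hx]
      simp
    refine ⟨?_, h2⟩
    simp only [smul_sub, Finset.sum_sub_distrib, h2, ← Finset.sum_smul]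
    module
  obtain ⟨hx1, hx2⟩ := hs x hx
  obtain ⟨hy1, hy2⟩ := hs y hy
  have h1 : ε ^ 2 * inner ℝ (∑ k, μ k • (x k.succ - x 0)) (∑ k, μ k • (y k.succ - y 0))
      = (1 + ε * ∑ k, μ k) ^ 2 * inner ℝ (x 0) (y 0) := by
    have : inner ℝ (ε • ∑ k, μ k • (x k.succ - x 0)) (ε • ∑ k, μ k • (y k.succ - y 0))
        = inner ℝ (-(1 + ε * ∑ k, μ k) • x 0) (-(1 + ε * ∑ k, μ k) • y 0) := by rw [hx1, hy1]
    simp only [real_inner_smul_left, real_inner_smul_right] at this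
    linear_combination this
  have h2 : ε * ∑ k, μ k * inner ℝ (x k.succ) (y 0) = -inner ℝ (x 0) (y 0) := by
    have : inner ℝ (ε • ∑ k, μ k • x k.succ) (y 0) = -inner ℝ (x 0) (y 0) := by
      rw [hx2, inner_neg_left]
    simpa only [real_inner_smul_left, sum_inner] using this
  have h3 : ε * ∑ k, μ k * inner ℝ (x 0) (y k.succ) = -inner ℝ (x 0) (y 0) := by
    have : inner ℝ (x 0) (ε • ∑ k, μ k • y k.succ) = -inner ℝ (x 0) (y 0) := by
      rw [hy2, inner_neg_right]
    simpa only [real_inner_smul_right, inner_sum] using this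
  have h4 : ∑ k, μ k * inner ℝ (x k.succ - x 0) (y k.succ - y 0)
      = ∑ k, μ k * inner ℝ (x k.succ) (y k.succ) - ∑ k, μ k * inner ℝ (x k.succ) (y 0)
        - ∑ k, μ k * inner ℝ (x 0) (y k.succ) + (∑ k, μ k) * inner ℝ (x 0) (y 0) := by
    rw [Finset.sum_mul]
    simp only [← Finset.sum_sub_distrib, ← Finset.sum_add_distrib]
    refine Finset.sum_congr rfl fun k _ => ?_
    simp only [inner_sub_left, inner_sub_right]
    ring
  have h5 : ε * (ε / (1 + ε * ∑ k, μ k) *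
      inner ℝ (∑ k, μ k • (x k.succ - x 0)) (∑ k, μ k • (y k.succ - y 0)))
      = (1 + ε * ∑ k, μ k) * inner ℝ (x 0) (y 0) := by
    field_simp
    linear_combination h1
  rw [massForm, mul_sub, h5, h4]
  simp only [mul_assoc ε, ← Finset.mul_sum]
  linear_combination h2 + h3

/-- Displacements with centre of mass zero that have given displacements relative to the dominant
body. -/
noncomputable def lift (ε : ℝ) (μ : Fin n → ℝ) (x : Fin n → ℂ) : Fin (n + 1) → ℂ :=
  fun i => (Fin.cons 0 x : Fin (n + 1) → ℂ) i - (ε / (1 + ε * ∑ k, μ k)) • ∑ k, μ k • x k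

theorem lift_succ_sub (x : Fin n → ℂ) (k : Fin n) :
    lift ε μ x k.succ - lift ε μ x 0 = x k := by
  simp [lift]

theorem sum_mass_mul_lift (hM : 1 + ε * ∑ k, μ k ≠ 0) (x : Fin n → ℂ) :
    ∑ i, (smallMasses μ ε i : ℂ) * lift ε μ x i = 0 := by
  rw [Fin.sum_univ_succ]
  simp only [smallMasses, lift, Fin.cons_zero, Fin.cons_succ, mul_sub, Finset.sum_sub_distrib,
    ← Finset.sum_mul]
  simp only [Complex.real_smul]
  have hM' : (1 + ε * ∑ k, (μ k : ℂ)) ≠ 0 := by exact_mod_cast hM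
  push_cast
  simp only [mul_assoc, ← Finset.mul_sum]
  field_simp
  ring

/-- With the centre of mass at zero, relative displacements determine the absolute ones, so the two
forms of the linearized problem are equivalent. -/
theorem eq_lift (hM : 1 + ε * ∑ k, μ k ≠ 0) {y : Fin (n + 1) → ℂ} {x : Fin n → ℂ}
    (hy : ∑ i, (smallMasses μ ε i : ℂ) * y i = 0) (hx : ∀ k : Fin n, y k.succ - y 0 = x k) :
    y = lift ε μ x := by
  have h0 : y 0 = lift ε μ x 0 := by
    have h := sum_mass_mul_lift hM x
    rw [Fin.sum_univ_succ] at hy h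
    have e : ∀ k : Fin n, lift ε μ x k.succ = y k.succ - y 0 + lift ε μ x 0 := fun k => by
      rw [hx, ← lift_succ_sub (ε := ε) (μ := μ) x k]; ring
    simp only [e] at h
    simp only [smallMasses, Fin.cons_zero, Fin.cons_succ, mul_add, mul_sub,
      Finset.sum_add_distrib, Finset.sum_sub_distrib, ← Finset.sum_mul] at h hy
    have hM' : (1 + ∑ k, ((ε * μ k : ℝ) : ℂ)) ≠ 0 := by
      rw [Finset.mul_sum] at hM
      exact_mod_cast hM
    refine mul_left_cancel₀ hM' ?_
    push_cast at h hy ⊢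
    linear_combination hy - h
  funext i
  refine Fin.cases h0 (fun k => ?_) i
  have h1 := lift_succ_sub (ε := ε) (μ := μ) x k
  linear_combination hx k - h1 + h0

theorem sum_mass_mul_fderiv {N : ℕ} (m : Fin N → ℝ) {z : Fin N → ℂ} (hz : Function.Injective z)
    (ξ : Fin N → ℂ) : ∑ i, (m i : ℂ) * fderiv ℝ (gravAccel m) z ξ i = 0 := by
  simp only [fderiv_gravAccel m hz, ← Complex.real_smul, Finset.smul_sum, smul_smul]
  refine self_eq_neg.1 ?_
  conv_lhs => rw [Finset.sum_comm]
  rw [← Finset.sum_neg_distrib]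
  refine Finset.sum_congr rfl fun k _ => ?_
  rw [← Finset.sum_neg_distrib]
  refine Finset.sum_congr rfl fun l _ => ?_
  rw [← neg_sub (z l), tidal_neg, ← neg_sub (ξ l), map_neg, smul_neg, mul_comm]

theorem fderiv_gravAccel_succ_sub {z : Fin (n + 1) → ℂ} (hz : Function.Injective z)
    (ξ : Fin (n + 1) → ℂ) (k : Fin n) :
    ξ k.succ + fderiv ℝ (gravAccel (smallMasses μ ε)) z ξ k.succ
      - (ξ 0 + fderiv ℝ (gravAccel (smallMasses μ ε)) z ξ 0)
      = helioOp ε μ (fun k => z k.succ - z 0) (fun k => ξ k.succ - ξ 0) k := by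
  rw [fderiv_gravAccel _ hz, fderiv_gravAccel _ hz, helioOp_apply, Fin.sum_univ_succ,
    Fin.sum_univ_succ]
  simp only [smallMasses, Fin.cons_zero, Fin.cons_succ, one_smul, sub_self, map_zero, zero_add,
    sub_sub_sub_cancel_right, smul_sub, Finset.sum_sub_distrib, Finset.smul_sum, smul_smul]
  rw [← neg_sub (z k.succ) (z 0), tidal_neg, ← neg_sub (ξ k.succ) (ξ 0), map_neg]
  ring

/-- Solutions of the linearized equations of motion relative to the dominant body. -/
def IsHelioSolution (ε : ℝ) (μ : Fin n → ℝ) (q : Fin n → ℂ) (x y : ℝ → Fin n → ℂ) : Prop :=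
  ∀ t : ℝ, HasDerivAt x (y t) t ∧
    HasDerivAt y ((fun k => -2 * Complex.I * y t k) + helioOp ε μ q (x t)) t

theorem IsHelioSolution.of_isLinearizedSolution {z : Fin (n + 1) → ℂ} (hz : Function.Injective z)
    {ξ η : ℝ → Fin (n + 1) → ℂ} (h : IsLinearizedSolution (smallMasses μ ε) z ξ η) :
    IsHelioSolution ε μ (fun k => z k.succ - z 0) (fun t k => ξ t k.succ - ξ t 0)
      (fun t k => η t k.succ - η t 0) := by
  intro t
  obtain ⟨h1, h2⟩ := h t
  rw [hasDerivAt_pi] at h1 h2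
  refine ⟨hasDerivAt_pi.2 fun k => (h1 k.succ).fun_sub (h1 0), hasDerivAt_pi.2 fun k =>
    ((h2 k.succ).fun_sub (h2 0)).congr_deriv ?_⟩
  rw [Pi.add_apply, ← fderiv_gravAccel_succ_sub hz]
  ring

theorem lift_add (x y : Fin n → ℂ) : lift ε μ (x + y) = lift ε μ x + lift ε μ y := by
  funext i
  refine Fin.cases ?_ (fun k => ?_) i <;> simp [lift, Finset.sum_add_distrib] <;> ring

theorem lift_mul (c : ℂ) (x : Fin n → ℂ) (i : Fin (n + 1)) :
    lift ε μ (fun k => c * x k) i = c * lift ε μ x i := by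
  have e : ∑ k, μ k • (c * x k) = c * ∑ k, μ k • x k := by
    simp only [mul_smul_comm, Finset.mul_sum]
  refine Fin.cases ?_ (fun k => ?_) i <;> simp only [lift, e] <;> simp <;> ring

theorem hasDerivAt_lift {x : ℝ → Fin n → ℂ} {x' : Fin n → ℂ} {t : ℝ} (h : HasDerivAt x x' t) :
    HasDerivAt (fun t => lift ε μ (x t)) (lift ε μ x') t := by
  rw [hasDerivAt_pi] at h ⊢
  have hs : HasDerivAt (fun t => (ε / (1 + ε * ∑ k, μ k)) • ∑ k, μ k • x t k)
      ((ε / (1 + ε * ∑ k, μ k)) • ∑ k, μ k • x' k) t :=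
    (HasDerivAt.fun_sum fun k _ => (h k).fun_const_smul (μ k)).fun_const_smul _
  intro i
  refine Fin.cases ?_ (fun k => ?_) i
  · simpa [lift] using hs.fun_neg
  · simpa [lift] using (h k).fun_sub hs

theorem IsHelioSolution.lift {z : Fin (n + 1) → ℂ} (hz : Function.Injective z)
    (hM : 1 + ε * ∑ k, μ k ≠ 0) {x y : ℝ → Fin n → ℂ}
    (h : IsHelioSolution ε μ (fun k => z k.succ - z 0) x y) :
    IsLinearizedSolution (smallMasses μ ε) z (fun t => HallRing.lift ε μ (x t))
      (fun t => HallRing.lift ε μ (y t)) := by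
  intro t
  obtain ⟨h1, h2⟩ := h t
  refine ⟨hasDerivAt_lift h1, (hasDerivAt_lift h2).congr_deriv ?_⟩
  have e : HallRing.lift ε μ (helioOp ε μ (fun k => z k.succ - z 0) (x t))
      = HallRing.lift ε μ (x t) + fderiv ℝ (gravAccel (smallMasses μ ε)) z (HallRing.lift ε μ (x t)) := by
    refine (eq_lift hM ?_ fun k => ?_).symm
    · simp only [Pi.add_apply, mul_add, Finset.sum_add_distrib, sum_mass_mul_lift hM,
        sum_mass_mul_fderiv _ hz, add_zero]
    · rw [Pi.add_apply, Pi.add_apply, fderiv_gravAccel_succ_sub hz]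
      simp only [lift_succ_sub]
  rw [lift_add, e]
  funext i
  simp only [Pi.add_apply, lift_mul]
  ring

end HallRing

/-! ### Derivatives of Hall's potential and their mechanical meaning. -/

namespace HallRing

/-- The pair interaction in Hall's potential. -/
noncomputable def pairPot (φ : ℝ) : ℝ :=
  1 / (2 * |Real.sin (φ / 2)|) + (2 * |Real.sin (φ / 2)|) ^ 2 / 2

/-- The derivative of `pairPot`. -/
noncomputable def pairForce (φ : ℝ) : ℝ :=
  Real.sin φ - Real.sin φ / (8 * |Real.sin (φ / 2)| ^ 3)

theorem hasDerivAt_pairPot {φ : ℝ} (h : Real.sin (φ / 2) ≠ 0) :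
    HasDerivAt pairPot (pairForce φ) φ := by
  have hs : HasDerivAt (fun φ : ℝ => Real.sin (φ / 2)) (Real.cos (φ / 2) * (1 / 2)) φ :=
    ((hasDerivAt_id φ).div_const 2).sin
  have ha : HasDerivAt (fun φ : ℝ => |Real.sin (φ / 2)|)
      (SignType.sign (Real.sin (φ / 2)) * (Real.cos (φ / 2) * (1 / 2))) φ :=
    HasDerivAt.comp (h₂ := fun x : ℝ => |x|) φ (hasDerivAt_abs h) hs
  have h0 : |Real.sin (φ / 2)| ≠ 0 := abs_ne_zero.2 h
  have h1 := (((ha.const_mul 2).fun_inv (mul_ne_zero two_ne_zero h0)).fun_add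
    (((ha.const_mul 2).fun_pow 2).div_const 2))
  refine (h1.congr_deriv ?_).congr_of_eventuallyEq (.of_forall fun x => by
    rw [pairPot, one_div])
  have e : Real.sin φ = 2 * Real.sin (φ / 2) * Real.cos (φ / 2) := by
    rw [← Real.sin_two_mul]; congr 1; ring
  rw [pairForce, e]
  rcases lt_or_gt_of_ne h with hn | hp
  · rw [abs_of_neg hn, sign_neg hn]
    simp
    field_simp
    ring
  · rw [abs_of_pos hp, sign_pos hp]
    simp
    field_simp
    ring

theorem hasDerivAt_pairForce {φ : ℝ} (h : Real.sin (φ / 2) ≠ 0) :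
    HasDerivAt pairForce (hallF φ) φ := by
  have hs : HasDerivAt (fun φ : ℝ => Real.sin (φ / 2)) (Real.cos (φ / 2) * (1 / 2)) φ :=
    ((hasDerivAt_id φ).div_const 2).sin
  have ha : HasDerivAt (fun φ : ℝ => |Real.sin (φ / 2)|)
      (SignType.sign (Real.sin (φ / 2)) * (Real.cos (φ / 2) * (1 / 2))) φ :=
    HasDerivAt.comp (h₂ := fun x : ℝ => |x|) φ (hasDerivAt_abs h) hs
  have h0 : |Real.sin (φ / 2)| ≠ 0 := abs_ne_zero.2 h
  have h1 := (Real.hasDerivAt_sin φ).fun_sub ((Real.hasDerivAt_sin φ).fun_div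
    ((ha.fun_pow 3).const_mul 8) (by positivity))
  refine h1.congr_deriv ?_
  have e : Real.sin φ = 2 * Real.sin (φ / 2) * Real.cos (φ / 2) := by
    rw [← Real.sin_two_mul]; congr 1; ring
  have e2 : Real.cos φ = 1 - 2 * Real.sin (φ / 2) ^ 2 := by
    rw [← Real.cos_two_mul_eq_one_sub]; congr 1; ring
  have e3 : Real.cos (φ / 2) ^ 2 = 1 - Real.sin (φ / 2) ^ 2 := by
    rw [← Real.sin_sq_add_cos_sq (φ / 2)]; ring
  rw [hallF, e, e2]
  generalize Real.sin (φ / 2) = s at *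
  generalize Real.cos (φ / 2) = c at *
  rcases lt_or_gt_of_ne h with hn | hp
  · rw [abs_of_neg hn, sign_neg hn]
    simp
    field_simp
    ring_nf
    simp only [e3]
    ring
  · rw [abs_of_pos hp, sign_pos hp]
    simp
    field_simp
    ring_nf
    simp only [e3]
    ring

theorem pairPot_neg (φ : ℝ) : pairPot (-φ) = pairPot φ := by
  simp [pairPot, neg_div]

theorem pairForce_neg (φ : ℝ) : pairForce (-φ) = -pairForce φ := by
  simp [pairForce, neg_div]; ring

theorem hallF_neg (φ : ℝ) : hallF (-φ) = hallF φ := by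
  simp [hallF, neg_div]

variable {n : ℕ} {μ : Fin n → ℝ}

theorem hallPotential_eq (θ : Fin n → ℝ) :
    hallPotential μ θ = ∑ i, ∑ k ∈ Finset.Ioi i, μ i * μ k * pairPot (θ i - θ k) := by
  refine Finset.sum_congr rfl fun i _ => Finset.sum_congr rfl fun k _ => ?_
  rw [← pairPot_neg, neg_sub]
  rfl

theorem sum_Ioi_eq_half_sum (g : Fin n → Fin n → ℝ) (hg : ∀ i k, g i k = g k i)
    (h0 : ∀ i, g i i = 0) : ∑ i, ∑ k ∈ Finset.Ioi i, g i k = 1 / 2 * ∑ i, ∑ k, g i k := by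
  have h1 : ∑ i, ∑ k, g i k = ∑ i, ∑ k ∈ Finset.Ioi i, g i k + ∑ i, ∑ k ∈ Finset.Iio i, g i k := by
    rw [← Finset.sum_add_distrib]
    refine Finset.sum_congr rfl fun i _ => ?_
    rw [← Finset.sum_union (Finset.disjoint_left.2 fun k hk hk' => by
      simp at hk hk'; exact absurd hk (not_lt.2 hk'.le)),
      ← Finset.sum_erase (a := i) Finset.univ (f := fun k => g i k) (h0 i)]
    refine Finset.sum_congr (Finset.ext fun k => ?_) fun _ _ => rfl
    simp [eq_comm]
  have h2 : ∑ i, ∑ k ∈ Finset.Iio i, g i k = ∑ i, ∑ k ∈ Finset.Ioi i, g i k := by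
    rw [Finset.sum_comm' (t' := Finset.univ) (s' := fun k => Finset.Ioi k) (by simp)]
    exact Finset.sum_congr rfl fun k _ => Finset.sum_congr rfl fun i _ => hg _ _
  rw [h1, h2]; ring

/-- Distinct points of the circle. -/
def Separated (θ : Fin n → ℝ) : Prop := ∀ i k, i ≠ k → Real.sin ((θ i - θ k) / 2) ≠ 0

theorem Separated.eventually {θ : Fin n → ℝ} (h : Separated θ) : ∀ᶠ φ in 𝓝 θ, Separated φ := by
  simp only [Separated, eventually_all]
  intro i k hik
  exact ContinuousAt.eventually_ne (by fun_prop) (h i k hik)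

theorem fderiv_hallPotential {θ : Fin n → ℝ} (h : Separated θ) (i : Fin n) :
    fderiv ℝ (hallPotential μ) θ (Pi.single i 1) =
      ∑ k ∈ Finset.univ.erase i, μ i * μ k * pairForce (θ i - θ k) := by
  have h1 : HasFDerivAt (hallPotential μ) (∑ i, ∑ k ∈ Finset.Ioi i, (μ i * μ k) •
      (pairForce (θ i - θ k) • (ContinuousLinearMap.proj (R := ℝ) (φ := fun _ : Fin n => ℝ) i
        - ContinuousLinearMap.proj k))) θ := by
    rw [show hallPotential μ = _ from funext hallPotential_eq]
    refine HasFDerivAt.fun_sum fun i _ => HasFDerivAt.fun_sum fun k hk => HasFDerivAt.const_mul ?_ _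
    exact (hasDerivAt_pairPot (h i k (Finset.mem_Ioi.1 hk).ne)).comp_hasFDerivAt θ
      ((hasFDerivAt_apply (𝕜 := ℝ) (F' := fun _ : Fin n => ℝ) i θ).fun_sub (hasFDerivAt_apply k θ))
  rw [h1.fderiv]
  simp only [sum_apply, smul_apply, sub_apply, ContinuousLinearMap.proj_apply,
    smul_eq_mul]
  rw [sum_Ioi_eq_half_sum]
  · have e : ∀ a b : Fin n, μ a * μ b * (pairForce (θ a - θ b)
        * ((Pi.single i 1 : Fin n → ℝ) a - (Pi.single i 1 : Fin n → ℝ) b))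
        = (if a = i then μ i * μ b * pairForce (θ i - θ b) else 0)
          + (if b = i then μ i * μ a * pairForce (θ i - θ a) else 0) := by
      intro a b
      by_cases ha : a = i <;> by_cases hb : b = i
      · subst ha; subst hb; simp [pairForce]
      · subst ha; simp [hb]
      · subst hb
        simp only [Pi.single_apply, ha, if_false, if_true]
        rw [← neg_sub (θ b) (θ a), pairForce_neg]; ring
      · simp [ha, hb]
    simp only [e, Finset.sum_add_distrib]
    rw [Finset.sum_comm]
    simp only [Finset.sum_ite_eq', Finset.mem_univ, if_true]
    rw [← Finset.sum_erase (a := i) Finset.univ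
      (f := fun b => μ i * μ b * pairForce (θ i - θ b)) (by simp [pairForce])]
    ring
  · intro a b
    rw [← neg_sub (θ b) (θ a), pairForce_neg]; ring
  · intro a; simp

/-- The Hessian is a weighted graph Laplacian with weights `μ i * μ k * hallF (θ i - θ k)`. All
later computations with it use this form. -/
theorem hallHessian_mulVec {θ : Fin n → ℝ} (h : Separated θ) (v : Fin n → ℝ) (i : Fin n) :
    (hallHessian μ θ).mulVec v i = ∑ k, μ i * μ k * hallF (θ i - θ k) * (v i - v k) := by
  have h1 : HasFDerivAt (fun φ => fderiv ℝ (hallPotential μ) φ (Pi.single i 1))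
      (∑ k ∈ Finset.univ.erase i, (μ i * μ k) •
      (hallF (θ i - θ k) • (ContinuousLinearMap.proj (R := ℝ) (φ := fun _ : Fin n => ℝ) i
        - ContinuousLinearMap.proj k))) θ := by
    -- The gradient formula needs distinct angles, an open condition, so it may be differentiated in
    -- place of the gradient.
    refine HasFDerivAt.congr_of_eventuallyEq ?_
      (h.eventually.mono fun φ hφ => fderiv_hallPotential hφ i)
    refine HasFDerivAt.fun_sum fun k hk => HasFDerivAt.const_mul ?_ _
    exact (hasDerivAt_pairForce (h i k (Finset.ne_of_mem_erase hk).symm)).comp_hasFDerivAt θ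
      ((hasFDerivAt_apply (𝕜 := ℝ) (F' := fun _ : Fin n => ℝ) i θ).fun_sub (hasFDerivAt_apply k θ))
  have h2 : (hallHessian μ θ).mulVec v i =
      fderiv ℝ (fun φ => fderiv ℝ (hallPotential μ) φ (Pi.single i 1)) θ v := by
    conv_rhs => rw [pi_eq_sum_univ' v, map_sum]
    simp [Matrix.mulVec, dotProduct, hallHessian, mul_comm]
  rw [h2, h1.fderiv]
  simp only [sum_apply, smul_apply, sub_apply, ContinuousLinearMap.proj_apply,
    smul_eq_mul]
  rw [← Finset.sum_erase (a := i) Finset.univ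
    (f := fun k => μ i * μ k * hallF (θ i - θ k) * (v i - v k)) (by simp)]
  exact Finset.sum_congr rfl fun k _ => by ring

theorem hallHessian_form {θ : Fin n → ℝ} (h : Separated θ) (v w : Fin n → ℝ) :
    dotProduct w ((hallHessian μ θ).mulVec v) =
      1 / 2 * ∑ i, ∑ k, μ i * μ k * hallF (θ i - θ k) * (w i - w k) * (v i - v k) := by
  have e0 : dotProduct w ((hallHessian μ θ).mulVec v)
      = ∑ i, ∑ k, w i * (μ i * μ k * hallF (θ i - θ k) * (v i - v k)) := by
    simp only [dotProduct, hallHessian_mulVec h, Finset.mul_sum]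
  have e : ∑ i, ∑ k, w k * (μ i * μ k * hallF (θ i - θ k) * (v i - v k)) =
      -∑ i, ∑ k, w i * (μ i * μ k * hallF (θ i - θ k) * (v i - v k)) := by
    rw [Finset.sum_comm, ← Finset.sum_neg_distrib]
    refine Finset.sum_congr rfl fun i _ => ?_
    rw [← Finset.sum_neg_distrib]
    refine Finset.sum_congr rfl fun k _ => ?_
    rw [← neg_sub (θ i), hallF_neg]; ring
  have e2 : ∀ i k, μ i * μ k * hallF (θ i - θ k) * (w i - w k) * (v i - v k)
      = w i * (μ i * μ k * hallF (θ i - θ k) * (v i - v k))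
        - w k * (μ i * μ k * hallF (θ i - θ k) * (v i - v k)) := fun i k => by ring
  simp only [e2, Finset.sum_sub_distrib, e, e0]
  ring

theorem hallHessian_isHermitian {θ : Fin n → ℝ} (h : Separated θ) :
    (hallHessian μ θ).IsHermitian := by
  refine Matrix.IsHermitian.ext fun i k => ?_
  have e : ∀ a b, hallHessian μ θ a b
      = dotProduct (Pi.single a 1) ((hallHessian μ θ).mulVec (Pi.single b 1)) := by
    intro a b; simp
  rw [e, e, hallHessian_form h, hallHessian_form h]
  simp only [star_trivial]
  congr 1
  exact Finset.sum_congr rfl fun _ _ => Finset.sum_congr rfl fun _ _ => by ring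

theorem norm_exp_sub_exp (α β : ℝ) : ‖Complex.exp (β * Complex.I) - Complex.exp (α * Complex.I)‖
    = 2 * |Real.sin ((β - α) / 2)| := by
  have h : ‖Complex.exp (β * Complex.I) - Complex.exp (α * Complex.I)‖ ^ 2
      = (2 * |Real.sin ((β - α) / 2)|) ^ 2 := by
    rw [mul_pow, sq_abs, Complex.sq_norm, Complex.normSq_apply]
    simp only [Complex.sub_re, Complex.sub_im, Complex.exp_ofReal_mul_I_re,
      Complex.exp_ofReal_mul_I_im]
    have h1 : Real.cos (β - α) = 1 - 2 * Real.sin ((β - α) / 2) ^ 2 := by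
      rw [← Real.cos_two_mul_eq_one_sub]; congr 1; ring
    rw [Real.cos_sub] at h1
    nlinarith [Real.sin_sq_add_cos_sq α, Real.sin_sq_add_cos_sq β]
  exact (pow_left_inj₀ (norm_nonneg _) (by positivity) two_ne_zero).1 h

theorem inner_I_exp (α β : ℝ) : inner ℝ (Complex.I * Complex.exp (α * Complex.I))
    (Complex.exp (β * Complex.I)) = Real.sin (β - α) := by
  simp only [Complex.inner, Real.sin_sub]
  simp [Complex.exp_ofReal_mul_I_re, Complex.exp_ofReal_mul_I_im]


theorem inner_exp (α β : ℝ) : inner ℝ (Complex.exp (α * Complex.I))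
    (Complex.exp (β * Complex.I)) = Real.cos (β - α) := by
  simp only [Complex.inner, Real.cos_sub]
  simp [Complex.exp_ofReal_mul_I_re, Complex.exp_ofReal_mul_I_im]

/-- This identifies the tangential perturbing force, the indirect term through the dominant body
included, with the gradient of Hall's potential. -/
theorem inner_I_newton (α β : ℝ) :
    inner ℝ (Complex.I * Complex.exp (α * Complex.I))
      (newton (Complex.exp (β * Complex.I) - Complex.exp (α * Complex.I))
        - newton (Complex.exp (β * Complex.I))) = -pairForce (β - α) := by
  have hself : inner ℝ (Complex.I * Complex.exp (α * Complex.I)) (Complex.exp (α * Complex.I)) = 0 := by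
    rw [inner_I_exp]; simp
  rw [newton, newton, norm_exp_sub_exp, Complex.norm_exp_ofReal_mul_I, inner_sub_right,
    real_inner_smul_right, real_inner_smul_right, inner_sub_right, hself, inner_I_exp, pairForce,
    mul_pow]
  field_simp
  ring

/-- The second order counterpart: the tangential response to tangential displacements is governed by
the entries of Hall's Hessian. -/
theorem inner_I_tidal {α β : ℝ} (h : Real.sin ((β - α) / 2) ≠ 0) :
    inner ℝ (Complex.I * Complex.exp (α * Complex.I))
      (tidal (Complex.exp (β * Complex.I) - Complex.exp (α * Complex.I))
        (Complex.I * Complex.exp (β * Complex.I))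
        - Complex.I * newton (Complex.exp (β * Complex.I))) = -hallF (β - α) := by
  have hII : ∀ x y : ℂ, inner ℝ (Complex.I * x) (Complex.I * y) = inner ℝ x y := by
    intro x y; simp [Complex.inner]
  have hself : inner ℝ (Complex.I * Complex.exp (α * Complex.I)) (Complex.exp (α * Complex.I)) = 0 := by
    rw [inner_I_exp]; simp
  have hself' : inner ℝ (Complex.I * Complex.exp (β * Complex.I)) (Complex.exp (β * Complex.I)) = 0 := by
    rw [inner_I_exp]; simp
  rw [tidal_apply, newton, norm_exp_sub_exp, Complex.norm_exp_ofReal_mul_I]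
  simp only [one_pow, inv_one, one_smul, inner_sub_right, real_inner_smul_right, hII, inner_exp,
    real_inner_comm (Complex.I * _), inner_I_exp, hself, hself', hallF]
  have e : Real.sin (β - α) = 2 * Real.sin ((β - α) / 2) * Real.cos ((β - α) / 2) := by
    rw [← Real.sin_two_mul]; congr 1; ring
  have e1 : Real.sin (α - β) = -Real.sin (β - α) := by rw [← Real.sin_neg]; congr 1; ring
  have e2 : Real.cos (β - α) = 1 - 2 * Real.sin ((β - α) / 2) ^ 2 := by
    rw [← Real.cos_two_mul_eq_one_sub]; congr 1; ring
  have e3 : Real.cos ((β - α) / 2) ^ 2 = 1 - Real.sin ((β - α) / 2) ^ 2 := by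
    rw [← Real.sin_sq_add_cos_sq ((β - α) / 2)]; ring
  have e4 : Real.sin ((β - α) / 2) ^ 2 = |Real.sin ((β - α) / 2)| ^ 2 := (sq_abs _).symm
  have e5 : Real.sin (β - α) ^ 2
      = 4 * |Real.sin ((β - α) / 2)| ^ 2 * (1 - |Real.sin ((β - α) / 2)| ^ 2) := by
    rw [e, ← e4, ← e3]; ring
  have e6 : ∀ x y : ℝ, x * (0 - -y) * (y - 0) = x * y ^ 2 := fun x y => by ring
  have h0 : |Real.sin ((β - α) / 2)| ≠ 0 := abs_ne_zero.2 h
  rw [e1, e6, e5, e2, e4]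
  field_simp
  ring

end HallRing

/-! ### First integrals of the linearized flow and boundedness. -/

namespace HallRing

variable {n : ℕ} {ε : ℝ} {μ : Fin n → ℝ}

/-- The system is linear and autonomous, so each integral yields another one, evaluated on the
differentiated solution. -/
theorem IsHelioSolution.deriv {q : Fin n → ℂ} {x y : ℝ → Fin n → ℂ}
    (h : IsHelioSolution ε μ q x y) :
    IsHelioSolution ε μ q y (fun t => (fun k => -2 * Complex.I * y t k) + helioOp ε μ q (x t)) := by
  intro t
  obtain ⟨h1, h2⟩ := h t
  refine ⟨h2, HasDerivAt.fun_add (hasDerivAt_pi.2 fun k => ?_) ?_⟩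
  · exact ((hasDerivAt_pi.1 h2) k).const_mul _
  · exact (helioOp ε μ q).hasFDerivAt.comp_hasDerivAt t h1

theorem hasDerivAt_massForm {x y : ℝ → Fin n → ℂ} {x' y' : Fin n → ℂ} {t : ℝ}
    (hx : HasDerivAt x x' t) (hy : HasDerivAt y y' t) :
    HasDerivAt (fun t => massForm ε μ (x t) (y t))
      (massForm ε μ (x t) y' + massForm ε μ x' (y t)) t := by
  rw [hasDerivAt_pi] at hx hy
  have hs : ∀ {x : ℝ → Fin n → ℂ} {x' : Fin n → ℂ}, (∀ i, HasDerivAt (fun t => x t i) (x' i) t) →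
      HasDerivAt (fun t => ∑ k, μ k • x t k) (∑ k, μ k • x' k) t := fun h =>
    HasDerivAt.fun_sum fun k _ => (h k).fun_const_smul (μ k)
  have h := (HasDerivAt.fun_sum fun k (_ : k ∈ Finset.univ) =>
    (((hx k).inner ℝ (hy k)).const_mul (μ k))).fun_sub
      (((hs hx).inner ℝ (hs hy)).const_mul (ε / (1 + ε * ∑ k, μ k)))
  refine h.congr_deriv ?_
  simp only [massForm, mul_add, Finset.sum_add_distrib]
  ring

/-- A combination of the energies of a solution and of its derivative. -/
noncomputable def energyForm (ε : ℝ) (μ : Fin n → ℝ) (q x y : Fin n → ℂ) : ℝ :=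
  2 * (massForm ε μ ((fun k => -2 * Complex.I * y k) + helioOp ε μ q x)
      ((fun k => -2 * Complex.I * y k) + helioOp ε μ q x) - massForm ε μ y (helioOp ε μ q y))
    - (massForm ε μ y y - massForm ε μ x (helioOp ε μ q x))

theorem massForm_I_self (x : Fin n → ℂ) :
    massForm ε μ x (fun k => -2 * Complex.I * x k) = 0 := by
  have h := massForm_I_left (ε := ε) (μ := μ) x x
  have e : (fun k => -2 * Complex.I * x k) = (-2 : ℝ) • fun k => Complex.I * x k := by
    funext k; simp; ring
  rw [massForm_symm] at h
  rw [e, massForm_smul_right]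
  linarith

/-- The Coriolis term does no work, and `helioOp` is symmetric. -/
theorem IsHelioSolution.energy_const {q : Fin n → ℂ} {x y : ℝ → Fin n → ℂ}
    (hM : 1 + ε * ∑ k, μ k ≠ 0) (h : IsHelioSolution ε μ q x y) (t : ℝ) :
    HasDerivAt (fun t => massForm ε μ (y t) (y t) - massForm ε μ (x t) (helioOp ε μ q (x t))) 0 t := by
  obtain ⟨h1, h2⟩ := h t
  refine ((hasDerivAt_massForm h2 h2).fun_sub (hasDerivAt_massForm h1
    ((helioOp ε μ q).hasFDerivAt.comp_hasDerivAt t h1))).congr_deriv ?_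
  have e1 : massForm ε μ (x t) (helioOp ε μ q (y t)) = massForm ε μ (y t) (helioOp ε μ q (x t)) := by
    rw [helioOp_symm hM, massForm_symm]
  have e2 := massForm_I_self (ε := ε) (μ := μ) (y t)
  simp only [massForm_add_right, e1, e2, Function.comp_apply,
    massForm_symm _ (y t)]
  ring

theorem IsHelioSolution.energyForm_const {q : Fin n → ℂ} {x y : ℝ → Fin n → ℂ}
    (hM : 1 + ε * ∑ k, μ k ≠ 0) (h : IsHelioSolution ε μ q x y) (t : ℝ) :
    energyForm ε μ q (x t) (y t) = energyForm ε μ q (x 0) (y 0) := by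
  have hd : ∀ t, HasDerivAt (fun t => energyForm ε μ q (x t) (y t)) 0 t := fun t =>
    (((h.deriv.energy_const hM t).const_mul 2).fun_sub (h.energy_const hM t)).congr_deriv (by simp)
  exact is_const_of_deriv_eq_zero (fun t => (hd t).differentiableAt) (fun t => (hd t).deriv) t 0

/-- A linear first integral under the constraint of vanishing angular momentum. -/
noncomputable def phaseForm (ε : ℝ) (μ : Fin n → ℝ) (q x y : Fin n → ℂ) : ℝ :=
  massForm ε μ x (fun k => Complex.I * q k) - 2 * massForm ε μ y q

theorem massForm_smul_I_left (x y : Fin n → ℂ) :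
    massForm ε μ (fun k => -2 * Complex.I * x k) y = 2 * massForm ε μ x (fun k => Complex.I * y k) := by
  have e : (fun k => -2 * Complex.I * x k) = (-2 : ℝ) • fun k => Complex.I * x k := by
    funext k; simp; ring
  rw [e, massForm_smul_left, massForm_I_left]
  ring

theorem hasDerivAt_massForm_const {x : ℝ → Fin n → ℂ} {x' : Fin n → ℂ} {t : ℝ}
    (hx : HasDerivAt x x' t) (y : Fin n → ℂ) :
    HasDerivAt (fun t => massForm ε μ (x t) y) (massForm ε μ x' y) t := by
  have h0 : massForm ε μ (x t) 0 = 0 := by simp [massForm]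
  simpa [h0] using hasDerivAt_massForm (ε := ε) (μ := μ) hx (hasDerivAt_const t y)

/-- The derivative is `-3` times the constraint `hc`, the 3 coming from `helioOp_self`. This
integral is needed because `energyForm` does not see rotations of the configuration. -/
theorem IsHelioSolution.phaseForm_const {q : Fin n → ℂ} {x y : ℝ → Fin n → ℂ}
    (hM : 1 + ε * ∑ k, μ k ≠ 0) (hq : IsHelioEq ε μ q) (h : IsHelioSolution ε μ q x y)
    (hc : ∀ t, 2 * massForm ε μ (x t) q + massForm ε μ (y t) (fun k => Complex.I * q k) = 0)
    (t : ℝ) : phaseForm ε μ q (x t) (y t) = phaseForm ε μ q (x 0) (y 0) := by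
  have hd : ∀ t, HasDerivAt (fun t => phaseForm ε μ q (x t) (y t)) 0 t := by
    intro t
    obtain ⟨h1, h2⟩ := h t
    refine ((hasDerivAt_massForm_const h1 _).fun_sub
      ((hasDerivAt_massForm_const h2 q).const_mul 2)).congr_deriv ?_
    rw [massForm_add_left, massForm_smul_I_left, ← helioOp_symm hM, helioOp_self hq,
      massForm_smul_right]
    linarith [hc t]
  exact is_const_of_deriv_eq_zero (fun t => (hd t).differentiableAt) (fun t => (hd t).deriv) t 0

theorem continuous_massForm :
    Continuous fun p : (Fin n → ℂ) × (Fin n → ℂ) => massForm ε μ p.1 p.2 := by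
  simp only [massForm]
  fun_prop

theorem fderiv_angularMomentum_eq (hM : 1 + ε * ∑ k, μ k ≠ 0) {z ξ η : Fin (n + 1) → ℂ}
    (hz : ∑ i, (smallMasses μ ε i : ℂ) * z i = 0) (hξ : ∑ i, (smallMasses μ ε i : ℂ) * ξ i = 0)
    (hη : ∑ i, (smallMasses μ ε i : ℂ) * η i = 0) :
    fderiv ℝ (angularMomentum (smallMasses μ ε)) (z, 0) (ξ, η) =
      ε * (2 * massForm ε μ (fun k => ξ k.succ - ξ 0) (fun k => z k.succ - z 0)
        + massForm ε μ (fun k => η k.succ - η 0) (fun k => Complex.I * (z k.succ - z 0))) := by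
  have hIz : ∑ i, (smallMasses μ ε i : ℂ) * (Complex.I * z i) = 0 := by
    simp only [mul_left_comm _ Complex.I, ← Finset.mul_sum, hz, mul_zero]
  have h1 := sum_mass_mul_inner hM hξ hz
  have h2 := sum_mass_mul_inner hM hη hIz
  rw [fderiv_angularMomentum]
  simp only [mul_add, Finset.sum_add_distrib, h2, mul_left_comm _ (2 : ℝ), ← Finset.mul_sum, h1,
    mul_sub]

/-- A positive definite first integral bounds the solutions. -/
theorem isLinearlyStable_of_pos {z : Fin (n + 1) → ℂ} (hε : 0 < ε) (hμ : ∀ k, 0 < μ k)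
    (hz : IsRelativeEquilibrium (smallMasses μ ε) z)
    (hpos : ∀ x y : Fin n → ℂ, (x, y) ≠ 0 → 0 < energyForm ε μ (fun k => z k.succ - z 0) x y
      + phaseForm ε μ (fun k => z k.succ - z 0) x y ^ 2) :
    IsLinearlyStable (smallMasses μ ε) z := by
  have hM' : 0 < 1 + ε * ∑ k, μ k := by
    have : 0 ≤ ∑ k, μ k := Finset.sum_nonneg fun k _ => (hμ k).le
    positivity
  have hM := hM'.ne'
  have hq := IsHelioEq.of_isRelativeEquilibrium hz
  set q : Fin n → ℂ := fun k => z k.succ - z 0 with hqdef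
  intro ξ η hsol hξ hang
  -- Differentiating the centre of mass constraint gives the same constraint for the velocities.
  have hη : ∀ t, ∑ i, (smallMasses μ ε i : ℂ) * η t i = 0 := by
    intro t
    have h1 : HasDerivAt (fun t => ∑ i, (smallMasses μ ε i : ℂ) * ξ t i)
        (∑ i, (smallMasses μ ε i : ℂ) * η t i) t :=
      HasDerivAt.fun_sum fun i _ => ((hasDerivAt_pi.1 (hsol t).1) i).const_mul _
    simp only [hξ] at h1
    exact h1.unique (hasDerivAt_const t 0)
  set x : ℝ → Fin n → ℂ := fun t k => ξ t k.succ - ξ t 0 with hx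
  set y : ℝ → Fin n → ℂ := fun t k => η t k.succ - η t 0 with hy
  have hh : IsHelioSolution ε μ q x y := .of_isLinearizedSolution hz.1 hsol
  have hc : ∀ t, 2 * massForm ε μ (x t) q + massForm ε μ (y t) (fun k => Complex.I * q k) = 0 := by
    intro t
    have h1 := hang t
    rw [fderiv_angularMomentum_eq hM hz.2.1 (hξ t) (hη t)] at h1
    exact (mul_eq_zero.1 h1).resolve_left hε.ne'
  set F : (Fin n → ℂ) × (Fin n → ℂ) → ℝ := fun p => energyForm ε μ q p.1 p.2
    + phaseForm ε μ q p.1 p.2 ^ 2 with hF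
  have hB : ∀ {f g : (Fin n → ℂ) × (Fin n → ℂ) → Fin n → ℂ}, Continuous f → Continuous g →
      Continuous fun p => massForm ε μ (f p) (g p) := fun hf hg =>
    continuous_massForm.comp (hf.prodMk hg)
  have hFc : Continuous F := by
    have hK : Continuous fun p : (Fin n → ℂ) × (Fin n → ℂ) =>
        (fun k => -2 * Complex.I * p.2 k) + helioOp ε μ q p.1 := by fun_prop
    refine Continuous.add (Continuous.sub (continuous_const.mul ((hB hK hK).sub
      (hB continuous_snd (by fun_prop)))) ((hB continuous_snd continuous_snd).sub
      (hB continuous_fst (by fun_prop)))) (Continuous.pow (Continuous.sub (hB continuous_fst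
      continuous_const) (continuous_const.mul (hB continuous_snd continuous_const))) 2)
  have hscale : ∀ (c : ℝ) p, F (c • p) = c ^ 2 * F p := by
    intro c p
    have e : (fun k => -2 * Complex.I * (c • p).2 k) + helioOp ε μ q (c • p).1
        = c • ((fun k => -2 * Complex.I * p.2 k) + helioOp ε μ q p.1) := by
      rw [Prod.smul_fst, map_smul, smul_add]
      congr 1
      funext k
      simp
      ring
    simp only [hF, energyForm, phaseForm, e]
    simp only [Prod.smul_fst, Prod.smul_snd, map_smul, massForm_smul_left, massForm_smul_right]
    ring
  -- A positive quadratic form is bounded below on the compact unit sphere, hence by a multiple of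
  -- the squared norm. Without light bodies the sphere is empty, so that case is separate.
  obtain ⟨c, hc0, hcF⟩ : ∃ c, 0 < c ∧ ∀ p, c * ‖p‖ ^ 2 ≤ F p := by
    rcases isEmpty_or_nonempty (Fin n) with hn | hn
    · refine ⟨1, one_pos, fun p => ?_⟩
      have : p = 0 := Subsingleton.elim _ _
      subst this
      have := hscale 0 0
      simp at this
      simp [this]
    · have hne : (Metric.sphere (0 : (Fin n → ℂ) × (Fin n → ℂ)) 1).Nonempty :=
        NormedSpace.sphere_nonempty.2 zero_le_one
      obtain ⟨p0, hp0, hmin⟩ := (isCompact_sphere (0 : (Fin n → ℂ) × (Fin n → ℂ)) 1).exists_isMinOn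
        hne hFc.continuousOn
      have hp0' : p0 ≠ 0 := by
        rintro rfl; simp at hp0
      refine ⟨F p0, hpos p0.1 p0.2 hp0', fun p => ?_⟩
      rcases eq_or_ne p 0 with rfl | hp
      · have := hscale 0 0
        simp at this
        simp [this]
      · have hnp : ‖p‖ ≠ 0 := norm_ne_zero_iff.2 hp
        have h1 : F p0 ≤ F (‖p‖⁻¹ • p) := hmin (by simp [norm_smul, hnp])
        rw [hscale] at h1
        calc F p0 * ‖p‖ ^ 2 ≤ (‖p‖⁻¹) ^ 2 * F p * ‖p‖ ^ 2 := by gcongr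
          _ = F p := by field_simp
  have hconst : ∀ t, F (x t, y t) = F (x 0, y 0) := fun t => by
    simp only [hF, hh.energyForm_const hM t, hh.phaseForm_const hM hq hc t]
  obtain ⟨R, hR⟩ : ∃ R, ∀ t, ‖(x t, y t)‖ ≤ R := by
    refine ⟨√(F (x 0, y 0) / c), fun t => Real.le_sqrt_of_sq_le ?_⟩
    rw [le_div_iff₀ hc0, mul_comm, ← hconst t]
    exact hcF _
  have hlift : ∀ w : Fin n → ℂ, ‖w‖ ≤ R →
      ‖lift ε μ w‖ ≤ R + ‖ε / (1 + ε * ∑ k, μ k)‖ * ∑ k, |μ k| * R := by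
    intro w hw
    have hR0 : 0 ≤ R := (norm_nonneg _).trans hw
    have h2 : ‖(ε / (1 + ε * ∑ k, μ k)) • ∑ k, μ k • w k‖
        ≤ ‖ε / (1 + ε * ∑ k, μ k)‖ * ∑ k, |μ k| * R := by
      rw [norm_smul]
      gcongr
      refine (norm_sum_le _ _).trans (Finset.sum_le_sum fun k _ => ?_)
      rw [norm_smul, Real.norm_eq_abs]
      gcongr
      exact (norm_le_pi_norm w k).trans hw
    refine (pi_norm_le_iff_of_nonneg (add_nonneg hR0 ((norm_nonneg _).trans h2))).2 fun i => ?_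
    refine (norm_sub_le _ _).trans (add_le_add ?_ h2)
    refine Fin.cases ?_ (fun k => ?_) i
    · simpa using hR0
    · simpa using (norm_le_pi_norm w k).trans hw
  refine ⟨R + ‖ε / (1 + ε * ∑ k, μ k)‖ * ∑ k, |μ k| * R, fun t => ⟨?_, ?_⟩⟩
  · rw [eq_lift hM (hξ t) (x := x t) fun k => rfl]
    exact hlift _ ((norm_fst_le (x t, y t)).trans (hR t))
  · rw [eq_lift hM (hη t) (x := y t) fun k => rfl]
    exact hlift _ ((norm_snd_le (x t, y t)).trans (hR t))

end HallRing

/-! ### Rescaled tangential displacements and positivity at a minimum. -/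

namespace HallRing

variable {n : ℕ} {ε : ℝ} {μ : Fin n → ℝ}

/-- Radial displacements. -/
noncomputable def radial (q : Fin n → ℂ) (u : Fin n → ℝ) : Fin n → ℂ := fun k => u k • q k

/-- Tangential displacements. -/
noncomputable def tangential (q : Fin n → ℂ) (s : Fin n → ℝ) : Fin n → ℂ := fun k => s k • (Complex.I * q k)

/-- The force due to tangential displacements at a relative equilibrium, divided by `ε`. -/
noncomputable def angularForce (μ : Fin n → ℝ) (q : Fin n → ℂ) (s : Fin n → ℝ) : Fin n → ℂ :=
  fun k => ∑ l, (μ l * (s l - s k)) •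
    (tidal (q l - q k) (Complex.I * q l) - Complex.I * newton (q l))

theorem helioOp_tangential {q : Fin n → ℂ} (h : IsHelioEq ε μ q) (s : Fin n → ℝ) :
    helioOp ε μ q (tangential q s) = ε • angularForce μ q s :=
  funext fun k => helioOp_I_smul h s k

theorem exists_radial_tangential {q : Fin n → ℂ} (hq : ∀ k, q k ≠ 0) (x : Fin n → ℂ) :
    ∃ u s, x = radial q u + tangential q s := by
  refine ⟨fun k => (x k / q k).re, fun k => (x k / q k).im, funext fun k => ?_⟩
  have : x k = x k / q k * q k := (div_mul_cancel₀ _ (hq k)).symm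
  rw [Pi.add_apply, radial, tangential, Complex.real_smul, Complex.real_smul]
  linear_combination this - q k * Complex.re_add_im (x k / q k)

theorem tangential_smul (q : Fin n → ℂ) (c : ℝ) (s : Fin n → ℝ) :
    tangential q (c • s) = c • tangential q s := by
  funext k; simp [tangential]; ring

theorem radial_smul (q : Fin n → ℂ) (c : ℝ) (s : Fin n → ℝ) :
    radial q (c • s) = c • radial q s := by
  funext k; simp [radial]; ring

theorem tangential_add (q : Fin n → ℂ) (s t : Fin n → ℝ) :
    tangential q (s + t) = tangential q s + tangential q t := by
  funext k; simp [tangential]; ring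

theorem angularForce_smul (q : Fin n → ℂ) (c : ℝ) (s : Fin n → ℝ) :
    angularForce μ q (c • s) = c • angularForce μ q s := by
  funext k
  simp only [angularForce, Pi.smul_apply, Finset.smul_sum, smul_smul, smul_eq_mul]
  exact Finset.sum_congr rfl fun l _ => by congr 1; ring

/-- `energyForm` in radial and rescaled tangential coordinates. -/
noncomputable def reducedForm (μ : Fin n → ℝ) (τ : ℝ) (q : Fin n → ℂ) (u a b σ : Fin n → ℝ) : ℝ :=
  2 * (massForm (τ ^ 2) μ
      ((fun k => -2 * Complex.I * (radial q a + tangential q b) k)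
        + (helioOp (τ ^ 2) μ q (radial q u) + τ • angularForce μ q σ))
      ((fun k => -2 * Complex.I * (radial q a + tangential q b) k)
        + (helioOp (τ ^ 2) μ q (radial q u) + τ • angularForce μ q σ))
    - massForm (τ ^ 2) μ (radial q a + tangential q b)
      (helioOp (τ ^ 2) μ q (radial q a) + τ • angularForce μ q (τ • b)))
  - (massForm (τ ^ 2) μ (radial q a + tangential q b) (radial q a + tangential q b)
    - (massForm (τ ^ 2) μ (radial q u) (helioOp (τ ^ 2) μ q (radial q u) + τ • angularForce μ q σ)
      + massForm (τ ^ 2) μ (tangential q σ) (angularForce μ q σ)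
      + τ * massForm (τ ^ 2) μ (angularForce μ q σ) (radial q u)))

/-- With `ε = τ²` and `σ = τ s`, the factor `ε` produced by each tangential displacement is shared
out so that no negative power of `τ` remains. Thus `reducedForm` makes sense, and is continuous, at
`τ = 0`, where the original coordinates degenerate. -/
theorem energyForm_eq_reducedForm {τ : ℝ} {q : Fin n → ℂ} (hM : 1 + τ ^ 2 * ∑ k, μ k ≠ 0)
    (h : IsHelioEq (τ ^ 2) μ q) (u a b s : Fin n → ℝ) :
    energyForm (τ ^ 2) μ q (radial q u + tangential q s) (radial q a + tangential q b)
      = reducedForm μ τ q u a b (τ • s) := by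
  have e : ∀ u s, helioOp (τ ^ 2) μ q (radial q u + tangential q s)
      = helioOp (τ ^ 2) μ q (radial q u) + τ • angularForce μ q (τ • s) := by
    intro u s
    rw [map_add, helioOp_tangential h, angularForce_smul, smul_smul, sq]
  -- Symmetry moves the operator onto the tangential factor, which gains another `τ²`.
  have e2 : massForm (τ ^ 2) μ (tangential q s) (helioOp (τ ^ 2) μ q (radial q u))
      = τ ^ 2 * massForm (τ ^ 2) μ (angularForce μ q s) (radial q u) := by
    rw [helioOp_symm hM, helioOp_tangential h, massForm_smul_left]
  rw [energyForm, reducedForm, e, e, massForm_add_left (radial q u) (tangential q s),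
    massForm_add_right _ _ (tangential q s), e2]
  simp only [massForm_smul_right, massForm_smul_left, angularForce_smul, tangential_smul]
  ring

/-- Common rotations lie in the kernel of the symmetric operator `helioOp`. -/
theorem energyForm_add_rotation {q : Fin n → ℂ} (hM : 1 + ε * ∑ k, μ k ≠ 0)
    (h : IsHelioEq ε μ q) (c : ℝ) (x y : Fin n → ℂ) :
    energyForm ε μ q (x + tangential q (fun _ => c)) y = energyForm ε μ q x y := by
  have e : helioOp ε μ q (tangential q (fun _ => c)) = 0 := by
    have h1 := helioOp_tangential h (fun _ => c)
    rw [h1]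
    funext k
    simp [angularForce]
  rw [energyForm, energyForm, map_add, e, add_zero, massForm_add_left x,
    helioOp_symm hM (x := tangential q _), e]
  simp [massForm]

section continuity

variable {X : Type*} [TopologicalSpace X] {p : X} {q : X → Fin n → ℂ}

theorem continuousAt_tidal_sub {w h : X → ℂ} (hw : ContinuousAt w p)
    (hh : ContinuousAt h p) (hne : w p ≠ 0) : ContinuousAt (fun p => tidal (w p) (h p)) p :=
  (continuousAt_tidal_uncurry hne (h p)).comp (f := fun p => (w p, h p)) (hw.prodMk hh)

theorem continuousAt_helioOp {e : X → ℝ} {x : X → Fin n → ℂ} (he : ContinuousAt e p)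
    (hq : ContinuousAt q p) (hx : ContinuousAt x p) (hne : ∀ k, q p k ≠ 0)
    (hinj : Function.Injective (q p)) :
    ContinuousAt (fun p => helioOp (e p) μ (q p) (x p)) p := by
  rw [continuousAt_pi]
  intro k
  have hq' := continuousAt_pi.1 hq
  have hx' := continuousAt_pi.1 hx
  simp only [helioOp_apply]
  refine ((hx' k).sub (continuousAt_tidal_sub (hq' k) (hx' k) (hne k))).add
    (he.smul (tendsto_finsetSum _ fun l _ => ContinuousAt.const_smul (ContinuousAt.sub ?_
      (continuousAt_tidal_sub (hq' l) (hx' l) (hne l))) (μ l)))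
  -- `tidal` is not continuous at zero, but the diagonal term vanishes identically.
  by_cases hkl : l = k
  · subst hkl
    simpa using continuousAt_const
  · exact continuousAt_tidal_sub ((hq' l).sub (hq' k)) ((hx' l).sub (hx' k))
      (sub_ne_zero.2 fun h => hkl (hinj h))

theorem continuousAt_angularForce {s : X → Fin n → ℝ}
    (hq : ContinuousAt q p) (hs : ContinuousAt s p) (hne : ∀ k, q p k ≠ 0)
    (hinj : Function.Injective (q p)) :
    ContinuousAt (fun p => angularForce μ (q p) (s p)) p := by
  rw [continuousAt_pi]
  intro k
  have hq' := continuousAt_pi.1 hq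
  have hs' := continuousAt_pi.1 hs
  simp only [angularForce]
  refine tendsto_finsetSum _ fun l _ => ?_
  by_cases hkl : l = k
  · subst hkl
    simp
  · exact (continuousAt_const.mul ((hs' l).sub (hs' k))).smul
      ((continuousAt_tidal_sub ((hq' l).sub (hq' k)) (continuousAt_const.mul (hq' l))
        (sub_ne_zero.2 fun h => hkl (hinj h))).sub (continuousAt_const.mul
        (ContinuousAt.comp (f := fun p => q p l) (continuousAt_newton (hne l)) (hq' l))))

theorem continuousAt_massForm {e : X → ℝ} {x y : X → Fin n → ℂ} (he : ContinuousAt e p)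
    (hx : ContinuousAt x p) (hy : ContinuousAt y p) (hM : 1 + e p * ∑ k, μ k ≠ 0) :
    ContinuousAt (fun p => massForm (e p) μ (x p) (y p)) p := by
  simp only [massForm]
  have hx' := continuousAt_pi.1 hx
  have hy' := continuousAt_pi.1 hy
  refine ContinuousAt.sub (by fun_prop) (ContinuousAt.mul (he.div (by fun_prop) hM) (by fun_prop))

theorem continuousAt_radial {u : X → Fin n → ℝ} (hq : ContinuousAt q p) (hu : ContinuousAt u p) :
    ContinuousAt (fun p => radial (q p) (u p)) p := by
  have hq' := continuousAt_pi.1 hq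
  have hu' := continuousAt_pi.1 hu
  exact continuousAt_pi.2 fun k => (hu' k).smul (hq' k)

theorem continuousAt_tangential {u : X → Fin n → ℝ} (hq : ContinuousAt q p)
    (hu : ContinuousAt u p) : ContinuousAt (fun p => tangential (q p) (u p)) p := by
  have hq' := continuousAt_pi.1 hq
  have hu' := continuousAt_pi.1 hu
  exact continuousAt_pi.2 fun k => (hu' k).smul (continuousAt_const.mul (hq' k))

theorem continuousAt_reducedForm {τ : X → ℝ} {u a b σ : X → Fin n → ℝ} (hτ : ContinuousAt τ p)
    (hq : ContinuousAt q p) (hu : ContinuousAt u p) (ha : ContinuousAt a p)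
    (hb : ContinuousAt b p) (hσ : ContinuousAt σ p) (hne : ∀ k, q p k ≠ 0)
    (hinj : Function.Injective (q p)) (hM : 1 + τ p ^ 2 * ∑ k, μ k ≠ 0) :
    ContinuousAt (fun p => reducedForm μ (τ p) (q p) (u p) (a p) (b p) (σ p)) p := by
  have hτ2 : ContinuousAt (fun p => τ p ^ 2) p := hτ.pow 2
  have hA := continuousAt_angularForce (μ := μ) hq hσ hne hinj
  have hAb := continuousAt_angularForce (μ := μ) hq (hτ.smul hb) hne hinj
  have hru := continuousAt_radial hq hu
  have hra := continuousAt_radial hq ha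
  have hη := hra.add (continuousAt_tangential hq hb)
  have hKu := (continuousAt_helioOp (μ := μ) hτ2 hq hru hne hinj).add (hτ.smul hA)
  have hKa := (continuousAt_helioOp (μ := μ) hτ2 hq hra hne hinj).add (hτ.smul hAb)
  have hζ : ContinuousAt (fun p => (fun k => -2 * Complex.I *
      (radial (q p) (a p) + tangential (q p) (b p)) k)
        + (helioOp (τ p ^ 2) μ (q p) (radial (q p) (u p)) + τ p • angularForce μ (q p) (σ p))) p :=
    ContinuousAt.add (continuousAt_pi.2 fun k => continuousAt_const.mul (continuousAt_pi.1 hη k)) hKu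
  exact ((continuousAt_const.mul ((continuousAt_massForm hτ2 hζ hζ hM).sub
    (continuousAt_massForm hτ2 hη hKa hM))).sub ((continuousAt_massForm hτ2 hη hη hM).sub
    (((continuousAt_massForm hτ2 hru hKu hM).add (continuousAt_massForm hτ2
    (continuousAt_tangential hq hσ) hA hM)).add (hτ.mul (continuousAt_massForm hτ2 hA hru hM)))))

end continuity

/-- The configuration of the light bodies. -/
noncomputable def ringConfig (θ : Fin n → ℝ) : Fin n → ℂ := fun k => Complex.exp (θ k * Complex.I)

theorem Separated.injective {θ : Fin n → ℝ} (h : Separated θ) :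
    Function.Injective (ringConfig θ) := by
  intro i k hik
  by_contra hne
  have h1 := norm_exp_sub_exp (θ k) (θ i)
  simp only [ringConfig] at hik
  rw [hik, sub_self, norm_zero] at h1
  exact h i k hne (abs_eq_zero.1 (by linarith))

theorem inner_angularForce {θ : Fin n → ℝ} (h : Separated θ) (s : Fin n → ℝ) (k : Fin n) :
    inner ℝ (Complex.I * ringConfig θ k) (angularForce μ (ringConfig θ) s k)
      = ∑ l, μ l * hallF (θ k - θ l) * (s k - s l) := by
  simp only [angularForce, inner_sum, real_inner_smul_right]
  refine Finset.sum_congr rfl fun l _ => ?_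
  by_cases hkl : l = k
  · subst hkl; simp
  · simp only [ringConfig]
    rw [inner_I_tidal (h l k hkl), ← hallF_neg (θ k - θ l), neg_sub]
    ring

theorem helioOp_radial_zero (θ : Fin n → ℝ) (u : Fin n → ℝ) :
    helioOp 0 μ (ringConfig θ) (radial (ringConfig θ) u) = (3 : ℝ) • radial (ringConfig θ) u := by
  funext k
  have : ‖ringConfig θ k‖ = 1 := Complex.norm_exp_ofReal_mul_I _
  simp only [helioOp_apply, radial, map_smul, tidal_self, newton, this, Pi.smul_apply]
  simp
  ring

/-- For a single light body with radial stiffness 3, the energy of the differentiated solution is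
`(3u + 2b)² + a²` and the energy itself is `a² + b² - 3u²`. Neither is definite, but twice the first
minus the second is, since `24² < 4 * 21 * 7`. The potential of the tangential displacements, which
enters the energy with a minus sign, then contributes the Hessian with a plus sign. -/
theorem reducedForm_zero {θ : Fin n → ℝ} (h : Separated θ) (u a b σ : Fin n → ℝ) :
    reducedForm μ 0 (ringConfig θ) u a b σ
      = ∑ k, μ k * (a k ^ 2 + (21 * u k ^ 2 + 24 * u k * b k + 7 * b k ^ 2))
        + dotProduct σ ((hallHessian μ θ).mulVec σ) := by
  have hσ : massForm 0 μ (tangential (ringConfig θ) σ) (angularForce μ (ringConfig θ) σ)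
      = dotProduct σ ((hallHessian μ θ).mulVec σ) := by
    simp only [massForm, zero_div, zero_mul, sub_zero, tangential, real_inner_smul_left,
      inner_angularForce h, dotProduct, hallHessian_mulVec h, Finset.mul_sum]
    exact Finset.sum_congr rfl fun k _ => Finset.sum_congr rfl fun l _ => by ring
  have hm : ∀ x y : Fin n → ℂ, massForm 0 μ (fun k => x k * ringConfig θ k)
      (fun k => y k * ringConfig θ k) = ∑ k, μ k * ((x k).re * (y k).re + (x k).im * (y k).im) := by
    intro x y
    simp only [massForm, zero_div, zero_mul, sub_zero]
    refine Finset.sum_congr rfl fun k _ => ?_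
    congr 1
    have h1 : (ringConfig θ k).re ^ 2 + (ringConfig θ k).im ^ 2 = 1 := by
      simp only [ringConfig, Complex.exp_ofReal_mul_I_re, Complex.exp_ofReal_mul_I_im]
      exact Real.cos_sq_add_sin_sq _
    simp [Complex.inner]
    linear_combination ((x k).re * (y k).re + (x k).im * (y k).im) * h1
  have hη : radial (ringConfig θ) a + tangential (ringConfig θ) b
      = fun k => ((a k : ℂ) + b k * Complex.I) * ringConfig θ k := by
    funext k; simp [radial, tangential]; ring
  have hζ : (fun k => -2 * Complex.I * (radial (ringConfig θ) a + tangential (ringConfig θ) b) k)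
        + (3 : ℝ) • radial (ringConfig θ) u
      = fun k => (((3 * u k + 2 * b k : ℝ) : ℂ) + (-2 * a k : ℝ) * Complex.I) * ringConfig θ k := by
    rw [hη]; funext k
    simp [radial]
    linear_combination (-2 * b k * ringConfig θ k) * Complex.I_sq
  have hr : ∀ u, radial (ringConfig θ) u = fun k => ((u k : ℝ) : ℂ) * ringConfig θ k := by
    intro u; funext k; simp [radial]
  have h3 : ∀ u, (3 : ℝ) • radial (ringConfig θ) u = fun k => ((3 * u k : ℝ) : ℂ) * ringConfig θ k := by
    intro u; funext k; simp [radial]; ring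
  have h02 : (0 : ℝ) ^ 2 = 0 := by norm_num
  simp only [reducedForm, h02, helioOp_radial_zero, zero_smul, add_zero, hσ, zero_mul, hζ]
  rw [hη, h3, h3, hr, hm, hm, hm, hm]
  simp only [Complex.add_re, Complex.add_im, Complex.mul_re, Complex.mul_im, Complex.ofReal_re,
    Complex.ofReal_im, Complex.I_re, Complex.I_im]
  rw [show ∀ A B C D E : ℝ, 2 * (A - B) - (C - (D + E)) = (2 * (A - B) - (C - D)) + E from
    fun _ _ _ _ _ => by ring]
  congr 1
  simp only [← Finset.sum_sub_distrib, Finset.mul_sum]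
  exact Finset.sum_congr rfl fun k _ => by ring

/-- Near a nondegenerate minimum of Hall's potential the first integral is positive definite. -/
theorem eventually_pos {θ : Fin n → ℝ} (hμ : ∀ k, 0 < μ k) (h : Separated θ)
    (hV : ∀ v : Fin n → ℝ, v ≠ 0 → ∑ k, v k = 0 →
      0 < dotProduct v ((hallHessian μ θ).mulVec v)) :
    ∀ᶠ p : ℝ × (Fin n → ℂ) in 𝓝[>] 0 ×ˢ 𝓝 (ringConfig θ), IsHelioEq p.1 μ p.2 →
      ∀ x y : Fin n → ℂ, (x, y) ≠ 0 →
        0 < energyForm p.1 μ p.2 x y + phaseForm p.1 μ p.2 x y ^ 2 := by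
  rcases isEmpty_or_nonempty (Fin n) with hn | hn
  · exact .of_forall fun p _ x y hxy => absurd (Subsingleton.elim _ _) hxy
  have hne : ∀ k, ringConfig θ k ≠ 0 := fun k => Complex.exp_ne_zero _
  set S : Set ((Fin n → ℝ) × (Fin n → ℝ) × (Fin n → ℝ) × (Fin n → ℝ)) :=
    Metric.sphere 0 1 ∩ {Y | ∑ k, Y.2.2.2 k = 0} with hS
  have hSc : IsCompact S := (isCompact_sphere _ _).inter_right
    (isClosed_eq (by fun_prop) continuous_const)
  have h0 : ∀ Y ∈ S, 0 < reducedForm μ 0 (ringConfig θ) Y.1 Y.2.1 Y.2.2.1 Y.2.2.2 := by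
    rintro ⟨u, a, b, σ⟩ ⟨hY1, hY2⟩
    have hY : (u, a, b, σ) ≠ 0 := by
      intro e; rw [e] at hY1; simp at hY1
    rw [reducedForm_zero h]
    have hterm : ∀ k, 0 ≤ μ k * (a k ^ 2 + (21 * u k ^ 2 + 24 * u k * b k + 7 * b k ^ 2)) :=
      fun k => mul_nonneg (hμ k).le <| by
        -- Completing the square: `7 (21u² + 24ub + 7b²) = (7b + 12u)² + 3u²`.
        nlinarith [sq_nonneg (7 * b k + 12 * u k), sq_nonneg (a k), sq_nonneg (u k)]
    have hsum : 0 ≤ ∑ k, μ k * (a k ^ 2 + (21 * u k ^ 2 + 24 * u k * b k + 7 * b k ^ 2)) :=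
      Finset.sum_nonneg fun k _ => hterm k
    by_cases hσ : σ = 0
    · subst hσ
      rw [Matrix.mulVec_zero, dotProduct_zero, add_zero]
      refine lt_of_le_of_ne hsum fun e => hY ?_
      rw [eq_comm, Finset.sum_eq_zero_iff_of_nonneg fun k _ => hterm k] at e
      have h1 : ∀ k, u k = 0 ∧ a k = 0 ∧ b k = 0 := by
        intro k
        have h2 := (mul_eq_zero.1 (e k (Finset.mem_univ k))).resolve_left (hμ k).ne'
        have hu : u k = 0 := by
          rw [← sq_eq_zero_iff]
          nlinarith [sq_nonneg (7 * b k + 12 * u k), sq_nonneg (a k), sq_nonneg (u k)]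
        have ha : a k = 0 := by
          rw [← sq_eq_zero_iff]
          nlinarith [sq_nonneg (7 * b k + 12 * u k), sq_nonneg (a k), sq_nonneg (u k)]
        rw [hu, ha] at h2
        have hb : b k = 0 := by
          rw [← sq_eq_zero_iff]
          linarith
        exact ⟨hu, ha, hb⟩
      have hu : u = 0 := funext fun k => (h1 k).1
      have ha : a = 0 := funext fun k => (h1 k).2.1
      have hb : b = 0 := funext fun k => (h1 k).2.2
      rw [hu, ha, hb]
      rfl
    · linarith [hV σ hσ hY2]
  -- Compactness of `S` gives one neighbourhood of the limit on which the form is positive for all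
  -- unit vectors at once.
  have htube : ∀ᶠ p : ℝ × (Fin n → ℂ) in 𝓝 (0, ringConfig θ), ∀ Y ∈ S,
      0 < reducedForm μ p.1 p.2 Y.1 Y.2.1 Y.2.2.1 Y.2.2.2 := by
    refine hSc.eventually_forall_of_forall_eventually fun Y hY => ?_
    have hc : ContinuousAt (fun P : (ℝ × (Fin n → ℂ)) ×
        ((Fin n → ℝ) × (Fin n → ℝ) × (Fin n → ℝ) × (Fin n → ℝ)) =>
        reducedForm μ P.1.1 P.1.2 P.2.1 P.2.2.1 P.2.2.2.1 P.2.2.2.2) ((0, ringConfig θ), Y) :=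
      continuousAt_reducedForm (by fun_prop) (by fun_prop) (by fun_prop) (by fun_prop)
        (by fun_prop) (by fun_prop) hne h.injective (by simp)
    exact hc.eventually_const_lt (h0 Y hY)
  have hrot : ∀ᶠ p : ℝ × (Fin n → ℂ) in 𝓝 (0, ringConfig θ),
      0 < massForm p.1 μ (fun k => Complex.I * p.2 k) (fun k => Complex.I * p.2 k) := by
    have hx : ContinuousAt (fun p : ℝ × (Fin n → ℂ) => fun k => Complex.I * p.2 k)
      (0, ringConfig θ) := by fun_prop
    have hc : ContinuousAt (fun p : ℝ × (Fin n → ℂ) =>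
        massForm p.1 μ (fun k => Complex.I * p.2 k) (fun k => Complex.I * p.2 k))
        (0, ringConfig θ) := continuousAt_massForm continuousAt_fst hx hx (by simp)
    refine hc.eventually_const_lt ?_
    simp only [massForm, zero_div, zero_mul, sub_zero, real_inner_self_eq_norm_sq, norm_mul,
      Complex.norm_I, ringConfig, Complex.norm_exp_ofReal_mul_I]
    exact Finset.sum_pos (fun k _ => by simpa using hμ k) Finset.univ_nonempty
  have hle : 𝓝[>] (0 : ℝ) ×ˢ 𝓝 (ringConfig θ) ≤ 𝓝 (0, ringConfig θ) := by
    rw [nhds_prod_eq]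
    exact Filter.prod_mono nhdsWithin_le_nhds le_rfl
  have hsqrt : Tendsto (fun p : ℝ × (Fin n → ℂ) => (√p.1, p.2)) (𝓝[>] 0 ×ˢ 𝓝 (ringConfig θ))
      (𝓝 (0, ringConfig θ)) := by
    have : ContinuousAt (fun p : ℝ × (Fin n → ℂ) => (√p.1, p.2)) (0, ringConfig θ) := by fun_prop
    have h1 : Tendsto (fun p : ℝ × (Fin n → ℂ) => (√p.1, p.2)) (𝓝 (0, ringConfig θ))
      (𝓝 (√0, ringConfig θ)) := this
    rw [Real.sqrt_zero] at h1
    exact h1.mono_left hle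
  have hposε : ∀ᶠ p : ℝ × (Fin n → ℂ) in 𝓝[>] 0 ×ˢ 𝓝 (ringConfig θ), 0 < p.1 :=
    (tendsto_fst (f := 𝓝[>] (0 : ℝ)) (g := 𝓝 (ringConfig θ))).eventually self_mem_nhdsWithin
  filter_upwards [hsqrt.eventually htube, hle hrot, hposε] with p hp1 hp2 hp3 hq x y hxy
  obtain ⟨ε, q⟩ := p
  obtain ⟨τ, hτ, rfl⟩ : ∃ τ : ℝ, 0 < τ ∧ τ ^ 2 = ε := ⟨√ε, Real.sqrt_pos.2 hp3, Real.sq_sqrt hp3.le⟩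
  simp only [Real.sqrt_sq hτ.le] at hp1 hp2 hq ⊢
  have hM : 1 + τ ^ 2 * ∑ k, μ k ≠ 0 := by
    have : 0 ≤ ∑ k, μ k := Finset.sum_nonneg fun k _ => (hμ k).le
    positivity
  have hred : ∀ u a b s : Fin n → ℝ, ∑ k, s k = 0 → (u, a, b, s) ≠ 0 →
      0 < energyForm (τ ^ 2) μ q (radial q u + tangential q s) (radial q a + tangential q b) := by
    intro u a b s hs hne
    rw [energyForm_eq_reducedForm hM hq]
    have hY : (u, a, b, τ • s) ≠ 0 := by
      intro e
      simp only [Prod.mk_eq_zero, smul_eq_zero, hτ.ne', false_or] at e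
      exact hne (by simp [e])
    have hnY : ‖(u, a, b, τ • s)‖ ≠ 0 := norm_ne_zero_iff.2 hY
    set c := ‖(u, a, b, τ • s)‖⁻¹ with hc
    have hmem : c • (u, a, b, τ • s) ∈ S := by
      refine ⟨?_, ?_⟩
      · rw [mem_sphere_zero_iff_norm, norm_smul, hc, norm_inv, norm_norm, inv_mul_cancel₀ hnY]
      · simp [← Finset.mul_sum, hs]
    have h1 := hp1 _ hmem
    have h2 : reducedForm μ τ q (c • u) (c • a) (c • b) (c • τ • s)
        = c ^ 2 * reducedForm μ τ q u a b (τ • s) := by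
      have e : ∀ x : Fin n → ℂ, (fun k => -2 * Complex.I * (c • x) k)
          = c • fun k => -2 * Complex.I * x k := by
        intro x; funext k; simp; ring
      simp only [reducedForm, radial_smul, tangential_smul, angularForce_smul, map_smul,
        smul_comm τ c, ← smul_add, e, massForm_smul_left, massForm_smul_right]
      ring
    have h3 : 0 < c ^ 2 * reducedForm μ τ q u a b (τ • s) := by
      rw [← h2]; exact h1
    exact pos_of_mul_pos_right h3 (sq_nonneg c)
  obtain ⟨u, s, rfl⟩ := exists_radial_tangential hq.ne_zero x
  obtain ⟨a, b, rfl⟩ := exists_radial_tangential hq.ne_zero y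
  -- The mean rotation `m` drops out of `energyForm`. If nothing else is left of the displacement,
  -- `phaseForm` equals `m` times the positive norm of the rotation vector.
  set m := (∑ k, s k) / n with hm
  have hsplit : s = (fun k => s k - m) + fun _ => m := by
    funext k; simp
  have hmean : ∑ k, (s k - m) = 0 := by
    have : (n : ℝ) ≠ 0 := by
      have := Fin.pos_iff_nonempty.2 hn
      positivity
    simp [hm]
    field_simp
    ring
  have hE : energyForm (τ ^ 2) μ q (radial q u + tangential q s) (radial q a + tangential q b)
      = energyForm (τ ^ 2) μ q (radial q u + tangential q fun k => s k - m)
        (radial q a + tangential q b) := by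
    rw [hsplit, tangential_add, ← add_assoc, energyForm_add_rotation hM hq, ← hsplit]
  rw [hE]
  by_cases h1 : (u, a, b, fun k => s k - m) = 0
  · simp only [Prod.mk_eq_zero] at h1
    obtain ⟨rfl, rfl, rfl, h4⟩ := h1
    have hm0 : m ≠ 0 := by
      rintro hm0
      rw [hm0] at h4
      simp only [sub_zero] at h4
      refine hxy ?_
      have : s = 0 := h4
      subst this
      have e0 : radial q 0 = 0 := by funext; simp [radial]
      have e1 : tangential q 0 = 0 := by funext; simp [tangential]
      rw [e0, e1, add_zero]
      rfl
    have hs : s = fun _ => m := by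
      rw [hsplit, h4, zero_add]
    have e0 : ∀ k : Fin n → ℂ, radial k 0 = 0 := fun k => by funext; simp [radial]
    have e1 : ∀ k : Fin n → ℂ, tangential k 0 = 0 := fun k => by funext; simp [tangential]
    have e2 : tangential q (fun _ => m) = m • fun k => Complex.I * q k := rfl
    rw [h4, hs]
    simp only [e0, e1, zero_add, phaseForm, e2, massForm_smul_left]
    have e3 : massForm (τ ^ 2) μ 0 q = 0 := by simp [massForm]
    have e4 : energyForm (τ ^ 2) μ q 0 0 = 0 := by
      simp [energyForm, massForm]
    rw [e3, e4, mul_zero, sub_zero, zero_add]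
    exact sq_pos_of_ne_zero (mul_ne_zero hm0 hp2.ne')
  · have := hred u a b _ hmean h1
    positivity

end HallRing

/-! ### Spectral consequences of linear stability. -/

namespace HallRing

section linear

variable {ι : Type*} [Fintype ι] [DecidableEq ι]

/-- All eigenvalues of a real matrix are purely imaginary, expressed through real and imaginary
parts of eigenvectors. -/
def ImaginarySpectrum (M : Matrix ι ι ℝ) : Prop :=
  ∀ (α β : ℝ) (v w : ι → ℝ), α ≠ 0 → M.mulVec v = α • v - β • w → M.mulVec w = β • v + α • w →
    v = 0 ∧ w = 0

theorem ImaginarySpectrum.re_root {M : Matrix ι ι ℝ} (h : ImaginarySpectrum M) {r : ℂ}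
    (hr : (M.map Complex.ofReal).charpoly.eval r = 0) : r.re = 0 := by
  by_contra hre
  rw [Matrix.eval_charpoly, ← Matrix.exists_mulVec_eq_zero_iff] at hr
  obtain ⟨x, hx, hx0⟩ := hr
  have hk : ∀ k, ∑ l, (M k l : ℂ) * x l = r * x k := by
    intro k
    have h1 := congrFun hx0 k
    rw [Matrix.sub_mulVec, Pi.sub_apply] at h1
    simp [Matrix.mulVec, dotProduct, Matrix.scalar_apply, Matrix.diagonal_apply] at h1
    linear_combination -h1
  obtain ⟨hv, hw⟩ := h r.re r.im (fun k => (x k).re) (fun k => (x k).im) hre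
    (by
      funext k
      have := congrArg Complex.re (hk k)
      simpa [Matrix.mulVec, dotProduct] using this)
    (by
      funext k
      have := congrArg Complex.im (hk k)
      simp [Matrix.mulVec, dotProduct] at this ⊢
      linarith)
  exact hx (funext fun k => Complex.ext (congrFun hv k) (congrFun hw k))

/-- Each root `r = iβ` satisfies `|x - iβ| ≥ (x / y) |y - iβ|`; the inequality is the product over
all roots. It is a closed condition on the matrix, so it passes to limits and no eigenvalue has to
be followed. -/
theorem ImaginarySpectrum.det_le {M : Matrix ι ι ℝ} (h : ImaginarySpectrum M) {x y : ℝ}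
    (hx : 0 < x) (hxy : x ≤ y) :
    (x / y) ^ Fintype.card ι * |(Matrix.scalar ι y - M).det| ≤ |(Matrix.scalar ι x - M).det| := by
  have hy : 0 < y := hx.trans_le hxy
  set p := (M.map Complex.ofReal).charpoly with hp
  have hs : p.Splits := IsAlgClosed.splits p
  have hm : p.Monic := Matrix.charpoly_monic _
  have hcard : p.roots.card = Fintype.card ι := by
    rw [← hs.natDegree_eq_card_roots, hp, Matrix.charpoly_natDegree_eq_dim]
  have hnorm : ∀ t : ℝ, |(Matrix.scalar ι t - M).det| = (p.roots.map fun r => ‖(t : ℂ) - r‖).prod := by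
    intro t
    have h1 : ((Matrix.scalar ι t - M).det : ℂ) = p.eval (t : ℂ) := by
      rw [hp, Matrix.eval_charpoly, ← Complex.ofRealHom_eq_coe, RingHom.map_det]
      congr 1
      ext i k
      by_cases hik : i = k <;> simp [hik]
    rw [← Real.norm_eq_abs, ← Complex.norm_real, h1, hs.eval_eq_prod_roots_of_monic hm]
    refine (map_multiset_prod (normHom (α := ℂ)) _).trans ?_
    rw [Multiset.map_map]
    rfl
  rw [hnorm, hnorm, ← hcard, ← Multiset.prod_replicate, ← Multiset.map_const',
    ← Multiset.prod_map_mul]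
  refine Multiset.prod_map_le_prod_map₀ _ _ (fun r hr => by positivity) fun r hr => ?_
  have hre := h.re_root ((Polynomial.mem_roots'.1 hr).2)
  rw [← Real.sqrt_sq (div_pos hx hy).le]
  have hn : ∀ t : ℝ, ‖(t : ℂ) - r‖ = √(t ^ 2 + r.im ^ 2) := by
    intro t
    rw [Complex.norm_eq_sqrt_sq_add_sq]
    simp [hre]
  rw [hn, hn, ← Real.sqrt_mul (sq_nonneg _)]
  refine Real.sqrt_le_sqrt ?_
  have h1 : (x / y) ^ 2 ≤ 1 := pow_le_one₀ (by positivity) ((div_le_one hy).2 hxy)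
  have h2 : (x / y) ^ 2 * y ^ 2 = x ^ 2 := by field_simp
  nlinarith [sq_nonneg r.im]

/-- The matrix of the first order system `x' = y`, `y' = K x - 2 J y`. -/
def phaseMatrix (K J : Matrix ι ι ℝ) : Matrix (ι ⊕ ι) (ι ⊕ ι) ℝ :=
  Matrix.fromBlocks 0 1 K (-(2 : ℝ) • J)

/-- The Schur complement of the block `t • 1`, which reduces the first order system to its quadratic
pencil. -/
theorem det_scalar_sub_phaseMatrix (K J : Matrix ι ι ℝ) {t : ℝ} (ht : t ≠ 0) :
    (Matrix.scalar (ι ⊕ ι) t - phaseMatrix K J).det =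
      (t ^ 2 • (1 : Matrix ι ι ℝ) + (2 * t) • J - K).det := by
  have h1 : Matrix.scalar (ι ⊕ ι) t - phaseMatrix K J =
      Matrix.fromBlocks (t • 1) (-1) (-K) (t • 1 + (2 : ℝ) • J) := by
    ext (i | i) (k | k) <;>
      simp [phaseMatrix, Matrix.diagonal_apply, Matrix.one_apply]
  let _ : Invertible (t • (1 : Matrix ι ι ℝ)) :=
    ⟨t⁻¹ • 1, by simp [smul_smul, ht], by simp [smul_smul, ht]⟩
  have h2 : ⅟(t • (1 : Matrix ι ι ℝ)) = t⁻¹ • 1 := rfl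
  rw [h1, Matrix.det_fromBlocks₁₁, ← Matrix.det_mul, h2]
  congr 1
  simp [sub_eq_add_neg, smul_smul, ht, sq, mul_comm t 2]

/-- Multiplication by `diag(1, t)` on both sides; with `t = τ` it pulls out the powers that make the
determinant degenerate as `ε → 0`. -/
theorem det_fromBlocks_smul (A B C D : Matrix ι ι ℝ) (t : ℝ) :
    (Matrix.fromBlocks A (t • B) (t • C) (t ^ 2 • D)).det
      = t ^ (2 * Fintype.card ι) * (Matrix.fromBlocks A B C D).det := by
  have h : Matrix.fromBlocks A (t • B) (t • C) (t ^ 2 • D) =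
      Matrix.fromBlocks 1 0 0 (t • 1) * Matrix.fromBlocks A B C D
        * Matrix.fromBlocks 1 0 0 (t • 1) := by
    simp [Matrix.fromBlocks_multiply, smul_smul, sq]
  rw [h, Matrix.det_mul, Matrix.det_mul, Matrix.det_fromBlocks_zero₂₁]
  simp
  ring

end linear

variable {n : ℕ} {ε : ℝ} {μ : Fin n → ℝ}

theorem hasDerivAt_spiral (α β : ℝ) (x₁ x₂ : Fin n → ℂ) (t : ℝ) :
    HasDerivAt (fun t => Real.exp (α * t) • (Real.cos (β * t) • x₁ - Real.sin (β * t) • x₂))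
      (Real.exp (α * t) • (Real.cos (β * t) • (α • x₁ - β • x₂)
        - Real.sin (β * t) • (β • x₁ + α • x₂))) t := by
  have h : ∀ c : ℝ, HasDerivAt (fun t : ℝ => c * t) c t := fun c => by
    simpa using (hasDerivAt_id t).const_mul c
  have h1 := (h α).exp.fun_smul (((h β).cos.smul_const x₁).fun_sub ((h β).sin.smul_const x₂))
  refine h1.congr_deriv ?_
  module

/-- Eigenvectors of the linearization that belong to eigenvalues off the imaginary axis contradict
linear stability. -/
theorem eigenvector_eq_zero_of_isLinearlyStable {z : Fin (n + 1) → ℂ}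
    (hM : 1 + ε * ∑ k, μ k ≠ 0)
    (hz : IsRelativeEquilibrium (smallMasses μ ε) z) (hst : IsLinearlyStable (smallMasses μ ε) z)
    {α β : ℝ} (hα : α ≠ 0) {x₁ x₂ y₁ y₂ : Fin n → ℂ}
    (h1 : y₁ = α • x₁ - β • x₂) (h2 : y₂ = β • x₁ + α • x₂)
    (h3 : (fun k => -2 * Complex.I * y₁ k) + helioOp ε μ (fun k => z k.succ - z 0) x₁
      = α • y₁ - β • y₂)
    (h4 : (fun k => -2 * Complex.I * y₂ k) + helioOp ε μ (fun k => z k.succ - z 0) x₂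
      = β • y₁ + α • y₂) : x₁ = 0 ∧ x₂ = 0 := by
  have hq := IsHelioEq.of_isRelativeEquilibrium hz
  set q : Fin n → ℂ := fun k => z k.succ - z 0 with hqdef
  set C : (Fin n → ℂ) → (Fin n → ℂ) → ℝ := fun x y =>
    2 * massForm ε μ x q + massForm ε μ y (fun k => Complex.I * q k) with hC
  have hCL : ∀ x y, C y ((fun k => -2 * Complex.I * y k) + helioOp ε μ q x) = 0 := by
    intro x y
    have e : (fun k => Complex.I * (Complex.I * q k)) = (-1 : ℝ) • q := by
      funext k
      simp only [Pi.smul_apply, Complex.real_smul]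
      push_cast
      linear_combination q k * Complex.I_sq
    have e0 : massForm ε μ x 0 = 0 := by simp [massForm]
    simp only [hC, massForm_add_left, massForm_smul_I_left]
    rw [e, massForm_smul_right, ← helioOp_symm hM, helioOp_I_self hq, e0]
    -- (See `hC1` and `hC2`.) The functional `C`, proportional to the first variation of the angular
    -- momentum, is thus a linear first integral.
    ring
  have hadd : ∀ (a b : ℝ) x y x' y', C (a • x + b • x') (a • y + b • y') = a * C x y + b * C x' y' := by
    intro a b x y x' y'
    simp only [hC, massForm_add_left, massForm_smul_left]
    ring
  -- On an eigenvector, constancy of `C` gives a linear system of determinant `α² + β²`. Hence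
  -- eigenvectors off the imaginary axis satisfy the angular momentum constraint automatically.
  have hC1 : α * C x₁ y₁ + (-β) * C x₂ y₂ = 0 := by
    rw [← hadd, neg_smul, neg_smul, ← sub_eq_add_neg, ← sub_eq_add_neg, ← h3, ← h1]
    exact hCL _ _
  have hC2 : β * C x₁ y₁ + α * C x₂ y₂ = 0 := by
    rw [← hadd, ← h4, ← h2]
    exact hCL _ _
  have hsq : α ^ 2 + β ^ 2 ≠ 0 := by positivity
  have hCx : C x₁ y₁ = 0 := by
    refine (mul_eq_zero.1 (?_ : (α ^ 2 + β ^ 2) * C x₁ y₁ = 0)).resolve_left hsq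
    linear_combination α * hC1 + β * hC2
  have hCy : C x₂ y₂ = 0 := by
    refine (mul_eq_zero.1 (?_ : (α ^ 2 + β ^ 2) * C x₂ y₂ = 0)).resolve_left hsq
    linear_combination α * hC2 - β * hC1
  have hbdd : ∀ a b : ℝ, ∃ R, ∀ t, ‖Real.exp (α * t) • (Real.cos (β * t) • (a • x₁ + b • x₂)
      - Real.sin (β * t) • ((-b) • x₁ + a • x₂))‖ ≤ R := by
    intro a b
    set X₁ := a • x₁ + b • x₂ with hX1
    set X₂ := (-b) • x₁ + a • x₂ with hX2
    set Y₁ := a • y₁ + b • y₂ with hY1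
    set Y₂ := (-b) • y₁ + a • y₂ with hY2
    have e1 : Y₁ = α • X₁ - β • X₂ := by
      rw [hY1, hX1, hX2, h1, h2]; module
    have e2 : Y₂ = β • X₁ + α • X₂ := by
      rw [hY2, hX1, hX2, h1, h2]; module
    have hsol : IsHelioSolution ε μ q
        (fun t => Real.exp (α * t) • (Real.cos (β * t) • X₁ - Real.sin (β * t) • X₂))
        (fun t => Real.exp (α * t) • (Real.cos (β * t) • Y₁ - Real.sin (β * t) • Y₂)) := by
      intro t
      refine ⟨?_, ?_⟩
      · rw [e1, e2]
        exact hasDerivAt_spiral α β X₁ X₂ t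
      · refine (hasDerivAt_spiral α β Y₁ Y₂ t).congr_deriv ?_
        have hI : ∀ (c d : ℝ) (x y : Fin n → ℂ), (fun k => -2 * Complex.I * (c • x + d • y) k)
            = c • (fun k => -2 * Complex.I * x k) + d • fun k => -2 * Complex.I * y k := by
          intro c d x y; funext k; simp; ring
        have e3 : (fun k => -2 * Complex.I * Y₁ k) + helioOp ε μ q X₁ = α • Y₁ - β • Y₂ := by
          rw [hY1, hX1, hI, map_add, map_smul, map_smul, hY2]
          linear_combination (norm := module) a • h3 + b • h4
        have e4 : (fun k => -2 * Complex.I * Y₂ k) + helioOp ε μ q X₂ = β • Y₁ + α • Y₂ := by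
          rw [hY2, hX2, hI, map_add, map_smul, map_smul, hY1]
          linear_combination (norm := module) (-b) • h3 + a • h4
        rw [← e3, ← e4]
        have e5 : Real.exp (α * t) • (Real.cos (β * t) • Y₁ - Real.sin (β * t) • Y₂)
            = (Real.exp (α * t) * Real.cos (β * t)) • Y₁
              + (-(Real.exp (α * t) * Real.sin (β * t))) • Y₂ := by module
        simp only [e5, hI, map_smul, map_sub]
        module
    obtain ⟨R, hR⟩ := hst _ _ (hsol.lift hz.1 hM) (fun t => sum_mass_mul_lift hM _) (by
      intro t
      rw [fderiv_angularMomentum_eq hM hz.2.1 (sum_mass_mul_lift hM _) (sum_mass_mul_lift hM _)]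
      simp only [lift_succ_sub]
      refine mul_eq_zero_of_right _ ?_
      have e5 : ∀ x y : Fin n → ℂ, Real.exp (α * t) • (Real.cos (β * t) • x - Real.sin (β * t) • y)
            = (Real.exp (α * t) * Real.cos (β * t)) • x
              + (-(Real.exp (α * t) * Real.sin (β * t))) • y := fun x y => by module
      have h5 : C (Real.exp (α * t) • (Real.cos (β * t) • X₁ - Real.sin (β * t) • X₂))
        (Real.exp (α * t) • (Real.cos (β * t) • Y₁ - Real.sin (β * t) • Y₂)) = 0 := by
        rw [e5, e5, hadd, hX1, hX2, hY1, hY2, hadd, hadd, hCx, hCy]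
        ring
      exact h5)
    refine ⟨R + R, fun t => ?_⟩
    have hR0 : 0 ≤ R := (norm_nonneg _).trans (hR t).1
    refine (pi_norm_le_iff_of_nonneg (by positivity)).2 fun k => ?_
    rw [← lift_succ_sub (ε := ε) (μ := μ) (_ • (_ - _)) k]
    exact (norm_sub_le _ _).trans (add_le_add ((norm_le_pi_norm _ _).trans (hR t).1)
      ((norm_le_pi_norm _ _).trans (hR t).1))
  -- These two solutions are the real and imaginary parts of a complex exponential solution, up to
  -- sign. Combining them with `cos` and `sin` undoes the oscillation and leaves `exp (α t) • x₁`
  -- and `exp (α t) • x₂`.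
  obtain ⟨R₁, hR1⟩ := hbdd 1 0
  obtain ⟨R₂, hR2⟩ := hbdd 0 (-1)
  have hzero : ∀ x : Fin n → ℂ, (∀ t, ‖Real.exp (α * t) • x‖ ≤ R₁ + R₂) → x = 0 := by
    intro x hx
    by_contra hne
    have hpos := norm_pos_iff.2 hne
    -- Dividing by `α` makes the exponent positive for either sign of `α`; then `exp r ≥ 1 + r`
    -- already exceeds the bound.
    have h5 := hx (((R₁ + R₂) / ‖x‖) / α)
    rw [norm_smul, Real.norm_eq_abs, Real.abs_exp, mul_div_cancel₀ _ hα] at h5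
    have h6 := Real.add_one_le_exp ((R₁ + R₂) / ‖x‖)
    have h7 : ((R₁ + R₂) / ‖x‖ + 1) * ‖x‖ ≤ R₁ + R₂ := (by gcongr : _ ≤ _).trans h5
    rw [add_mul, div_mul_cancel₀ _ hpos.ne'] at h7
    linarith
  have hcomb : ∀ (c s : ℝ) (x y : Fin n → ℂ), |c| ≤ 1 → |s| ≤ 1 → ‖x‖ ≤ R₁ → ‖y‖ ≤ R₂ →
      ‖c • x + s • y‖ ≤ R₁ + R₂ := by
    intro c s x y hc hs hx hy
    refine (norm_add_le _ _).trans (add_le_add ?_ ?_) <;> rw [norm_smul, Real.norm_eq_abs]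
    · exact (mul_le_of_le_one_left (norm_nonneg _) hc).trans hx
    · exact (mul_le_of_le_one_left (norm_nonneg _) hs).trans hy
  have htrig : ∀ (t : ℝ) (x : Fin n → ℂ), Real.exp (α * t) • x
      = (Real.exp (α * t) * (Real.sin (β * t) ^ 2 + Real.cos (β * t) ^ 2)) • x := fun t x => by
    rw [Real.sin_sq_add_cos_sq, mul_one]
  constructor
  · refine hzero x₁ fun t => ?_
    refine le_of_eq_of_le (congrArg norm ?_) (hcomb (Real.cos (β * t)) (-Real.sin (β * t)) _ _
      (Real.abs_cos_le_one _) (by rw [abs_neg]; exact Real.abs_sin_le_one _) (hR1 t) (hR2 t))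
    rw [htrig]
    module
  · refine hzero x₂ fun t => ?_
    refine le_of_eq_of_le (congrArg norm ?_) (hcomb (-Real.sin (β * t)) (-Real.cos (β * t)) _ _
      (by rw [abs_neg]; exact Real.abs_sin_le_one _) (by rw [abs_neg]; exact Real.abs_cos_le_one _)
      (hR1 t) (hR2 t))
    rw [htrig]
    module

end HallRing

/-! ### The rescaled pencil and its limit. -/

namespace HallRing

variable {n : ℕ} {ε : ℝ} {μ : Fin n → ℝ}

/-- Radial response to radial displacements. -/
noncomputable def radRad (μ : Fin n → ℝ) (τ : ℝ) (q : Fin n → ℂ) : Matrix (Fin n) (Fin n) ℝ :=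
  Matrix.of fun k l => (helioOp (τ ^ 2) μ q (radial q (Pi.single l 1)) k / q k).re

/-- Tangential response to radial displacements, divided by `ε`. -/
noncomputable def tanRad (μ : Fin n → ℝ) (q : Fin n → ℂ) : Matrix (Fin n) (Fin n) ℝ :=
  Matrix.of fun k l => ((helioOp 1 μ q (radial q (Pi.single l 1)) k
    - helioOp 0 μ q (radial q (Pi.single l 1)) k) / q k).im

/-- Radial response to tangential displacements, divided by `ε`. -/
noncomputable def radTan (μ : Fin n → ℝ) (q : Fin n → ℂ) : Matrix (Fin n) (Fin n) ℝ :=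
  Matrix.of fun k l => (angularForce μ q (Pi.single l 1) k / q k).re

/-- Tangential response to tangential displacements, divided by `ε`. -/
noncomputable def tanTan (μ : Fin n → ℝ) (q : Fin n → ℂ) : Matrix (Fin n) (Fin n) ℝ :=
  Matrix.of fun k l => (angularForce μ q (Pi.single l 1) k / q k).im

theorem sum_smul_apply_single {f : (Fin n → ℝ) → Fin n → ℂ}
    (hadd : ∀ u v, f (u + v) = f u + f v) (hsmul : ∀ (c : ℝ) u, f (c • u) = c • f u)
    (u : Fin n → ℝ) (k : Fin n) : f u k = ∑ l, u l • f (Pi.single l 1) k := by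
  let F : (Fin n → ℝ) →ₗ[ℝ] (Fin n → ℂ) :=
    { toFun := f, map_add' := hadd, map_smul' := hsmul }
  have h : F u = F (∑ l, u l • Pi.single l (1 : ℝ)) := by rw [← pi_eq_sum_univ' u]
  rw [map_sum] at h
  simp only [map_smul] at h
  simpa [F] using congrFun h k

theorem radial_add (q : Fin n → ℂ) (s t : Fin n → ℝ) :
    radial q (s + t) = radial q s + radial q t := by
  funext k; simp [radial]; ring

theorem angularForce_add (q : Fin n → ℂ) (s t : Fin n → ℝ) :
    angularForce μ q (s + t) = angularForce μ q s + angularForce μ q t := by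
  funext k
  simp only [angularForce, Pi.add_apply, ← Finset.sum_add_distrib, ← add_smul]
  exact Finset.sum_congr rfl fun l _ => by congr 1; ring

theorem mulVec_re {f : (Fin n → ℝ) → Fin n → ℂ}
    (hadd : ∀ u v, f (u + v) = f u + f v) (hsmul : ∀ (c : ℝ) u, f (c • u) = c • f u)
    (q : Fin n → ℂ) (u : Fin n → ℝ) (k : Fin n) :
    (Matrix.of fun k l => (f (Pi.single l 1) k / q k).re).mulVec u k = (f u k / q k).re := by
  rw [sum_smul_apply_single hadd hsmul u k, Finset.sum_div, Complex.re_sum]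
  simp only [Matrix.mulVec, dotProduct, Matrix.of_apply, Complex.real_smul]
  refine Finset.sum_congr rfl fun l _ => ?_
  rw [mul_div_assoc, Complex.re_ofReal_mul, mul_comm]

theorem mulVec_im {f : (Fin n → ℝ) → Fin n → ℂ}
    (hadd : ∀ u v, f (u + v) = f u + f v) (hsmul : ∀ (c : ℝ) u, f (c • u) = c • f u)
    (q : Fin n → ℂ) (u : Fin n → ℝ) (k : Fin n) :
    (Matrix.of fun k l => (f (Pi.single l 1) k / q k).im).mulVec u k = (f u k / q k).im := by
  rw [sum_smul_apply_single hadd hsmul u k, Finset.sum_div, Complex.im_sum]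
  simp only [Matrix.mulVec, dotProduct, Matrix.of_apply, Complex.real_smul]
  refine Finset.sum_congr rfl fun l _ => ?_
  rw [mul_div_assoc, Complex.im_ofReal_mul, mul_comm]

theorem radRad_mulVec (τ : ℝ) (q : Fin n → ℂ) (u : Fin n → ℝ) (k : Fin n) :
    (radRad μ τ q).mulVec u k = (helioOp (τ ^ 2) μ q (radial q u) k / q k).re :=
  mulVec_re (f := fun u => helioOp (τ ^ 2) μ q (radial q u))
    (fun u v => by simp only [radial_add, map_add]) (fun c u => by simp only [radial_smul, map_smul])
    q u k

theorem radTan_mulVec (q : Fin n → ℂ) (s : Fin n → ℝ) (k : Fin n) :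
    (radTan μ q).mulVec s k = (angularForce μ q s k / q k).re :=
  mulVec_re (angularForce_add q) (angularForce_smul q) q s k

theorem tanTan_mulVec (q : Fin n → ℂ) (s : Fin n → ℝ) (k : Fin n) :
    (tanTan μ q).mulVec s k = (angularForce μ q s k / q k).im :=
  mulVec_im (angularForce_add q) (angularForce_smul q) q s k

theorem helioOp_affine (q x : Fin n → ℂ) (ε : ℝ) (k : Fin n) :
    helioOp ε μ q x k = helioOp 0 μ q x k + ε • (helioOp 1 μ q x k - helioOp 0 μ q x k) := by
  simp only [helioOp_apply]
  module

/-- At `ε = 0` radial displacements cause only radial forces, and `helioOp` is affine in `ε`. So the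
tangential response is exactly `ε` times the difference of the values at `1` and at `0`. -/
theorem tanRad_mulVec (τ : ℝ) {q : Fin n → ℂ} (hq : ∀ k, q k ≠ 0) (u : Fin n → ℝ) (k : Fin n) :
    τ ^ 2 * (tanRad μ q).mulVec u k = (helioOp (τ ^ 2) μ q (radial q u) k / q k).im := by
  have h1 := mulVec_im (f := fun u => fun k => helioOp 1 μ q (radial q u) k
    - helioOp 0 μ q (radial q u) k)
    (fun u v => by
      funext k
      simp only [radial_add, map_add, Pi.add_apply]
      ring)
    (fun c u => by
      funext k
      simp only [radial_smul, map_smul, Pi.smul_apply, smul_sub]) q u k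
  rw [tanRad, h1, helioOp_affine _ _ (τ ^ 2), add_div, Complex.add_im, Complex.real_smul,
    mul_div_assoc, Complex.im_ofReal_mul, right_eq_add]
  have h2 : helioOp 0 μ q (radial q u) k / q k = ((u k + 2 * u k * (‖q k‖ ^ 3)⁻¹ : ℝ) : ℂ) := by
    rw [div_eq_iff (hq k)]
    simp only [helioOp_apply, radial, map_smul, tidal_self, newton, zero_smul, add_zero]
    simp only [Complex.real_smul]
    push_cast
    ring
  rw [h2, Complex.ofReal_im]

/-- The displacement with given radial and tangential coordinates. -/
noncomputable def frame (q : Fin n → ℂ) (U : Fin n ⊕ Fin n → ℝ) : Fin n → ℂ :=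
  radial q (U ∘ Sum.inl) + tangential q (U ∘ Sum.inr)

theorem frame_add (q : Fin n → ℂ) (U V : Fin n ⊕ Fin n → ℝ) :
    frame q (U + V) = frame q U + frame q V := by
  funext k; simp [frame, radial, tangential]; ring

theorem frame_smul (q : Fin n → ℂ) (c : ℝ) (U : Fin n ⊕ Fin n → ℝ) :
    frame q (c • U) = c • frame q U := by
  funext k; simp [frame, radial, tangential]; ring

theorem frame_injective {q : Fin n → ℂ} (hq : ∀ k, q k ≠ 0) {U : Fin n ⊕ Fin n → ℝ}
    (h : frame q U = 0) : U = 0 := by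
  have h1 : ∀ k, (U (Sum.inl k) : ℂ) + U (Sum.inr k) * Complex.I = 0 := by
    intro k
    refine (mul_eq_zero.1 ?_).resolve_right (hq k)
    have := congrFun h k
    simp [frame, radial, tangential] at this
    linear_combination this
  funext i
  rcases i with k | k
  · simpa using congrArg Complex.re (h1 k)
  · simpa using congrArg Complex.im (h1 k)

/-- `helioOp` in radial and tangential coordinates. -/
noncomputable def helioMatrix (μ : Fin n → ℝ) (τ : ℝ) (q : Fin n → ℂ) :
    Matrix (Fin n ⊕ Fin n) (Fin n ⊕ Fin n) ℝ :=
  Matrix.fromBlocks (radRad μ τ q) (τ ^ 2 • radTan μ q) (τ ^ 2 • tanRad μ q) (τ ^ 2 • tanTan μ q)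

/-- Multiplication by `i` in radial and tangential coordinates. -/
def rotMatrix (n : ℕ) : Matrix (Fin n ⊕ Fin n) (Fin n ⊕ Fin n) ℝ :=
  Matrix.fromBlocks 0 (-1) 1 0

theorem frame_helioMatrix {τ : ℝ} {q : Fin n → ℂ} (h : IsHelioEq (τ ^ 2) μ q)
    (U : Fin n ⊕ Fin n → ℝ) :
    frame q ((helioMatrix μ τ q).mulVec U) = helioOp (τ ^ 2) μ q (frame q U) := by
  funext k
  rw [frame, frame, map_add, helioOp_tangential h, helioMatrix, Matrix.fromBlocks_mulVec]
  simp only [Pi.add_apply, radial, tangential, Function.comp_apply, Sum.elim_inl, Sum.elim_inr,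
    Matrix.smul_mulVec, Pi.smul_apply, smul_eq_mul, radRad_mulVec, radTan_mulVec, tanTan_mulVec,
    tanRad_mulVec τ h.ne_zero]
  have e : ∀ x : ℂ, x = ((x / q k).re + (x / q k).im * Complex.I) * q k := fun x => by
    rw [Complex.re_add_im, div_mul_cancel₀ _ (h.ne_zero k)]
  have e1 := e (helioOp (τ ^ 2) μ q (radial q (U ∘ Sum.inl)) k)
  have e2 := e (angularForce μ q (U ∘ Sum.inr) k)
  simp only [Complex.real_smul] at e1 ⊢
  push_cast
  linear_combination -e1 - (τ : ℂ) ^ 2 * e2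

theorem frame_rotMatrix (q : Fin n → ℂ) (U : Fin n ⊕ Fin n → ℝ) :
    frame q ((rotMatrix n).mulVec U) = fun k => Complex.I * frame q U k := by
  funext k
  rw [rotMatrix, Matrix.fromBlocks_mulVec]
  simp [frame, radial, tangential, Matrix.neg_mulVec]
  linear_combination -(U (Sum.inr k) : ℂ) * q k * Complex.I_sq

theorem imaginarySpectrum_of_isLinearlyStable {τ : ℝ} {z : Fin (n + 1) → ℂ}
    (hM : 1 + τ ^ 2 * ∑ k, μ k ≠ 0) (hz : IsRelativeEquilibrium (smallMasses μ (τ ^ 2)) z)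
    (hst : IsLinearlyStable (smallMasses μ (τ ^ 2)) z) :
    ImaginarySpectrum (phaseMatrix (helioMatrix μ τ fun k => z k.succ - z 0) (rotMatrix n)) := by
  have hq := IsHelioEq.of_isRelativeEquilibrium hz
  intro α β v w hα hv hw
  set q : Fin n → ℂ := fun k => z k.succ - z 0 with hqdef
  have hl : ∀ v, (phaseMatrix (helioMatrix μ τ q) (rotMatrix n)).mulVec v ∘ Sum.inl
      = v ∘ Sum.inr := by
    intro v
    rw [phaseMatrix, Matrix.fromBlocks_mulVec]
    funext k; simp
  have hr : ∀ v, frame q ((phaseMatrix (helioMatrix μ τ q) (rotMatrix n)).mulVec v ∘ Sum.inr)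
      = (fun k => -2 * Complex.I * frame q (v ∘ Sum.inr) k)
        + helioOp (τ ^ 2) μ q (frame q (v ∘ Sum.inl)) := by
    intro v
    have e : (phaseMatrix (helioMatrix μ τ q) (rotMatrix n)).mulVec v ∘ Sum.inr
        = (helioMatrix μ τ q).mulVec (v ∘ Sum.inl)
          + (-2 : ℝ) • (rotMatrix n).mulVec (v ∘ Sum.inr) := by
      rw [phaseMatrix, Matrix.fromBlocks_mulVec]
      funext k; simp [Matrix.neg_mulVec, Matrix.smul_mulVec]
    rw [e, frame_add, frame_smul, frame_helioMatrix hq, frame_rotMatrix]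
    funext k
    simp
    ring
  have hsub : ∀ (a b : ℝ) (v w : Fin n ⊕ Fin n → ℝ),
      frame q (a • v - b • w) = a • frame q v - b • frame q w := by
    intro a b v w
    rw [sub_eq_add_neg, ← neg_smul, frame_add, frame_smul, frame_smul, neg_smul, sub_eq_add_neg]
  have h1 : frame q (v ∘ Sum.inr) = α • frame q (v ∘ Sum.inl) - β • frame q (w ∘ Sum.inl) := by
    rw [← hl v, hv, ← hsub]; rfl
  have h2 : frame q (w ∘ Sum.inr) = β • frame q (v ∘ Sum.inl) + α • frame q (w ∘ Sum.inl) := by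
    rw [← hl w, hw, ← frame_smul, ← frame_smul, ← frame_add]; rfl
  have h3 : (fun k => -2 * Complex.I * frame q (v ∘ Sum.inr) k)
      + helioOp (τ ^ 2) μ q (frame q (v ∘ Sum.inl))
      = α • frame q (v ∘ Sum.inr) - β • frame q (w ∘ Sum.inr) := by
    rw [← hr v, hv, ← hsub]; rfl
  have h4 : (fun k => -2 * Complex.I * frame q (w ∘ Sum.inr) k)
      + helioOp (τ ^ 2) μ q (frame q (w ∘ Sum.inl))
      = β • frame q (v ∘ Sum.inr) + α • frame q (w ∘ Sum.inr) := by
    rw [← hr w, hw, ← frame_smul, ← frame_smul, ← frame_add]; rfl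
  obtain ⟨hv0, hw0⟩ := eigenvector_eq_zero_of_isLinearlyStable hM hz hst hα h1 h2 h3 h4
  rw [hv0, hw0] at h1 h2
  simp only [smul_zero, sub_zero, add_zero] at h1 h2
  have e := fun U => frame_injective hq.ne_zero (U := U)
  have e1 := e _ hv0
  have e2 := e _ hw0
  have e3 := e _ h1
  have e4 := e _ h2
  constructor <;> funext i <;> rcases i with k | k
  · exact congrFun e1 k
  · exact congrFun e3 k
  · exact congrFun e2 k
  · exact congrFun e4 k

/-- The rescaled matrix pencil of the linearization. -/
noncomputable def pencil (μ : Fin n → ℝ) (τ : ℝ) (q : Fin n → ℂ) (σ : ℝ) :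
    Matrix (Fin n ⊕ Fin n) (Fin n ⊕ Fin n) ℝ :=
  Matrix.fromBlocks ((τ * σ) ^ 2 • 1 - radRad μ τ q) (-(2 * σ) • 1 - τ • radTan μ q)
    ((2 * σ) • 1 - τ • tanRad μ q) (σ ^ 2 • 1 - tanTan μ q)

/-- The determinant inequality is applied at `τ x` and `τ y`, the scale of the slow eigenvalues. The
common power of `τ` cancels, and the remaining matrices converge as `τ → 0`. -/
theorem det_pencil_le {τ : ℝ} (hτ : 0 < τ) {z : Fin (n + 1) → ℂ}
    (hM : 1 + τ ^ 2 * ∑ k, μ k ≠ 0) (hz : IsRelativeEquilibrium (smallMasses μ (τ ^ 2)) z)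
    (hst : IsLinearlyStable (smallMasses μ (τ ^ 2)) z) {x y : ℝ} (hx : 0 < x) (hxy : x ≤ y) :
    (x / y) ^ Fintype.card ((Fin n ⊕ Fin n) ⊕ (Fin n ⊕ Fin n)) *
      |(pencil μ τ (fun k => z k.succ - z 0) y).det| ≤
      |(pencil μ τ (fun k => z k.succ - z 0) x).det| := by
  have h := (imaginarySpectrum_of_isLinearlyStable hM hz hst).det_le (mul_pos hτ hx)
    (mul_le_mul_of_nonneg_left hxy hτ.le)
  have hy : 0 < y := hx.trans_le hxy
  have key : ∀ σ : ℝ, 0 < σ → (Matrix.scalar ((Fin n ⊕ Fin n) ⊕ (Fin n ⊕ Fin n)) (τ * σ)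
      - phaseMatrix (helioMatrix μ τ fun k => z k.succ - z 0) (rotMatrix n)).det
      = τ ^ (2 * Fintype.card (Fin n)) * (pencil μ τ (fun k => z k.succ - z 0) σ).det := by
    intro σ hσ
    rw [det_scalar_sub_phaseMatrix _ _ (mul_pos hτ hσ).ne', pencil, ← det_fromBlocks_smul]
    congr 1
    rw [rotMatrix, helioMatrix, ← Matrix.fromBlocks_one, Matrix.fromBlocks_smul,
      Matrix.fromBlocks_smul, Matrix.fromBlocks_add, sub_eq_add_neg, Matrix.fromBlocks_neg,
      Matrix.fromBlocks_add]
    congr 1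
    · simp [sub_eq_add_neg]
    · simp only [smul_zero, zero_add]
      module
    · simp only [smul_zero, zero_add]
      module
    · simp only [smul_zero, add_zero]
      module
  rw [key x hx, key y hy, mul_div_mul_left _ _ hτ.ne', abs_mul, abs_mul, mul_left_comm] at h
  exact le_of_mul_le_mul_left h (by positivity)

theorem continuousAt_det_pencil {θ : Fin n → ℝ} (h : Separated θ) (σ : ℝ) :
    ContinuousAt (fun p : ℝ × (Fin n → ℂ) => (pencil μ p.1 p.2 σ).det) (0, ringConfig θ) := by
  have hne : ∀ k, ringConfig θ k ≠ 0 := fun k => Complex.exp_ne_zero _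
  have hq : ContinuousAt (fun p : ℝ × (Fin n → ℂ) => p.2) (0, ringConfig θ) := continuousAt_snd
  have hqk : ∀ k, ContinuousAt (fun p : ℝ × (Fin n → ℂ) => p.2 k) (0, ringConfig θ) := by
    intro k; fun_prop
  have hτ : ContinuousAt (fun p : ℝ × (Fin n → ℂ) => p.1) (0, ringConfig θ) := continuousAt_fst
  have hA : ∀ (e : ℝ × (Fin n → ℂ) → ℝ) (_ : ContinuousAt e (0, ringConfig θ)) k l,
      ContinuousAt (fun p : ℝ × (Fin n → ℂ) =>
        helioOp (e p) μ p.2 (radial p.2 (Pi.single l 1)) k) (0, ringConfig θ) := fun e he k l =>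
    continuousAt_pi.1 (continuousAt_helioOp he hq (continuousAt_radial hq continuousAt_const)
      hne h.injective) k
  have hF : ∀ k l, ContinuousAt (fun p : ℝ × (Fin n → ℂ) =>
        angularForce μ p.2 (Pi.single l 1) k / p.2 k) (0, ringConfig θ) := fun k l =>
    (continuousAt_pi.1 (continuousAt_angularForce hq continuousAt_const hne h.injective) k).div
      (hqk k) (hne k)
  have hre : ∀ {f : ℝ × (Fin n → ℂ) → ℂ}, ContinuousAt f (0, ringConfig θ) →
      ContinuousAt (fun p => (f p).re) (0, ringConfig θ) := fun hf =>
    Complex.continuous_re.continuousAt.comp hf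
  have him : ∀ {f : ℝ × (Fin n → ℂ) → ℂ}, ContinuousAt f (0, ringConfig θ) →
      ContinuousAt (fun p => (f p).im) (0, ringConfig θ) := fun hf =>
    Complex.continuous_im.continuousAt.comp hf
  have hm : ContinuousAt (fun p : ℝ × (Fin n → ℂ) => pencil μ p.1 p.2 σ) (0, ringConfig θ) := by
    refine continuousAt_pi.2 fun i => continuousAt_pi.2 fun k => ?_
    rcases i with i | i <;> rcases k with k | k
    · exact (((hτ.mul continuousAt_const).pow 2).mul continuousAt_const).sub
        (hre ((hA _ (hτ.pow 2) i k).div (hqk i) (hne i)))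
    · exact continuousAt_const.sub (hτ.mul (hre (hF i k)))
    · exact continuousAt_const.sub (hτ.mul (him (((hA _ continuousAt_const i k).sub
        (hA _ continuousAt_const i k)).div (hqk i) (hne i))))
    · exact continuousAt_const.sub (him (hF i k))
  exact ContinuousAt.comp (g := Matrix.det) (continuous_id.matrix_det).continuousAt hm

/-- Eliminating `u = -(2/3) σ s` leaves `H s = -(σ²/3) μ s`. So the limiting determinant vanishes at
a real `σ > 0` exactly when `-σ²/3` is a generalized eigenvalue of the Hessian. -/
theorem pencil_zero_mulVec {θ : Fin n → ℝ} (h : Separated θ) (hμ : ∀ k, 0 < μ k) (σ : ℝ)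
    (u s : Fin n → ℝ) : (pencil μ 0 (ringConfig θ) σ).mulVec (Sum.elim u s) = 0 ↔
      (∀ k, 3 * u k + 2 * σ * s k = 0) ∧
      ∀ k, μ k * (2 * σ * u k + σ ^ 2 * s k) = (hallHessian μ θ).mulVec s k := by
  have hne : ∀ k, ringConfig θ k ≠ 0 := fun k => Complex.exp_ne_zero _
  have h1 : ∀ k, (radRad μ 0 (ringConfig θ)).mulVec u k = 3 * u k := by
    intro k
    rw [radRad_mulVec, zero_pow two_ne_zero, helioOp_radial_zero]
    simp only [Pi.smul_apply, radial, Complex.real_smul]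
    rw [mul_div_assoc, mul_div_cancel_right₀ _ (hne k), ← Complex.ofReal_mul, Complex.ofReal_re]
  have h2 : ∀ k, μ k * (tanTan μ (ringConfig θ)).mulVec s k = (hallHessian μ θ).mulVec s k := by
    intro k
    have e : ∀ x : ℂ, (x / ringConfig θ k).im = inner ℝ (Complex.I * ringConfig θ k) x := by
      intro x
      have hn : Complex.normSq (ringConfig θ k) = 1 := by
        rw [Complex.normSq_eq_norm_sq, ringConfig, Complex.norm_exp_ofReal_mul_I, one_pow]
      rw [Complex.div_im, hn]
      simp [Complex.inner]
    rw [tanTan_mulVec, e, inner_angularForce h, hallHessian_mulVec h, Finset.mul_sum]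
    exact Finset.sum_congr rfl fun l _ => by ring
  rw [pencil, Matrix.fromBlocks_mulVec, Sum.elim_comp_inl, Sum.elim_comp_inr]
  rw [funext_iff, Sum.forall]
  simp only [Sum.elim_inl, Sum.elim_inr, Pi.add_apply, Matrix.sub_mulVec, Matrix.smul_mulVec,
    Matrix.one_mulVec, Pi.sub_apply, Pi.smul_apply, smul_eq_mul, zero_mul, zero_smul,
    Matrix.zero_mulVec, Pi.zero_apply, h1, ← h2]
  refine and_congr (forall_congr' fun k => ?_) (forall_congr' fun k => ?_)
  · constructor <;> intro e <;> linarith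
  · rw [mul_right_inj' (hμ k).ne']
    constructor <;> intro e <;> linarith

/-- Conjugation with `diag(μ^{-1/2})` gives an ordinary symmetric matrix, which has a negative
eigenvalue because congruence preserves semidefiniteness. -/
theorem exists_neg_generalized_eigenvalue (hμ : ∀ k, 0 < μ k) {H : Matrix (Fin n) (Fin n) ℝ}
    (hH : H.IsHermitian) (hneg : ¬ H.PosSemidef) :
    ∃ (c : ℝ) (s : Fin n → ℝ), 0 < c ∧ s ≠ 0 ∧ ∀ k, H.mulVec s k = -c * (μ k * s k) := by
  set D : Matrix (Fin n) (Fin n) ℝ := Matrix.diagonal fun k => (√(μ k))⁻¹ with hD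
  set E : Matrix (Fin n) (Fin n) ℝ := Matrix.diagonal fun k => √(μ k) with hE
  have hs : ∀ k, √(μ k) ≠ 0 := fun k => (Real.sqrt_pos.2 (hμ k)).ne'
  have hED : E * D = 1 := by
    rw [hE, hD, Matrix.diagonal_mul_diagonal, ← Matrix.diagonal_one]
    congr 1; funext k; exact mul_inv_cancel₀ (hs k)
  have hDE : D * E = 1 := by
    rw [hE, hD, Matrix.diagonal_mul_diagonal, ← Matrix.diagonal_one]
    congr 1; funext k; exact inv_mul_cancel₀ (hs k)
  have hDt : D.conjTranspose = D := by simp [hD]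
  have hEt : E.conjTranspose = E := by simp [hE]
  have hA : (D * H * D).IsHermitian := by
    have := Matrix.isHermitian_conjTranspose_mul_mul D hH
    rwa [hDt] at this
  have hA' : ¬ (D * H * D).PosSemidef := by
    intro h
    refine hneg ?_
    have h1 := h.conjTranspose_mul_mul_same E
    have h2 : E * (D * H * D) * E = (E * D) * H * (D * E) := by simp only [Matrix.mul_assoc]
    rwa [hEt, h2, hED, hDE, one_mul, mul_one] at h1
  rw [hA.posSemidef_iff_eigenvalues_nonneg] at hA'
  obtain ⟨i, hi⟩ : ∃ i, hA.eigenvalues i < 0 := by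
    by_contra! hc
    exact hA' fun i => hc i
  set w : Fin n → ℝ := ⇑(hA.eigenvectorBasis i) with hw
  have hw0 : w ≠ 0 := by
    intro h
    refine hA.eigenvectorBasis.orthonormal.ne_zero i ?_
    ext k
    exact congrFun h k
  have hev := hA.mulVec_eigenvectorBasis i
  rw [← hw] at hev
  refine ⟨-hA.eigenvalues i, D.mulVec w, by linarith, ?_, fun k => ?_⟩
  · intro h
    refine hw0 ?_
    have := congrArg E.mulVec h
    rwa [Matrix.mulVec_mulVec, hED, Matrix.one_mulVec, Matrix.mulVec_zero] at this
  · have h1 : H.mulVec (D.mulVec w) = E.mulVec ((D * H * D).mulVec w) := by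
      rw [Matrix.mulVec_mulVec, Matrix.mulVec_mulVec, ← Matrix.mul_assoc, ← Matrix.mul_assoc, hED,
        one_mul]
    have eE : ∀ v k, E.mulVec v k = √(μ k) * v k := fun v k => by rw [hE, Matrix.mulVec_diagonal]
    have eD : ∀ v k, D.mulVec v k = (√(μ k))⁻¹ * v k := fun v k => by
      rw [hD, Matrix.mulVec_diagonal]
    rw [h1, hev, eE, eD, Pi.smul_apply, smul_eq_mul]
    have h2 : μ k = √(μ k) * √(μ k) := (Real.mul_self_sqrt (hμ k).le).symm
    have h3 := hs k
    rw [neg_neg]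
    nth_rw 2 [h2]
    field_simp

/-- Gershgorin's argument: compare both sides at a component of largest modulus. -/
theorem exists_no_large_generalized_eigenvalue (hμ : ∀ k, 0 < μ k) (H : Matrix (Fin n) (Fin n) ℝ) :
    ∃ c₀ : ℝ, ∀ (c : ℝ) (s : Fin n → ℝ), c₀ < c → (∀ k, H.mulVec s k = -c * (μ k * s k)) →
      s = 0 := by
  refine ⟨∑ k, (∑ l, |H k l|) / μ k, fun c s hc hs => ?_⟩
  by_contra hne
  obtain ⟨i, hi⟩ := Function.ne_iff.1 hne
  have : Nonempty (Fin n) := ⟨i⟩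
  obtain ⟨k, hk⟩ := Finite.exists_max fun k => |s k|
  have hpos : 0 < |s k| := (abs_pos.2 hi).trans_le (hk i)
  have hnn : ∀ k, 0 ≤ (∑ l, |H k l|) / μ k := fun k =>
    div_nonneg (Finset.sum_nonneg fun _ _ => abs_nonneg _) (hμ k).le
  have hc0 : 0 < c := (Finset.sum_nonneg fun k _ => hnn k).trans_lt hc
  have h1 : c * (μ k * |s k|) ≤ (∑ l, |H k l|) * |s k| := by
    have h2 : c * (μ k * |s k|) = |H.mulVec s k| := by
      rw [hs k, abs_mul, abs_mul, abs_neg, abs_of_pos hc0, abs_of_pos (hμ k)]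
    rw [h2, Matrix.mulVec, dotProduct, Finset.sum_mul]
    refine (Finset.abs_sum_le_sum_abs _ _).trans (Finset.sum_le_sum fun l _ => ?_)
    rw [abs_mul]
    exact mul_le_mul_of_nonneg_left (hk l) (abs_nonneg _)
  have h3 : c ≤ (∑ l, |H k l|) / μ k := by
    rw [le_div_iff₀ (hμ k)]
    refine le_of_mul_le_mul_right ?_ hpos
    linarith
  have h4 := Finset.single_le_sum (f := fun k => (∑ l, |H k l|) / μ k) (fun k _ => hnn k)
    (Finset.mem_univ k)
  exact absurd (h3.trans h4) (not_le.2 hc)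

/-- If relative equilibria that accumulate at the configuration are linearly stable, Hall's
potential has no negative Hessian eigenvalue there. -/
theorem posSemidef_of_isLinearlyStable {θ : Fin n → ℝ} (hμ : ∀ k, 0 < μ k) (h : Separated θ)
    {ε : ℕ → ℝ} {z : ℕ → Fin (n + 1) → ℂ} (hε : ∀ s, 0 < ε s) (hε0 : Tendsto ε atTop (𝓝 0))
    (hz : Tendsto z atTop (𝓝 (circleConfig θ)))
    (hre : ∀ s, IsRelativeEquilibrium (smallMasses μ (ε s)) (z s))
    (hst : ∀ᶠ s in atTop, IsLinearlyStable (smallMasses μ (ε s)) (z s)) :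
    (hallHessian μ θ).PosSemidef := by
  by_contra hneg
  obtain ⟨c, s, hc, hs0, hs⟩ := exists_neg_generalized_eigenvalue hμ
    (hallHessian_isHermitian h) hneg
  obtain ⟨c₀, hc0⟩ := exists_no_large_generalized_eigenvalue hμ (hallHessian μ θ)
  -- The limiting determinant vanishes at `x`, because `-c = -x²/3` is a generalized eigenvalue. The
  -- number `y` is chosen so large that it does not vanish there.
  set x := √(3 * c) with hx
  have hxpos : 0 < x := Real.sqrt_pos.2 (by linarith)
  have hx2 : x ^ 2 = 3 * c := Real.sq_sqrt (by linarith)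
  set y := √(3 * (|c₀| + c + 1)) with hy
  have hy2 : y ^ 2 = 3 * (|c₀| + c + 1) := Real.sq_sqrt (by positivity)
  have hxy : x ≤ y := Real.sqrt_le_sqrt (by linarith [abs_nonneg c₀])
  have hypos : 0 < y := hxpos.trans_le hxy
  have hdx : (pencil μ 0 (ringConfig θ) x).det = 0 := by
    rw [← Matrix.exists_mulVec_eq_zero_iff]
    refine ⟨Sum.elim (fun k => -(2 / 3) * x * s k) s, ?_, (pencil_zero_mulVec h hμ x _ _).2
      ⟨fun k => by ring, fun k => ?_⟩⟩
    · intro e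
      exact hs0 (funext fun k => congrFun e (Sum.inr k))
    · rw [hs]
      linear_combination (-(1 / 3) * μ k * s k) * hx2
  have hdy : (pencil μ 0 (ringConfig θ) y).det ≠ 0 := by
    rw [Ne, ← Matrix.exists_mulVec_eq_zero_iff]
    rintro ⟨v, hv0, hv⟩
    rw [← Sum.elim_comp_inl_inr v, pencil_zero_mulVec h hμ] at hv
    obtain ⟨h1, h2⟩ := hv
    have h3 : v ∘ Sum.inr = 0 := by
      refine hc0 (|c₀| + c + 1) _ (by linarith [le_abs_self c₀]) fun k => ?_
      rw [← h2]
      linear_combination (2 / 3 * y * μ k) * h1 k - (1 / 3 * μ k * (v ∘ Sum.inr) k) * hy2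
    refine hv0 ?_
    rw [← Sum.elim_comp_inl_inr v, h3]
    funext i
    rcases i with k | k
    · have := h1 k
      rw [h3] at this
      simpa using this
    · rfl
  have hlim : Tendsto (fun i => ((√(ε i), fun k => z i k.succ - z i 0) : ℝ × (Fin n → ℂ))) atTop
      (𝓝 (0, ringConfig θ)) := by
    rw [nhds_prod_eq]
    refine Tendsto.prodMk ?_ ?_
    · have := (Real.continuous_sqrt.tendsto 0).comp hε0
      rwa [Real.sqrt_zero] at this
    · rw [tendsto_pi_nhds] at hz ⊢
      intro k
      have := (hz k.succ).sub (hz 0)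
      simpa [circleConfig, ringConfig] using this
  have hdet : ∀ σ : ℝ, Tendsto (fun i => |(pencil μ (√(ε i)) (fun k => z i k.succ - z i 0) σ).det|)
      atTop (𝓝 |(pencil μ 0 (ringConfig θ) σ).det|) := fun σ =>
    ((continuousAt_det_pencil h σ).tendsto.comp hlim).abs
  -- In the limit the inequality reads: a positive multiple of a nonzero number is at most zero.
  have hle := le_of_tendsto_of_tendsto ((hdet y).const_mul
    ((x / y) ^ Fintype.card ((Fin n ⊕ Fin n) ⊕ (Fin n ⊕ Fin n)))) (hdet x) (by
      filter_upwards [hst] with i hi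
      have hsq : √(ε i) ^ 2 = ε i := Real.sq_sqrt (hε i).le
      have hM : 1 + √(ε i) ^ 2 * ∑ k, μ k ≠ 0 := by
        have : 0 ≤ ∑ k, μ k := Finset.sum_nonneg fun k _ => (hμ k).le
        positivity
      refine det_pencil_le (Real.sqrt_pos.2 (hε i)) hM ?_ ?_ hxpos hxy <;> rw [hsq]
      · exact hre i
      · exact hi)
  rw [hdx, abs_zero] at hle
  have : 0 < (x / y) ^ Fintype.card ((Fin n ⊕ Fin n) ⊕ (Fin n ⊕ Fin n)) *
      |(pencil μ 0 (ringConfig θ) y).det| := by positivity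
  linarith

/-- Limits of relative equilibria are critical points of Hall's potential. -/
theorem sum_pairForce_eq_zero {θ : Fin n → ℝ} (h : Separated θ) (hre : IsRelEqOneN μ θ)
    (k : Fin n) : ∑ l, μ l * pairForce (θ l - θ k) = 0 := by
  obtain ⟨ε, z, hε, -, hz, heq⟩ := hre
  have hne : ∀ k, ringConfig θ k ≠ 0 := fun k => Complex.exp_ne_zero _
  have hlim : Tendsto (fun i => fun k => z i (Fin.succ k) - z i 0) atTop (𝓝 (ringConfig θ)) := by
    rw [tendsto_pi_nhds] at hz ⊢
    intro k
    have := (hz k.succ).sub (hz 0)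
    simpa [circleConfig, ringConfig] using this
  -- Central terms have no tangential component, so for each equilibrium `ε` can be divided out
  -- before passing to the limit.
  set F : (Fin n → ℂ) → ℝ := fun q => inner ℝ (Complex.I * q k)
    (∑ l, μ l • (newton (q l - q k) - newton (q l))) with hF
  have hc : ContinuousAt F (ringConfig θ) := by
    have hk : ∀ k, ContinuousAt (fun q : Fin n → ℂ => q k) (ringConfig θ) := fun k =>
      (continuous_apply k).continuousAt
    have hs : ContinuousAt (fun q : Fin n → ℂ => ∑ l, μ l • (newton (q l - q k) - newton (q l)))
        (ringConfig θ) := by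
      refine tendsto_finsetSum _ fun l _ => ?_
      have hl : ContinuousAt (fun q : Fin n → ℂ => newton (q l)) (ringConfig θ) :=
        ContinuousAt.comp (f := fun q : Fin n → ℂ => q l) (continuousAt_newton (hne l)) (hk l)
      refine (continuousAt_const (y := μ l)).smul (ContinuousAt.sub ?_ hl)
      by_cases hlk : l = k
      · subst hlk
        simp only [sub_self]
        exact continuousAt_const
      · exact ContinuousAt.comp (f := fun q : Fin n → ℂ => q l - q k) (continuousAt_newton
          (sub_ne_zero.2 fun e => hlk (h.injective e))) ((hk l).sub (hk k))
    exact (continuousAt_const.mul (hk k)).inner hs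
  have hzero : ∀ i, F (fun k => z i (Fin.succ k) - z i 0) = 0 := by
    intro i
    have hq := IsHelioEq.of_isRelativeEquilibrium (heq i)
    set q : Fin n → ℂ := fun k => z i (Fin.succ k) - z i 0
    have hI : inner ℝ (Complex.I * q k) (q k) = 0 := by
      simp [Complex.inner]; ring
    have h1 : inner ℝ (Complex.I * q k) (q k - newton (q k)
        + ε i • ∑ l, μ l • (newton (q l - q k) - newton (q l))) = 0 := by
      rw [hq.eq k, inner_zero_right]
    rw [inner_add_right, inner_sub_right, newton, real_inner_smul_right, real_inner_smul_right, hI,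
      mul_zero, sub_zero, zero_add] at h1
    exact (mul_eq_zero.1 h1).resolve_left (hε i).ne'
  have h0 : F (ringConfig θ) = 0 := by
    refine tendsto_nhds_unique (hc.tendsto.comp hlim) ?_
    exact tendsto_const_nhds.congr fun i => (hzero i).symm
  simp only [hF, inner_sum, real_inner_smul_right, ringConfig, inner_I_newton] at h0
  simpa using h0

end HallRing

/-! ### Linear stability as a condition on the Hessian. -/

namespace HallRing

variable {n : ℕ} {μ θ : Fin n → ℝ}

/-- A semidefinite form vanishes only on its kernel, here the constants, and nonzero vectors of mean
zero are not constant. -/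
theorem pos_of_posSemidef (hP : (hallHessian μ θ).PosSemidef) (hN : IsNondegenerate μ θ)
    {v : Fin n → ℝ} (hv : v ≠ 0) (hs : ∑ k, v k = 0) :
    0 < dotProduct v ((hallHessian μ θ).mulVec v) := by
  have h0 := hP.dotProduct_mulVec_nonneg v
  rw [star_trivial] at h0
  refine h0.lt_of_ne fun h => hv ?_
  have h1 : (hallHessian μ θ).mulVec v = 0 := by
    rw [← hP.dotProduct_mulVec_zero_iff, star_trivial]
    exact h.symm
  obtain ⟨c, rfl⟩ := hN v h1
  funext k
  have hn : (n : ℝ) ≠ 0 := by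
    have := k.pos
    positivity
  simpa [hn] using hs

/-- A relative equilibrium of the `(1 + n)`-body problem is linearly stable if and only if it is a
nondegenerate minimum of Hall's potential, to second order. -/
theorem isLinearlyStableOneN_iff (hμ : ∀ k, 0 < μ k) (h : Separated θ) (hre : IsRelEqOneN μ θ) :
    IsLinearlyStableOneN μ θ ↔ (hallHessian μ θ).PosSemidef ∧ IsNondegenerate μ θ := by
  constructor
  · rintro ⟨-, hN, hev⟩
    refine ⟨?_, hN⟩
    obtain ⟨ε, z, hε, hε0, hz, heq⟩ := hre
    refine posSemidef_of_isLinearlyStable hμ h hε hε0 hz heq ?_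
    have hlim : Tendsto (fun s => (ε s, z s)) atTop (𝓝[>] 0 ×ˢ 𝓝 (circleConfig θ)) :=
      (tendsto_nhdsWithin_iff.2 ⟨hε0, Eventually.of_forall hε⟩).prodMk hz
    filter_upwards [hlim.eventually hev] with s hs
    exact hs (heq s)
  · rintro ⟨hP, hN⟩
    refine ⟨hre, hN, ?_⟩
    have hlim : Tendsto (fun p : ℝ × (Fin (n + 1) → ℂ) => (p.1, fun k : Fin n => p.2 k.succ - p.2 0))
        (𝓝[>] 0 ×ˢ 𝓝 (circleConfig θ)) (𝓝[>] 0 ×ˢ 𝓝 (ringConfig θ)) := by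
      refine tendsto_fst.prodMk (Tendsto.comp (y := 𝓝 (circleConfig θ))
        (g := fun z : Fin (n + 1) → ℂ => fun k : Fin n => z k.succ - z 0) ?_ tendsto_snd)
      have hc : Continuous fun z : Fin (n + 1) → ℂ => fun k : Fin n => z k.succ - z 0 := by
        fun_prop
      have := hc.tendsto (circleConfig θ)
      have e : (fun k : Fin n => circleConfig θ k.succ - circleConfig θ 0) = ringConfig θ := by
        funext k
        simp [circleConfig, ringConfig]
      rwa [e] at this
    have hpos : ∀ᶠ p : ℝ × (Fin (n + 1) → ℂ) in 𝓝[>] 0 ×ˢ 𝓝 (circleConfig θ), 0 < p.1 :=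
      tendsto_fst.eventually self_mem_nhdsWithin
    filter_upwards [hlim.eventually (eventually_pos hμ h fun v hv hs => pos_of_posSemidef hP hN hv hs),
      hpos] with p hp h0 hz
    exact isLinearlyStable_of_pos h0 hμ hz (hp (IsHelioEq.of_isRelativeEquilibrium hz))

theorem sin_half_sub_ngonAngles (i k : Fin n) (hik : i ≠ k) :
    Real.sin ((ngonAngles n i - ngonAngles n k) / 2) ≠ 0 := by
  have hn : (0 : ℝ) < n := by exact_mod_cast i.pos
  have hn' := hn.ne'
  have e : (ngonAngles n i - ngonAngles n k) / 2 = ((i : ℝ) - k) / n * Real.pi := by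
    simp only [ngonAngles]; field_simp
  rw [e, Real.sin_ne_zero_iff]
  intro m hm
  have h1 : (m : ℝ) = ((i : ℝ) - k) / n := mul_right_cancel₀ Real.pi_ne_zero hm
  have hi : (i : ℝ) < n := by exact_mod_cast i.2
  have hk : (k : ℝ) < n := by exact_mod_cast k.2
  have hi0 : (0 : ℝ) ≤ i := by positivity
  have hk0 : (0 : ℝ) ≤ k := by positivity
  have h2 : (m : ℝ) < 1 := by rw [h1, div_lt_one hn]; linarith
  have h3 : (-1 : ℝ) < m := by rw [h1, lt_div_iff₀ hn]; linarith
  have h4 : m = 0 := by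
    have : m < 1 := by exact_mod_cast h2
    have : -1 < m := by exact_mod_cast h3
    omega
  rw [h4, Int.cast_zero, eq_comm, div_eq_zero_iff] at h1
  have : (i : ℝ) = k := by rcases h1 with h | h <;> linarith
  exact hik (Fin.ext (by exact_mod_cast this))

theorem separated_ngonAngles : Separated (ngonAngles n) := sin_half_sub_ngonAngles

theorem alternatingMasses_pos {a b : ℝ} (ha : 0 < a) (hb : 0 < b) (k : Fin n) :
    0 < alternatingMasses n a b k := by
  rw [alternatingMasses]; split_ifs <;> assumption

end HallRing

/-! ### Periodic sums and the vertices of a polygon. -/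

namespace HallRing

section PeriodicSums

variable {E : Type*} [AddCommGroup E]

theorem sum_range_add_int (n : ℕ) {h : ℤ → E} (hp : ∀ x, h (x + n) = h x) (k : ℤ) :
    ∑ l ∈ Finset.range n, h (l + k) = ∑ l ∈ Finset.range n, h l := by
  have step : ∀ k : ℤ, ∑ l ∈ Finset.range n, h (l + (k + 1)) = ∑ l ∈ Finset.range n, h (l + k) := by
    intro k
    have h1 := Finset.sum_range_succ (fun l : ℕ => h (l + k)) n
    rw [Finset.sum_range_succ'] at h1
    have e : h (n + k) = h ((0 : ℕ) + k) := by
      rw [add_comm, hp, Nat.cast_zero, zero_add]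
    rw [e] at h1
    rw [← add_right_cancel h1]
    refine Finset.sum_congr rfl fun l _ => ?_
    congr 1; push_cast; ring
  induction k using Int.induction_on with
  | zero => simp
  | succ i ih => rw [step, ih]
  | pred i ih => rw [← ih, ← step, sub_add_cancel]

theorem sum_range_neg_int (n : ℕ) {h : ℤ → E} (hp : ∀ x, h (x + n) = h x) :
    ∑ l ∈ Finset.range n, h (-l) = ∑ l ∈ Finset.range n, h l := by
  have hp' : ∀ x, h (x - n) = h x := fun x => by rw [← hp (x - n), sub_add_cancel]
  rw [← Finset.sum_range_reflect, ← sum_range_add_int n hp 1]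
  refine Finset.sum_congr rfl fun l hl => ?_
  have := Finset.mem_range.1 hl
  rw [← hp' (l + 1), Nat.sub_sub, Nat.cast_sub (by omega)]
  congr 1; push_cast; ring

theorem sum_range_two_mul (j : ℕ) (h : ℕ → E) :
    ∑ l ∈ Finset.range (2 * j), h l =
      ∑ d ∈ Finset.range j, (h (2 * d) + h (2 * d + 1)) := by
  induction j with
  | zero => simp
  | succ j ih =>
    rw [Finset.sum_range_succ, ← ih, show 2 * (j + 1) = 2 * j + 1 + 1 by ring,
      Finset.sum_range_succ, Finset.sum_range_succ, add_assoc]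

/-- A convolution sum with weights that depend on the parity. -/
theorem sum_parity_shift (j : ℕ) (W : ℤ → ℤ → E) (hW : ∀ k x, W (k + 2) x = W k x)
    (hp : ∀ k x, W k (x + (2 * j : ℕ)) = W k x) (k : ℤ) :
    ∑ l ∈ Finset.range (2 * j), W l (l - k) = ∑ l ∈ Finset.range (2 * j), W (l + k) l := by
  have hW2 : ∀ (m : ℕ) (k x : ℤ), W (k + 2 * m) x = W k x := by
    intro m
    induction m with
    | zero => simp
    | succ m ih =>
      intro k x
      rw [← ih k x, ← hW (k + 2 * m)]
      congr 1; push_cast; ring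
  have := sum_range_add_int (2 * j) (h := fun x => W x (x - k)) (fun x => by
    have h1 := hW2 j x (x - k + (2 * j : ℕ))
    rw [hp x] at h1
    rw [← h1, Nat.cast_mul, Nat.cast_ofNat, sub_add_eq_add_sub]) k
  rw [← this]
  simp

/-- The value `a` at even integers and `b` at odd ones. -/
def parityWeight {α : Type*} (a b : α) (x : ℤ) : α := if Even x then a else b

theorem parityWeight_add_two {α : Type*} (a b : α) (x : ℤ) :
    parityWeight a b (x + 2) = parityWeight a b x := by
  simp [parityWeight]

theorem parityWeight_neg {α : Type*} (a b : α) (x : ℤ) :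
    parityWeight a b (-x) = parityWeight a b x := by
  simp [parityWeight]

theorem parityWeight_add {α : Type*} (a b : α) (x k : ℤ) :
    parityWeight a b (x + k) = parityWeight (parityWeight a b k) (parityWeight b a k) x := by
  simp only [parityWeight, Int.even_add]
  split_ifs <;> tauto

theorem alternatingMasses_eq (n : ℕ) (a b : ℝ) (k : Fin n) :
    alternatingMasses n a b k = parityWeight a b (k : ℕ) := by
  simp [alternatingMasses, parityWeight]

end PeriodicSums

theorem ngonAngles_sub {n : ℕ} (l k : Fin n) :
    ngonAngles n l - ngonAngles n k = 2 * (((l : ℕ) - (k : ℕ) : ℤ) : ℝ) * Real.pi / n := by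
  simp only [ngonAngles]; push_cast; ring

/-- The vertex of the regular `n`-gon with an arbitrary integer index. -/
noncomputable def ngonVertex (n : ℕ) (x : ℤ) : ℂ :=
  Complex.exp ((2 * (x : ℝ) * Real.pi / n : ℝ) * Complex.I)

theorem ngonVertex_zero (n : ℕ) : ngonVertex n 0 = 1 := by simp [ngonVertex]

theorem ngonVertex_add (n : ℕ) (x y : ℤ) :
    ngonVertex n (x + y) = ngonVertex n x * ngonVertex n y := by
  rw [ngonVertex, ngonVertex, ngonVertex, ← Complex.exp_add]
  congr 1; push_cast; ring

theorem ngonVertex_neg (n : ℕ) (x : ℤ) : ngonVertex n (-x) = star (ngonVertex n x) := by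
  rw [ngonVertex, ngonVertex, Complex.star_def, ← Complex.exp_conj]
  congr 1
  rw [map_mul, Complex.conj_ofReal, Complex.conj_I]
  push_cast; ring

theorem norm_ngonVertex (n : ℕ) (x : ℤ) : ‖ngonVertex n x‖ = 1 := Complex.norm_exp_ofReal_mul_I _

theorem ngonVertex_natCast_self {n : ℕ} (hn : n ≠ 0) : ngonVertex n n = 1 := by
  have : (n : ℝ) ≠ 0 := by exact_mod_cast hn
  rw [ngonVertex, Int.cast_natCast, show 2 * (n : ℝ) * Real.pi / n = 2 * Real.pi by field_simp]
  push_cast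
  exact Complex.exp_two_pi_mul_I

theorem ngonVertex_eq_one_iff {n : ℕ} (hn : n ≠ 0) (x : ℤ) :
    ngonVertex n x = 1 ↔ (n : ℤ) ∣ x := by
  have hn' : (n : ℝ) ≠ 0 := by exact_mod_cast hn
  rw [ngonVertex, Complex.exp_eq_one_iff]
  refine exists_congr fun m => ?_
  have e : (m : ℂ) * (2 * Real.pi * Complex.I) = ((m * (2 * Real.pi) : ℝ) : ℂ) * Complex.I := by
    push_cast; ring
  rw [e, mul_left_inj' Complex.I_ne_zero, Complex.ofReal_inj, div_eq_iff hn']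
  have hpi := Real.pi_ne_zero
  constructor
  · intro h
    have : (x : ℝ) = n * m := by
      apply mul_left_cancel₀ (mul_ne_zero two_ne_zero hpi); linear_combination h
    exact_mod_cast this
  · rintro rfl
    push_cast; ring

theorem ngonVertex_add_self {n : ℕ} (hn : n ≠ 0) (x : ℤ) :
    ngonVertex n (x + n) = ngonVertex n x := by
  rw [ngonVertex_add, ngonVertex_natCast_self hn, mul_one]

theorem ringConfig_ngonAngles {n : ℕ} (k : Fin n) :
    ringConfig (ngonAngles n) k = ngonVertex n (k : ℕ) := by
  simp [ringConfig, ngonAngles, ngonVertex]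

/-- A rotation by two vertices preserves the weights and multiplies the sum by `ngonVertex (2 * j)
2`, which is not `1` for `j ≥ 2`. -/
theorem sum_parityWeight_mul_ngonVertex {j : ℕ} (hj : 2 ≤ j) (a b : ℂ) :
    ∑ l ∈ Finset.range (2 * j), parityWeight a b l * ngonVertex (2 * j) l = 0 := by
  have h0 : 2 * j ≠ 0 := by omega
  have hper : ∀ x : ℤ, parityWeight a b (x + (2 * j : ℕ)) = parityWeight a b x := fun x => by
    simp [parityWeight, Int.even_add]
  have := sum_range_add_int (2 * j) (h := fun x => parityWeight a b x * ngonVertex (2 * j) x)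
    (fun x => by rw [ngonVertex_add_self h0, hper]) 2
  simp only [parityWeight_add_two, ngonVertex_add, ← mul_assoc, ← Finset.sum_mul] at this
  have h1 : ngonVertex (2 * j) 2 ≠ 1 := by
    rw [Ne, ngonVertex_eq_one_iff h0]
    intro h
    have := Int.le_of_dvd (by norm_num) h
    push_cast at this
    omega
  by_contra hne
  exact h1 (mul_left_cancel₀ hne (this.trans (mul_one _).symm))

end HallRing

/-! ### Existence of equilibria: two concentric polygons. -/

namespace HallRing

theorem newton_mul {u : ℂ} (hu : ‖u‖ = 1) (w : ℂ) : newton (u * w) = u * newton w := by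
  rw [newton, newton, norm_mul, hu, one_mul, mul_smul_comm]

theorem newton_smul {r : ℝ} (hr : 0 < r) (w : ℂ) : newton (r • w) = (r ^ 2)⁻¹ • newton w := by
  rw [newton, newton, norm_smul, Real.norm_of_nonneg hr.le, smul_smul, smul_smul]
  congr 1
  have := hr.ne'
  field_simp

theorem newton_star (w : ℂ) : newton (star w) = star (newton w) := by
  rw [newton, newton, norm_star, star_smul, star_trivial (‖w‖ ^ 3)⁻¹]

/-- The pull on a body at distance `R` and angle zero of the other vertices of a `2j`-gon, with
masses `A` and distances `R` at even places, masses `B` and distances `R'` at odd places. -/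
noncomputable def ringPull (j : ℕ) (A B R R' : ℝ) : ℂ :=
  ∑ l ∈ Finset.range (2 * j), parityWeight A B l •
    newton ((parityWeight R R' l : ℝ) * ngonVertex (2 * j) l - R)

theorem parityWeight_add_two_mul {α : Type*} (a b : α) (x : ℤ) (j : ℕ) :
    parityWeight a b (x + (2 * j : ℕ)) = parityWeight a b x := by
  simp [parityWeight, Int.even_add]

/-- Reflection in the real axis permutes the vertices and preserves parities, so the pull is purely
radial. -/
theorem star_ringPull {j : ℕ} (hj : j ≠ 0) (A B R R' : ℝ) :
    star (ringPull j A B R R') = ringPull j A B R R' := by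
  have h0 : 2 * j ≠ 0 := by omega
  conv_rhs => rw [ringPull, ← sum_range_neg_int (2 * j) (h := fun x : ℤ => parityWeight A B x •
    newton ((parityWeight R R' x : ℝ) * ngonVertex (2 * j) x - R))
    (fun x => by simp only [parityWeight_add_two_mul, ngonVertex_add_self h0])]
  rw [ringPull, star_sum]
  refine Finset.sum_congr rfl fun l _ => ?_
  rw [star_smul, star_trivial, ← newton_star, parityWeight_neg, parityWeight_neg, ngonVertex_neg,
    star_sub, star_mul']
  simp

theorem ringPull_smul (j : ℕ) (A B R R' : ℝ) {r : ℝ} (hr : 0 < r) :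
    ringPull j A B (r * R) (r * R') = (r ^ 2)⁻¹ • ringPull j A B R R' := by
  rw [ringPull, ringPull, Finset.smul_sum]
  refine Finset.sum_congr rfl fun l _ => ?_
  rw [smul_comm, ← newton_smul hr]
  congr 2
  rw [parityWeight, parityWeight, Complex.real_smul]
  split_ifs <;> push_cast <;> ring

theorem continuousAt_ringPull {j : ℕ} (A B : ℝ) {p : ℝ × ℝ} (h1 : 0 < p.1) (h2 : 0 < p.2) :
    ContinuousAt (fun p : ℝ × ℝ => ringPull j A B p.1 p.2) p := by
  refine tendsto_finsetSum _ fun l hl => ?_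
  suffices h : ContinuousAt (fun p : ℝ × ℝ => newton
      ((parityWeight p.1 p.2 l : ℝ) * ngonVertex (2 * j) l - p.1)) p from
    (continuousAt_const (y := parityWeight A B (l : ℤ))).smul h
  rw [Finset.mem_range] at hl
  by_cases h0 : l = 0
  · subst h0
    simpa [parityWeight, ngonVertex_zero] using continuousAt_const
  · have hw : Continuous fun p : ℝ × ℝ => parityWeight p.1 p.2 l := by
      simp only [parityWeight]
      split_ifs <;> fun_prop
    refine ContinuousAt.comp (f := fun p : ℝ × ℝ =>
      ((parityWeight p.1 p.2 l : ℝ) : ℂ) * ngonVertex (2 * j) l - p.1) (continuousAt_newton ?_)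
      (by fun_prop)
    intro h
    have hpos : 0 < parityWeight p.1 p.2 l := by
      rw [parityWeight]; split_ifs <;> assumption
    rw [sub_eq_zero] at h
    have hn := congrArg norm h
    rw [norm_mul, norm_ngonVertex, mul_one, Complex.norm_real, Complex.norm_real,
      Real.norm_of_nonneg hpos.le, Real.norm_of_nonneg h1.le] at hn
    rw [hn] at h
    have hc : (p.1 : ℂ) ≠ 0 := by exact_mod_cast h1.ne'
    have := mul_left_cancel₀ hc (h.trans (mul_one _).symm)
    rw [ngonVertex_eq_one_iff (by omega)] at this
    have := Int.le_of_dvd (by omega) this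
    omega

/-- The dominant body at the centre, the others at the vertices of two regular `j`-gons. -/
noncomputable def twoRingConfig (j : ℕ) (R R' : ℝ) : Fin (2 * j + 1) → ℂ :=
  Fin.cons 0 fun k => (parityWeight R R' (k : ℕ) : ℝ) * ngonVertex (2 * j) (k : ℕ)

theorem gravAccel_twoRingConfig_zero {j : ℕ} (hj : 2 ≤ j) (a b ε : ℝ) {R R' : ℝ} (hR : 0 < R)
    (hR' : 0 < R') : gravAccel (smallMasses (alternatingMasses (2 * j) a b) ε)
      (twoRingConfig j R R') 0 = 0 := by
  rw [gravAccel_eq, Fin.sum_univ_succ]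
  simp only [sub_self, newton_zero, smul_zero, zero_add, smallMasses, twoRingConfig, Fin.cons_succ,
    Fin.cons_zero, sub_zero, alternatingMasses_eq]
  rw [Finset.sum_fin_eq_sum_range, ← sum_parityWeight_mul_ngonVertex hj
    ((ε * (a * (R ^ 2)⁻¹) : ℝ) : ℂ) ((ε * (b * (R' ^ 2)⁻¹) : ℝ) : ℂ)]
  refine Finset.sum_congr rfl fun l hl => ?_
  rw [dif_pos (Finset.mem_range.1 hl), mul_comm ((parityWeight R R' _ : ℝ) : ℂ),
    newton_mul (norm_ngonVertex _ _)]
  have : ∀ r : ℝ, 0 < r → newton r = ((r ^ 2)⁻¹ : ℝ) := fun r hr => by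
    have := newton_smul hr 1
    simpa [newton] using this
  simp only [parityWeight]
  split_ifs
  · rw [this R hR, Complex.real_smul]; push_cast; ring
  · rw [this R' hR', Complex.real_smul]; push_cast; ring

/-- Rotate body `k` to angle zero; if `k` is odd the two rings exchange their roles. -/
theorem gravAccel_twoRingConfig_succ {j : ℕ} (a b ε : ℝ) {R R' : ℝ} (hR : 0 < R)
    (hR' : 0 < R') (k : Fin (2 * j)) :
    gravAccel (smallMasses (alternatingMasses (2 * j) a b) ε) (twoRingConfig j R R') k.succ =
      ngonVertex (2 * j) (k : ℕ) * (-((parityWeight R R' (k : ℕ) ^ 2)⁻¹ : ℝ) +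
        ε * ringPull j (parityWeight a b (k : ℕ)) (parityWeight b a (k : ℕ))
          (parityWeight R R' (k : ℕ)) (parityWeight R' R (k : ℕ))) := by
  have h0 : 2 * j ≠ 0 := k.pos.ne'
  have hpos : 0 < parityWeight R R' (k : ℕ) := by
    rw [parityWeight]; split_ifs <;> assumption
  rw [gravAccel_eq, Fin.sum_univ_succ]
  simp only [smallMasses, twoRingConfig, Fin.cons_succ, Fin.cons_zero, zero_sub,
    alternatingMasses_eq]
  rw [mul_add]
  congr 1
  · have := newton_smul hpos 1
    rw [one_smul, newton_neg, mul_comm, newton_mul (norm_ngonVertex _ _), mul_neg]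
    congr 2
    simpa [newton] using this
  · rw [Finset.sum_fin_eq_sum_range]
    have key := sum_parity_shift j (fun x y => ngonVertex (2 * j) (k : ℕ) *
      (ε * (parityWeight a b x • newton ((parityWeight R R' x : ℝ) * ngonVertex (2 * j) y -
        (parityWeight R R' (k : ℕ) : ℝ))))) (fun x y => by simp only [parityWeight_add_two])
      (fun x y => by simp only [ngonVertex_add_self h0]) (k : ℕ)
    rw [ringPull, Finset.mul_sum, Finset.mul_sum]
    simp only [parityWeight_add] at key
    rw [← key]
    refine Finset.sum_congr rfl fun l hl => ?_
    have e : ((parityWeight R R' l : ℝ) : ℂ) * ngonVertex (2 * j) l -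
        (parityWeight R R' (k : ℕ) : ℝ) * ngonVertex (2 * j) (k : ℕ) =
        ngonVertex (2 * j) (k : ℕ) * ((parityWeight R R' l : ℝ) * ngonVertex (2 * j) (l - (k : ℕ)) -
          (parityWeight R R' (k : ℕ) : ℝ)) := by
      have : ngonVertex (2 * j) l = ngonVertex (2 * j) (k : ℕ) * ngonVertex (2 * j) (l - (k : ℕ)) := by
        rw [← ngonVertex_add, add_sub_cancel]
      rw [this]; ring
    rw [dif_pos (Finset.mem_range.1 hl), e, newton_mul (norm_ngonVertex _ _)]
    simp only [Complex.real_smul]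
    push_cast; ring

/-- By symmetry all the conditions reduce to one real radial equation for each ring. -/
theorem isRelativeEquilibrium_twoRingConfig {j : ℕ} (hj : 2 ≤ j) {a b ε R R' : ℝ} (hR : 0 < R)
    (hR' : 0 < R') (h1 : R ^ 3 - 1 + ε * R ^ 2 * (ringPull j a b R R').re = 0)
    (h2 : R' ^ 3 - 1 + ε * R' ^ 2 * (ringPull j b a R' R).re = 0) :
    IsRelativeEquilibrium (smallMasses (alternatingMasses (2 * j) a b) ε)
      (twoRingConfig j R R') := by
  have hpos : ∀ k : Fin (2 * j), 0 < parityWeight R R' (k : ℕ) := fun k => by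
    rw [parityWeight]; split_ifs <;> assumption
  have hring : ∀ k : Fin (2 * j), ((parityWeight R R' (k : ℕ) : ℝ) : ℂ) *
      ngonVertex (2 * j) (k : ℕ) ≠ 0 := fun k => by
    refine mul_ne_zero (by exact_mod_cast (hpos k).ne') ?_
    rw [← norm_ne_zero_iff, norm_ngonVertex]; exact one_ne_zero
  refine ⟨?_, ?_, ?_⟩
  · rw [twoRingConfig, Fin.cons_injective_iff]
    refine ⟨fun ⟨k, hk⟩ => hring k hk, fun i k hik => ?_⟩
    have hn := congrArg norm hik
    simp only [norm_mul, norm_ngonVertex, mul_one, Complex.norm_real,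
      Real.norm_of_nonneg (hpos _).le] at hn
    simp only [hn] at hik
    have := mul_left_cancel₀ (by exact_mod_cast (hpos k).ne') hik
    rw [← ringConfig_ngonAngles, ← ringConfig_ngonAngles] at this
    exact separated_ngonAngles.injective this
  · rw [Fin.sum_univ_succ]
    simp only [twoRingConfig, Fin.cons_zero, mul_zero, zero_add, smallMasses, Fin.cons_succ,
      alternatingMasses_eq]
    rw [Finset.sum_fin_eq_sum_range, ← sum_parityWeight_mul_ngonVertex hj
      ((ε * (a * R) : ℝ) : ℂ) ((ε * (b * R') : ℝ) : ℂ)]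
    refine Finset.sum_congr rfl fun l hl => ?_
    rw [dif_pos (Finset.mem_range.1 hl)]
    simp only [parityWeight]
    split_ifs <;> push_cast <;> ring
  · refine Fin.cases ?_ fun k => ?_
    · rw [gravAccel_twoRingConfig_zero hj a b ε hR hR', add_zero]
      rfl
    · rw [gravAccel_twoRingConfig_succ a b ε hR hR']
      simp only [twoRingConfig, Fin.cons_succ]
      have hre : ∀ A B R R' : ℝ, ringPull j A B R R' = ((ringPull j A B R R').re : ℂ) :=
        fun A B R R' => (Complex.conj_eq_iff_re.1 (star_ringPull (by omega) A B R R')).symm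
      have key : ∀ A B R R' : ℝ, 0 < R → R ^ 3 - 1 + ε * R ^ 2 * (ringPull j A B R R').re = 0 →
          (R : ℂ) + (-((R ^ 2)⁻¹ : ℝ) + ε * ringPull j A B R R') = 0 := by
        intro A B R R' hR h
        rw [hre]
        have : R + (-(R ^ 2)⁻¹ + ε * (ringPull j A B R R').re) = 0 := by
          have := hR.ne'
          field_simp
          linear_combination h
        exact_mod_cast this
      rw [mul_comm, ← mul_add]
      refine mul_eq_zero_of_right _ ?_
      simp only [parityWeight]
      split_ifs
      · exact key _ _ _ _ hR h1
      · exact key _ _ _ _ hR' h2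

theorem isRelEqOneN_of_frequently {n : ℕ} {μ θ : Fin n → ℝ}
    (h : ∃ᶠ p : ℝ × (Fin (n + 1) → ℂ) in 𝓝[>] 0 ×ˢ 𝓝 (circleConfig θ),
      IsRelativeEquilibrium (smallMasses μ p.1) p.2) : IsRelEqOneN μ θ := by
  have h' := h.and_eventually (tendsto_fst.eventually (self_mem_nhdsWithin (s := Set.Ioi (0 : ℝ))))
  obtain ⟨p, hp, hre⟩ := exists_seq_forall_of_frequently h'
  rw [tendsto_prod_iff'] at hp
  exact ⟨fun s => (p s).1, fun s => (p s).2, fun s => (hre s).2,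
    tendsto_nhds_of_tendsto_nhdsWithin hp.1, hp.2, fun s => (hre s).1⟩

/-- At `ε = 0` the function `ρ³ - 1` changes sign between `1 - d` and `1 + d`. For small `ε` it
still does, and the intermediate value theorem needs no derivative of `P` and `S`. -/
theorem frequently_exists_ratio (P S : ℝ → ℝ) (hP : ∀ ρ, 0 < ρ → ContinuousAt P ρ)
    (hS : ∀ ρ, 0 < ρ → ContinuousAt S ρ) :
    ∃ᶠ p : ℝ × ℝ in 𝓝[>] 0 ×ˢ 𝓝 1, p.2 ^ 3 - 1 + p.1 * (p.2 ^ 2 * S p.2 - p.2 ^ 3 * P p.2) = 0 := by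
  rw [frequently_iff]
  intro U hU
  obtain ⟨s, hs, t, ht, hst⟩ := mem_prod_iff.1 hU
  obtain ⟨δ, hδ, hδt⟩ := Metric.mem_nhds_iff.1 ht
  set d := min (δ / 2) (1 / 2) with hd
  have hd0 : 0 < d := by rw [hd]; positivity
  have hd1 : d ≤ 1 / 2 := min_le_right _ _
  have hdδ : d ≤ δ / 2 := min_le_left _ _
  set F : ℝ → ℝ → ℝ := fun ε ρ => ρ ^ 3 - 1 + ε * (ρ ^ 2 * S ρ - ρ ^ 3 * P ρ) with hF
  have hc : ∀ ρ, Tendsto (fun ε => F ε ρ) (𝓝[>] 0) (𝓝 (F 0 ρ)) := fun ρ => by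
    have : Continuous fun ε => F ε ρ := by rw [hF]; fun_prop
    exact (this.tendsto 0).mono_left nhdsWithin_le_nhds
  have hlo : ∀ᶠ ε in 𝓝[>] 0, F ε (1 - d) < 0 := (hc _).eventually_lt_const (by
    simp only [hF]; nlinarith [sq_nonneg (1 - d), sq_nonneg d])
  have hhi : ∀ᶠ ε in 𝓝[>] 0, 0 < F ε (1 + d) := (hc _).eventually_const_lt (by
    simp only [hF]; nlinarith [sq_nonneg (1 - d), sq_nonneg d])
  obtain ⟨ε, h1, h2, h3⟩ := (hlo.and (hhi.and hs)).exists
  have hcont : ContinuousOn (F ε) (Set.Icc (1 - d) (1 + d)) := fun ρ hρ => by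
    have h0 : 0 < ρ := by linarith [hρ.1]
    have := hP ρ h0
    have := hS ρ h0
    refine ContinuousAt.continuousWithinAt ?_
    rw [hF]
    fun_prop
  obtain ⟨ρ, hρ, h0⟩ := intermediate_value_Icc (by linarith) hcont ⟨h1.le, h2.le⟩
  refine ⟨(ε, ρ), hst ⟨h3, hδt ?_⟩, h0⟩
  rw [Metric.mem_ball, Real.dist_eq, abs_lt]
  constructor <;> linarith [hρ.1, hρ.2]

theorem tendsto_twoRingConfig {α : Type*} {l : Filter α} {R R' : α → ℝ} (j : ℕ)
    (h : Tendsto R l (𝓝 1)) (h' : Tendsto R' l (𝓝 1)) :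
    Tendsto (fun p => twoRingConfig j (R p) (R' p)) l
      (𝓝 (circleConfig (ngonAngles (2 * j)))) := by
  rw [tendsto_pi_nhds]
  refine Fin.cases ?_ fun k => ?_
  · simpa only [twoRingConfig, circleConfig, Fin.cons_zero] using tendsto_const_nhds
  · have hw : Tendsto (fun p => parityWeight (R p) (R' p) (k : ℕ)) l (𝓝 1) := by
      simp only [parityWeight]
      split_ifs <;> assumption
    have := ((Complex.continuous_ofReal.tendsto 1).comp hw).mul_const (ngonVertex (2 * j) (k : ℕ))
    rw [Complex.ofReal_one, one_mul] at this
    simp only [twoRingConfig, circleConfig, Fin.cons_succ]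
    rwa [← ringConfig_ngonAngles k] at this ⊢

/-- Alternating masses at the vertices of a regular polygon are in relative equilibrium. -/
theorem isRelEqOneN_alternatingMasses {j : ℕ} (hj : 2 ≤ j) (a b : ℝ) :
    IsRelEqOneN (alternatingMasses (2 * j) a b) (ngonAngles (2 * j)) := by
  refine isRelEqOneN_of_frequently ?_
  -- With radii `r` and `r ρ`, homogeneity of degree `-2` turns the first ring equation into `r³ = 1
  -- - ε P(ρ)`, which defines `r`. The second becomes an equation for `ρ` alone, the one solved in
  -- `frequently_exists_ratio`.
  set P : ℝ → ℝ := fun ρ => (ringPull j a b 1 ρ).re with hPdef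
  set S : ℝ → ℝ := fun ρ => (ringPull j b a ρ 1).re with hSdef
  have hP : ∀ ρ, 0 < ρ → ContinuousAt P ρ := fun ρ h =>
    Complex.continuous_re.continuousAt.comp (ContinuousAt.comp
      (f := fun ρ : ℝ => ((1 : ℝ), ρ)) (continuousAt_ringPull a b one_pos h) (by fun_prop))
  have hS : ∀ ρ, 0 < ρ → ContinuousAt S ρ := fun ρ h =>
    Complex.continuous_re.continuousAt.comp (ContinuousAt.comp
      (f := fun ρ : ℝ => (ρ, (1 : ℝ))) (continuousAt_ringPull b a h one_pos) (by fun_prop))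
  have hlim : Tendsto (fun p : ℝ × ℝ => 1 - p.1 * P p.2) (𝓝[>] 0 ×ˢ 𝓝 1) (𝓝 1) := by
    have h1 : Tendsto (fun p : ℝ × ℝ => p.1) (𝓝[>] 0 ×ˢ 𝓝 1) (𝓝 0) :=
      tendsto_nhds_of_tendsto_nhdsWithin tendsto_fst
    have h2 : Tendsto (fun p : ℝ × ℝ => P p.2) (𝓝[>] 0 ×ˢ 𝓝 1) (𝓝 (P 1)) :=
      (hP 1 one_pos).tendsto.comp tendsto_snd
    simpa using (tendsto_const_nhds (x := (1 : ℝ))).sub (h1.mul h2)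
  have hr : Tendsto (fun p : ℝ × ℝ => (1 - p.1 * P p.2) ^ (1 / 3 : ℝ)) (𝓝[>] 0 ×ˢ 𝓝 1) (𝓝 1) := by
    simpa using hlim.rpow_const (p := 1 / 3) (Or.inl one_ne_zero)
  have hconf : Tendsto (fun p : ℝ × ℝ => (p.1, twoRingConfig j ((1 - p.1 * P p.2) ^ (1 / 3 : ℝ))
      ((1 - p.1 * P p.2) ^ (1 / 3 : ℝ) * p.2))) (𝓝[>] 0 ×ˢ 𝓝 1)
      (𝓝[>] 0 ×ˢ 𝓝 (circleConfig (ngonAngles (2 * j)))) := by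
    refine tendsto_fst.prodMk ?_
    have h2 : Tendsto (fun p : ℝ × ℝ => p.2) (𝓝[>] (0 : ℝ) ×ˢ 𝓝 (1 : ℝ)) (𝓝 1) := tendsto_snd
    have h3 := hr.mul h2
    rw [mul_one] at h3
    exact tendsto_twoRingConfig j hr h3
  refine hconf.frequently ?_
  refine ((frequently_exists_ratio P S hP hS).and_eventually ((hlim.eventually_const_lt one_pos).and
    (tendsto_snd.eventually (lt_mem_nhds one_pos)))).mono ?_
  rintro ⟨ε, ρ⟩ ⟨h, hpos, hρ⟩
  simp only at h hpos hρ ⊢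
  set r := (1 - ε * P ρ) ^ (1 / 3 : ℝ) with hr
  have hr0 : 0 < r := Real.rpow_pos_of_pos hpos _
  have hr3 : r ^ 3 = 1 - ε * P ρ := by
    rw [hr, ← Real.rpow_natCast, ← Real.rpow_mul hpos.le]; norm_num
  have e1 := congrArg Complex.re (ringPull_smul j a b 1 ρ hr0)
  have e2 := congrArg Complex.re (ringPull_smul j b a ρ 1 hr0)
  rw [mul_one, Complex.smul_re, smul_eq_mul] at e1 e2
  have hrn := hr0.ne'
  refine isRelativeEquilibrium_twoRingConfig hj hr0 (mul_pos hr0 hρ) ?_ ?_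
  · rw [e1, hr3]
    field_simp
    simp only [hPdef]; ring
  · rw [e2]
    field_simp
    rw [hr3]
    linear_combination h

end HallRing

/-! ### The sine transform of the pair force: higher harmonics. -/

namespace HallRing

theorem sum_cos_eq_zero {n : ℕ} (hn : n ≠ 0) {q : ℤ} (hq : ¬ (n : ℤ) ∣ q) :
    ∑ d ∈ Finset.range n, Real.cos (2 * q * d * Real.pi / n) = 0 := by
  have hS : ∑ d ∈ Finset.range n, ngonVertex n (q * d) = 0 := by
    have := sum_range_add_int n (h := fun x => ngonVertex n (q * x)) (fun x => by
      have : ngonVertex n (q * n) = 1 := (ngonVertex_eq_one_iff hn _).2 (dvd_mul_left _ _)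
      rw [mul_add, ngonVertex_add, this, mul_one]) 1
    simp only [mul_add, ngonVertex_add, mul_one, ← Finset.sum_mul] at this
    by_contra hne
    exact hq ((ngonVertex_eq_one_iff hn q).1 (mul_left_cancel₀ hne (this.trans (mul_one _).symm)))
  have := congrArg Complex.re hS
  rw [Complex.re_sum, Complex.zero_re] at this
  rw [← this]
  refine Finset.sum_congr rfl fun d _ => ?_
  rw [ngonVertex, Complex.exp_ofReal_mul_I_re]
  congr 1; push_cast; ring

theorem sum_range_symm {j : ℕ} (hj : 0 < j) (u : ℕ → ℝ) (h0 : u 0 = 0)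
    (hs : ∀ d, 0 < d → d < j → u (2 * j - d) = u d) :
    ∑ d ∈ Finset.range (2 * j), u d = 2 * ∑ d ∈ Finset.Ico 1 j, u d + u j := by
  have h1 : ∑ d ∈ Finset.Ico (j + 1) (2 * j), u d = ∑ d ∈ Finset.Ico 1 j, u d := by
    have := Finset.sum_Ico_reflect u 1 (n := 2 * j) (m := j) (by omega)
    rw [show 2 * j + 1 - j = j + 1 by omega, Nat.add_sub_cancel] at this
    rw [← this]
    refine Finset.sum_congr rfl fun d hd => ?_
    rw [Finset.mem_Ico] at hd
    exact hs d hd.1 hd.2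
  rw [Finset.range_eq_Ico, ← Finset.sum_Ico_consecutive u (m := 0) (n := 1) (by omega) (by omega),
    ← Finset.sum_Ico_consecutive u (m := 1) (n := j) (by omega) (by omega),
    ← Finset.sum_Ico_consecutive u (m := j) (n := j + 1) (by omega) (by omega), h1]
  simp [h0]; ring

/-- Summation by parts for sine sums. -/
theorem two_mul_sum_mul_sin (a : ℕ → ℝ) (x : ℝ) (N : ℕ) :
    2 * (1 - Real.cos x) * ∑ k ∈ Finset.range N, a (k + 1) * Real.sin ((k + 1 : ℕ) * x) =
      ∑ k ∈ Finset.range N, (a k - 2 * a (k + 1) + a (k + 2)) *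
        ((k + 1 : ℕ) * Real.sin x - Real.sin ((k + 1 : ℕ) * x)) +
      a N * ((N + 1 : ℕ) * Real.sin x - Real.sin ((N + 1 : ℕ) * x)) -
      a (N + 1) * (N * Real.sin x - Real.sin (N * x)) := by
  -- The underlying fact is that `k sin x - sin (k x)` has second difference `2 (1 - cos x) sin (k
  -- x)` in `k`.
  induction N with
  | zero => simp
  | succ N ih =>
    rw [Finset.sum_range_succ, Finset.sum_range_succ, mul_add, ih]
    have e1 : ((N + 1 + 1 : ℕ) : ℝ) * x = (N + 1 : ℕ) * x + x := by push_cast; ring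
    have e2 : (N : ℝ) * x = (N + 1 : ℕ) * x - x := by push_cast; ring
    rw [e1, e2, Real.sin_add, Real.sin_sub]
    push_cast
    ring

theorem abs_sin_natCast_mul_le (k : ℕ) (x : ℝ) : |Real.sin (k * x)| ≤ k * |Real.sin x| := by
  induction k with
  | zero => simp
  | succ k ih =>
    have e : ((k + 1 : ℕ) : ℝ) * x = k * x + x := by push_cast; ring
    rw [e, Real.sin_add]
    have h1 := Real.abs_cos_le_one x
    have h2 := Real.abs_cos_le_one (k * x)
    calc |Real.sin (k * x) * Real.cos x + Real.cos (k * x) * Real.sin x|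
        ≤ |Real.sin (k * x)| * |Real.cos x| + |Real.cos (k * x)| * |Real.sin x| := by
          rw [← abs_mul, ← abs_mul]; exact abs_add_le _ _
      _ ≤ |Real.sin (k * x)| * 1 + 1 * |Real.sin x| := by gcongr
      _ ≤ _ := by push_cast; linarith

/-- Convexity of the sampled force gives the sine sums the sign of `sin x` after summation by parts.
-/
theorem convexOn_cos_div_sin_sq :
    ConvexOn ℝ (Set.Ioc 0 (Real.pi / 2)) fun y => Real.cos y / Real.sin y ^ 2 := by
  have hsin : ∀ y ∈ Set.Ioc 0 (Real.pi / 2), 0 < Real.sin y := fun y hy =>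
    Real.sin_pos_of_pos_of_lt_pi hy.1 (by linarith [hy.2, Real.pi_pos])
  have hd : ∀ y ∈ Set.Ioc 0 (Real.pi / 2), HasDerivAt (fun y => Real.cos y / Real.sin y ^ 2)
      (-((1 + Real.cos y ^ 2) / Real.sin y ^ 3)) y := by
    intro y hy
    have hs := (hsin y hy).ne'
    refine ((Real.hasDerivAt_cos y).div ((Real.hasDerivAt_sin y).pow 2)
      (pow_ne_zero 2 hs)).congr_deriv ?_
    have := Real.sin_sq_add_cos_sq y
    simp only [Pi.pow_apply]
    field_simp
    push_cast
    linear_combination (-Real.sin y) * this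
  refine MonotoneOn.convexOn_of_deriv (convex_Ioc _ _)
    (fun y hy => (hd y hy).continuousAt.continuousWithinAt) ?_ ?_
  · rw [interior_Ioc]
    exact fun y hy => (hd y (Set.Ioo_subset_Ioc_self hy)).differentiableAt.differentiableWithinAt
  · rw [interior_Ioc]
    intro y hy w hw hyw
    have hy' := Set.Ioo_subset_Ioc_self hy
    have hw' := Set.Ioo_subset_Ioc_self hw
    rw [(hd y hy').deriv, (hd w hw').deriv, neg_le_neg_iff]
    have h1 : Real.sin y ≤ Real.sin w := Real.sin_le_sin_of_le_of_le_pi_div_two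
      (by linarith [hy.1, Real.pi_pos]) hw'.2 hyw
    have h2 : Real.cos w ≤ Real.cos y := Real.cos_le_cos_of_nonneg_of_le_pi hy.1.le
      (by linarith [hw.2, Real.pi_pos]) hyw
    have h3 : 0 ≤ Real.cos w := Real.cos_nonneg_of_neg_pi_div_two_le_of_le
      (by linarith [hw.1, Real.pi_pos]) hw'.2
    have h4 := hsin y hy'
    gcongr

theorem pairForce_two_mul {y : ℝ} (hy : 0 < Real.sin y) :
    pairForce (2 * y) = Real.sin (2 * y) - Real.cos y / Real.sin y ^ 2 / 4 := by
  rw [pairForce, mul_div_cancel_left₀ y two_ne_zero, abs_of_pos hy, Real.sin_two_mul]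
  have := hy.ne'
  field_simp
  ring

/-- The sine transform of the pair force, reduced to a sum over an open quarter period. -/
theorem sum_pairForce_mul_sin {j : ℕ} (hj : 0 < j) (m : ℕ) :
    ∑ d ∈ Finset.range (2 * j), pairForce (2 * d * Real.pi / (2 * j : ℕ)) *
        Real.sin (2 * m * d * Real.pi / (2 * j : ℕ)) =
      ∑ d ∈ Finset.range (2 * j), Real.sin (2 * d * Real.pi / (2 * j : ℕ)) *
        Real.sin (2 * m * d * Real.pi / (2 * j : ℕ)) -
      1 / 2 * ∑ d ∈ Finset.Ico 1 j, Real.cos (d * Real.pi / (2 * j : ℕ)) /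
        Real.sin (d * Real.pi / (2 * j : ℕ)) ^ 2 * Real.sin (d * (m * Real.pi / j)) := by
  have hj' : (j : ℝ) ≠ 0 := by positivity
  have h1 : ∀ d : ℕ, 2 * (m : ℝ) * d * Real.pi / (2 * j : ℕ) = d * (m * Real.pi / j) := fun d => by
    push_cast; field_simp
  have h2 : ∀ d : ℕ, 2 * (d : ℝ) * Real.pi / (2 * j : ℕ) = 2 * (d * Real.pi / (2 * j : ℕ)) :=
    fun d => by ring
  have key := sum_range_symm hj (fun d => Real.cos (d * Real.pi / (2 * j : ℕ)) /
        Real.sin (d * Real.pi / (2 * j : ℕ)) ^ 2 * Real.sin (d * (m * Real.pi / j))) (by simp) (by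
    intro d h0 hd
    have e1 : ((2 * j - d : ℕ) : ℝ) * Real.pi / (2 * j : ℕ) = Real.pi - d * Real.pi / (2 * j : ℕ) := by
      rw [Nat.cast_sub (by omega)]; push_cast; field_simp
    have e2 : ((2 * j - d : ℕ) : ℝ) * (m * Real.pi / j) = m * (2 * Real.pi) - d * (m * Real.pi / j) := by
      rw [Nat.cast_sub (by omega)]; push_cast; field_simp
    simp only [e1, e2, Real.cos_pi_sub, Real.sin_pi_sub, Real.sin_nat_mul_two_pi_sub]
    ring)
  have e3 : (j : ℝ) * Real.pi / (2 * j : ℕ) = Real.pi / 2 := by push_cast; field_simp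
  rw [e3, Real.cos_pi_div_two, zero_div, zero_mul, add_zero] at key
  rw [show (1 / 2 : ℝ) * ∑ d ∈ Finset.Ico 1 j, Real.cos (d * Real.pi / (2 * j : ℕ)) /
        Real.sin (d * Real.pi / (2 * j : ℕ)) ^ 2 * Real.sin (d * (m * Real.pi / j)) =
      1 / 4 * (2 * ∑ d ∈ Finset.Ico 1 j, Real.cos (d * Real.pi / (2 * j : ℕ)) /
        Real.sin (d * Real.pi / (2 * j : ℕ)) ^ 2 * Real.sin (d * (m * Real.pi / j))) by ring,
    ← key, Finset.mul_sum, ← Finset.sum_sub_distrib]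
  refine Finset.sum_congr rfl fun d hd => ?_
  rw [Finset.mem_range] at hd
  rcases Nat.eq_zero_or_pos d with rfl | h0
  · simp
  · have : 0 < Real.sin (d * Real.pi / (2 * j : ℕ)) := by
      refine Real.sin_pos_of_pos_of_lt_pi (by positivity) ?_
      rw [div_lt_iff₀ (by positivity), mul_comm]
      exact mul_lt_mul_of_pos_left (by exact_mod_cast hd) Real.pi_pos
    rw [h1, h2, pairForce_two_mul this]
    ring

theorem sum_sin_mul_sin {n : ℕ} (m : ℕ) :
    ∑ d ∈ Finset.range n, Real.sin (2 * d * Real.pi / n) * Real.sin (2 * m * d * Real.pi / n) =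
      1 / 2 * (∑ d ∈ Finset.range n, Real.cos (2 * ((m - 1 : ℤ) : ℝ) * d * Real.pi / n) -
        ∑ d ∈ Finset.range n, Real.cos (2 * ((m + 1 : ℤ) : ℝ) * d * Real.pi / n)) := by
  rw [← Finset.sum_sub_distrib, Finset.mul_sum]
  refine Finset.sum_congr rfl fun d _ => ?_
  have e1 : 2 * ((m - 1 : ℤ) : ℝ) * d * Real.pi / n = 2 * m * d * Real.pi / n - 2 * d * Real.pi / n := by
    push_cast; ring
  have e2 : 2 * ((m + 1 : ℤ) : ℝ) * d * Real.pi / n = 2 * m * d * Real.pi / n + 2 * d * Real.pi / n := by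
    push_cast; ring
  rw [e1, e2, Real.cos_sub, Real.cos_add]
  ring

/-- For these `m` the `sin` part of the force is orthogonal to the harmonic, and only the Newtonian
part remains. That one is a sine sum with convex coefficients, so two summations by parts write it,
times `sin x`, as nonnegative terms plus a positive boundary term. -/
theorem sum_pairForce_mul_sin_ne_zero_of_two_le {j m : ℕ} (hm : 2 ≤ m) (hm' : m + 2 ≤ 2 * j)
    (hmj : m ≠ j) : ∑ d ∈ Finset.range (2 * j), pairForce (2 * d * Real.pi / (2 * j : ℕ)) *
        Real.sin (2 * m * d * Real.pi / (2 * j : ℕ)) ≠ 0 := by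
  have hj : 2 ≤ j := by omega
  have hj0 : (0 : ℝ) < j := by positivity
  rw [sum_pairForce_mul_sin (by omega), sum_sin_mul_sin, sum_cos_eq_zero (by omega),
    sum_cos_eq_zero (by omega)]
  rotate_left
  · intro h
    have := Int.le_of_dvd (by omega) h
    push_cast at this; omega
  · intro h
    have := Int.le_of_dvd (by omega) h
    push_cast at this; omega
  rw [sub_zero, mul_zero, zero_sub, neg_ne_zero]
  refine mul_ne_zero (by norm_num) ?_
  set a : ℕ → ℝ := fun d => Real.cos (d * Real.pi / (2 * j : ℕ)) /
        Real.sin (d * Real.pi / (2 * j : ℕ)) ^ 2 with ha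
  set x := m * Real.pi / j with hx
  -- Here `0 < m < 2j` and `m ≠ j` are used: otherwise `x` would be a multiple of `π`.
  have hsx : Real.sin x ≠ 0 := by
    rw [Real.sin_ne_zero_iff]
    intro q hq
    rw [hx, mul_comm, mul_div_assoc, mul_comm] at hq
    have : (m : ℝ) = q * j := by
      have := mul_right_cancel₀ Real.pi_ne_zero (hq.trans (mul_comm _ _).symm |>.trans (by ring : _ = (m / j : ℝ) * Real.pi))
      field_simp at this
      linarith
    have h1 : (m : ℤ) = q * j := by exact_mod_cast this
    have h2 : q < 2 := by
      by_contra! hc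
      nlinarith
    have h3 : 0 < q := by
      by_contra! hc
      nlinarith
    have : q = 1 := by omega
    subst this
    omega
  intro h0
  have key := two_mul_sum_mul_sin a x (j - 1)
  have hI : ∑ k ∈ Finset.range (j - 1), a (k + 1) * Real.sin ((k + 1 : ℕ) * x) = 0 := by
    rw [← h0, Finset.sum_Ico_eq_sum_range]
    exact Finset.sum_congr rfl fun k _ => by rw [add_comm 1 k]
  rw [hI, mul_zero, Nat.sub_add_cancel (by omega)] at key
  have haj : a j = 0 := by
    have : (j : ℝ) * Real.pi / (2 * j : ℕ) = Real.pi / 2 := by push_cast; field_simp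
    simp only [ha, this, Real.cos_pi_div_two, zero_div]
  have hsj : Real.sin (j * x) = 0 := by
    have : j * x = m * Real.pi := by rw [hx]; field_simp
    rw [this, Real.sin_nat_mul_pi]
  rw [haj, hsj, zero_mul, sub_zero, sub_zero] at key
  have hpos : 0 < a (j - 1) := by
    have h1 : 0 < ((j - 1 : ℕ) : ℝ) * Real.pi / (2 * j : ℕ) := by
      have : 0 < j - 1 := by omega
      positivity
    have h2 : ((j - 1 : ℕ) : ℝ) * Real.pi / (2 * j : ℕ) < Real.pi / 2 := by
      rw [Nat.cast_sub (by omega)]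
      push_cast
      rw [div_lt_div_iff₀ (by positivity) (by norm_num)]
      nlinarith [Real.pi_pos]
    refine div_pos (Real.cos_pos_of_mem_Ioo ⟨by linarith [Real.pi_pos], h2⟩) (pow_pos ?_ 2)
    exact Real.sin_pos_of_pos_of_lt_pi h1 (by linarith [Real.pi_pos])
  have hterm : ∀ k ∈ Finset.range (j - 1), 0 ≤ Real.sin x * ((a k - 2 * a (k + 1) + a (k + 2)) *
        ((k + 1 : ℕ) * Real.sin x - Real.sin ((k + 1 : ℕ) * x))) := by
    intro k hk
    rw [Finset.mem_range] at hk
    -- At `k = 0` the sine factor vanishes, so the meaningless value `a 0` plays no part.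
    rcases Nat.eq_zero_or_pos k with rfl | hk0
    · simp
    have h1 : 0 ≤ Real.sin x * ((k + 1 : ℕ) * Real.sin x - Real.sin ((k + 1 : ℕ) * x)) := by
      have h2 := abs_sin_natCast_mul_le (k + 1) x
      have h3 : Real.sin x * Real.sin ((k + 1 : ℕ) * x) ≤ |Real.sin x| * |Real.sin ((k + 1 : ℕ) * x)| := by
        rw [← abs_mul]; exact le_abs_self _
      have h4 := mul_le_mul_of_nonneg_left h2 (abs_nonneg (Real.sin x))
      have h5 : |Real.sin x| * |Real.sin x| = Real.sin x * Real.sin x := abs_mul_abs_self _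
      nlinarith
    have h2 : 0 ≤ a k - 2 * a (k + 1) + a (k + 2) := by
      have hmem : ∀ i : ℕ, 0 < i → i ≤ j →
          (i : ℝ) * Real.pi / (2 * j : ℕ) ∈ Set.Ioc 0 (Real.pi / 2) := by
        intro i hi hij
        refine ⟨by positivity, ?_⟩
        have : (i : ℝ) ≤ j := by exact_mod_cast hij
        push_cast
        rw [div_le_div_iff₀ (by positivity) (by norm_num)]
        nlinarith [Real.pi_pos]
      have := convexOn_cos_div_sin_sq.2 (hmem k hk0 (by omega)) (hmem (k + 2) (by omega) (by omega))
        (by norm_num : (0 : ℝ) ≤ 1 / 2) (by norm_num : (0 : ℝ) ≤ 1 / 2) (by norm_num)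
      have e : (1 / 2 : ℝ) • ((k : ℝ) * Real.pi / (2 * j : ℕ)) +
          (1 / 2 : ℝ) • (((k + 2 : ℕ) : ℝ) * Real.pi / (2 * j : ℕ)) =
          ((k + 1 : ℕ) : ℝ) * Real.pi / (2 * j : ℕ) := by
        simp only [smul_eq_mul]; push_cast; ring
      rw [e] at this
      simp only [smul_eq_mul] at this
      simp only [ha]
      linarith
    nlinarith
  have hsum := Finset.sum_nonneg hterm
  rw [← Finset.mul_sum] at hsum
  have hlast : 0 < a (j - 1) * j * (Real.sin x) ^ 2 := by positivity
  have := congrArg (Real.sin x * ·) key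
  simp only [mul_zero, mul_add] at this
  nlinarith

end HallRing

/-! ### The sine transform of the pair force: the first harmonic. -/

namespace HallRing

theorem one_div_sub_self_le {y : ℝ} (h0 : 0 < y) (h : y < Real.pi) :
    1 / y - y ≤ Real.cos y ^ 2 / Real.sin y := by
  have hs := Real.sin_pos_of_pos_of_lt_pi h0 h
  have h1 := (Real.sin_lt h0).le
  have e : Real.cos y ^ 2 / Real.sin y = 1 / Real.sin y - Real.sin y := by
    rw [Real.cos_sq']; field_simp
  rw [e]
  have := one_div_le_one_div_of_le hs h1
  linarith

theorem cos_sq_div_sin_le {y y₀ : ℝ} (h0 : 0 < y₀) (h1 : y₀ ≤ y) (h2 : y ≤ Real.pi / 2)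
    (h3 : 0 < y₀ - y₀ ^ 3 / 6) :
    Real.cos y ^ 2 / Real.sin y ≤ 1 / (y₀ - y₀ ^ 3 / 6) - (y₀ - y₀ ^ 3 / 6) := by
  have hle : y₀ - y₀ ^ 3 / 6 ≤ Real.sin y := (Real.sin_gt_sub_cube h0).le.trans
    (Real.sin_le_sin_of_le_of_le_pi_div_two (by linarith [Real.pi_pos]) h2 h1)
  have hs := h3.trans_le hle
  have e : Real.cos y ^ 2 / Real.sin y = 1 / Real.sin y - Real.sin y := by
    rw [Real.cos_sq']; field_simp
  rw [e]
  have := one_div_le_one_div_of_le h3 hle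
  linarith

/-- The sum lies below `j` for `j ≤ 5` and above `j` from `j = 6` on. The upper bounds use `sin y ≥
y₀ - y₀³/6` with `3.1415` in place of `π`; the lower bounds need only the first four terms. -/
theorem sum_cos_sq_div_sin_ne {j : ℕ} (hj : 2 ≤ j) :
    ∑ d ∈ Finset.Ico 1 j, Real.cos (d * Real.pi / (2 * j : ℕ)) ^ 2 /
      Real.sin (d * Real.pi / (2 * j : ℕ)) ≠ j := by
  have hpi := Real.pi_gt_d6
  have hpi' := Real.pi_lt_d6
  rcases Nat.lt_or_ge j 6 with hj6 | hj6
  · refine ne_of_lt ?_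
    have key : ∀ d : ℕ, 0 < d → d < j → 0 < (d * 3.1415 / (2 * j : ℕ) - (d * 3.1415 / (2 * j : ℕ)) ^ 3 / 6 : ℝ) →
        Real.cos (d * Real.pi / (2 * j : ℕ)) ^ 2 / Real.sin (d * Real.pi / (2 * j : ℕ)) ≤
        1 / (d * 3.1415 / (2 * j : ℕ) - (d * 3.1415 / (2 * j : ℕ)) ^ 3 / 6) -
          (d * 3.1415 / (2 * j : ℕ) - (d * 3.1415 / (2 * j : ℕ)) ^ 3 / 6 : ℝ) := by
      intro d h0 hd h
      refine cos_sq_div_sin_le (by positivity) ?_ ?_ h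
      · gcongr; linarith
      · have : (d : ℝ) ≤ j := by exact_mod_cast hd.le
        push_cast
        rw [div_le_div_iff₀ (by positivity) (by norm_num)]
        nlinarith [Real.pi_pos]
    have h5 : j = 2 ∨ j = 3 ∨ j = 4 ∨ j = 5 := by omega
    rcases h5 with rfl | rfl | rfl | rfl
    · have h1 := key 1 (by norm_num) (by norm_num) (by norm_num)
      norm_num [Finset.sum_Ico_succ_top] at h1 ⊢
      linarith
    · have h1 := key 1 (by norm_num) (by norm_num) (by norm_num)
      have h2 := key 2 (by norm_num) (by norm_num) (by norm_num)
      norm_num [Finset.sum_Ico_succ_top] at h1 h2 ⊢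
      linarith
    · have h1 := key 1 (by norm_num) (by norm_num) (by norm_num)
      have h2 := key 2 (by norm_num) (by norm_num) (by norm_num)
      have h3 := key 3 (by norm_num) (by norm_num) (by norm_num)
      norm_num [Finset.sum_Ico_succ_top] at h1 h2 h3 ⊢
      linarith
    · have h1 := key 1 (by norm_num) (by norm_num) (by norm_num)
      have h2 := key 2 (by norm_num) (by norm_num) (by norm_num)
      have h3 := key 3 (by norm_num) (by norm_num) (by norm_num)
      have h4 := key 4 (by norm_num) (by norm_num) (by norm_num)
      norm_num [Finset.sum_Ico_succ_top] at h1 h2 h3 h4 ⊢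
      linarith
  · refine ne_of_gt ?_
    have hj0 : (0 : ℝ) < j := by positivity
    have hlt : ∀ d : ℕ, d < j → (d : ℝ) * Real.pi / (2 * j : ℕ) < Real.pi := by
      intro d hd
      rw [div_lt_iff₀ (by positivity), mul_comm]
      have : (d : ℝ) < (2 * j : ℕ) := by exact_mod_cast (by omega)
      exact mul_lt_mul_of_pos_left this Real.pi_pos
    have hnn : ∀ d ∈ Finset.Ico 1 j, 0 ≤ Real.cos (d * Real.pi / (2 * j : ℕ)) ^ 2 /
        Real.sin (d * Real.pi / (2 * j : ℕ)) := fun d hd =>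
      div_nonneg (sq_nonneg _) (Real.sin_nonneg_of_nonneg_of_le_pi (by positivity)
        (hlt d (Finset.mem_Ico.1 hd).2).le)
    have hsub := Finset.sum_le_sum_of_subset_of_nonneg (s := Finset.Ico 1 5) (t := Finset.Ico 1 j)
      (f := fun d : ℕ => Real.cos (d * Real.pi / (2 * j : ℕ)) ^ 2 /
        Real.sin (d * Real.pi / (2 * j : ℕ))) (Finset.Ico_subset_Ico_right (by omega))
      fun d hd _ => hnn d hd
    refine lt_of_lt_of_le ?_ hsub
    -- For `j = 6` the margin is small: the bounds used add up to `6.005`. Hence the special angles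
    -- are evaluated separately.
    rcases hj6.eq_or_lt with rfl | hj7
    · have h1 := one_div_sub_self_le (y := Real.pi / 12) (by positivity) (by linarith)
      have e2 : (2 : ℝ) * Real.pi / 12 = Real.pi / 6 := by ring
      have e3 : (3 : ℝ) * Real.pi / 12 = Real.pi / 4 := by ring
      have e4 : (4 : ℝ) * Real.pi / 12 = Real.pi / 3 := by ring
      have h3 : (7 : ℝ) / 10 ≤ Real.cos (Real.pi / 4) ^ 2 / Real.sin (Real.pi / 4) := by
        rw [Real.cos_pi_div_four, Real.sin_pi_div_four, sq, mul_div_assoc, div_self (by positivity)]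
        have : (1.4 : ℝ) ≤ √2 := Real.le_sqrt_of_sq_le (by norm_num)
        linarith
      have h4 : (1 : ℝ) / 4 ≤ Real.cos (Real.pi / 3) ^ 2 / Real.sin (Real.pi / 3) := by
        rw [Real.cos_pi_div_three, le_div_iff₀ (Real.sin_pos_of_pos_of_lt_pi (by positivity) (by linarith))]
        linarith [Real.sin_le_one (Real.pi / 3)]
      have h2 : Real.cos (Real.pi / 6) ^ 2 / Real.sin (Real.pi / 6) = 3 / 2 := by
        rw [Real.cos_pi_div_six, Real.sin_pi_div_six, div_pow, Real.sq_sqrt (by norm_num)]; norm_num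
      have h5 : (3.555 : ℝ) ≤ 1 / (Real.pi / 12) - Real.pi / 12 := by
        have : (3.8194 : ℝ) ≤ 1 / (Real.pi / 12) := by
          rw [le_div_iff₀ (by positivity)]; linarith
        linarith
      norm_num [Finset.sum_Ico_succ_top, e2, e3, e4] at h1 h2 h3 h4 h5 ⊢
      rw [h2]
      linarith
    · have hb : ∀ d : ℕ, 0 < d → d < j → 2 * j / Real.pi * (1 / d) - Real.pi / (2 * j) * d ≤
          Real.cos (d * Real.pi / (2 * j : ℕ)) ^ 2 / Real.sin (d * Real.pi / (2 * j : ℕ)) := by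
        intro d h0 hd
        refine le_trans (le_of_eq ?_) (one_div_sub_self_le (by positivity) (hlt d hd))
        push_cast
        field_simp
      have h1 := hb 1 (by norm_num) (by omega)
      have h2 := hb 2 (by norm_num) (by omega)
      have h3 := hb 3 (by norm_num) (by omega)
      have h4 := hb 4 (by norm_num) (by omega)
      have h7 : (7 : ℝ) ≤ j := by exact_mod_cast hj7
      -- Here `25/12 = 1 + 1/2 + 1/3 + 1/4` and `10 = 1 + 2 + 3 + 4`.
      have h5 : (j : ℝ) < 2 * j / Real.pi * (25 / 12) - Real.pi / (2 * j) * 10 := by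
        rw [div_mul_eq_mul_div, div_mul_eq_mul_div, div_sub_div _ _ Real.pi_ne_zero (by positivity),
          lt_div_iff₀ (by positivity)]
        have h8 : (49 : ℝ) ≤ j ^ 2 := by nlinarith
        have h9 : Real.pi ^ 2 < 9.8697 := by nlinarith
        nlinarith
      rw [Finset.sum_Ico_succ_top (by norm_num), Finset.sum_Ico_succ_top (by norm_num),
        Finset.sum_Ico_succ_top (by norm_num), Finset.sum_Ico_succ_top (by norm_num)]
      push_cast at h1 h2 h3 h4 ⊢
      simp only [Finset.Ico_self, Finset.sum_empty]
      linarith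

theorem sum_pairForce_mul_sin_one {j : ℕ} (hj : 2 ≤ j) :
    ∑ d ∈ Finset.range (2 * j), pairForce (2 * d * Real.pi / (2 * j : ℕ)) *
        Real.sin (2 * (1 : ℕ) * d * Real.pi / (2 * j : ℕ)) =
      j - ∑ d ∈ Finset.Ico 1 j, Real.cos (d * Real.pi / (2 * j : ℕ)) ^ 2 /
        Real.sin (d * Real.pi / (2 * j : ℕ)) := by
  rw [sum_pairForce_mul_sin (by omega), sum_sin_mul_sin, sum_cos_eq_zero (q := ((1 : ℕ) + 1 : ℤ))
    (by omega)]
  · congr 1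
    · simp
    · rw [Finset.mul_sum]
      refine Finset.sum_congr rfl fun d hd => ?_
      rw [Finset.mem_Ico] at hd
      have hj0 : (0 : ℝ) < j := by positivity
      have e : (d : ℝ) * ((1 : ℕ) * Real.pi / j) = 2 * (d * Real.pi / (2 * j : ℕ)) := by
        push_cast; field_simp
      have : 0 < Real.sin (d * Real.pi / (2 * j : ℕ)) := by
        have hd0 : (0 : ℝ) < d := by exact_mod_cast hd.1
        refine Real.sin_pos_of_pos_of_lt_pi (by positivity) ?_
        rw [div_lt_iff₀ (by positivity), mul_comm]
        exact mul_lt_mul_of_pos_left (by exact_mod_cast (by omega)) Real.pi_pos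
      rw [e, Real.sin_two_mul]
      field_simp
  · intro h
    have := Int.le_of_dvd (by omega) h
    push_cast at this; omega

theorem sum_pairForce_mul_sin_ne_zero {j m : ℕ} (hj : 2 ≤ j) (hm : 0 < m) (hm' : m < 2 * j)
    (hmj : m ≠ j) : ∑ d ∈ Finset.range (2 * j), pairForce (2 * d * Real.pi / (2 * j : ℕ)) *
        Real.sin (2 * m * d * Real.pi / (2 * j : ℕ)) ≠ 0 := by
  have h1 := sum_pairForce_mul_sin_one hj
  have h2 := sum_cos_sq_div_sin_ne hj
  rcases Nat.lt_or_ge 1 m with hm1 | hm1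
  · rcases Nat.lt_or_ge (2 * j) (m + 2) with hm2 | hm2
    -- The frequency `2j - 1` is the mirror image of `1`.
    · have hm3 : m = 2 * j - 1 := by omega
      have hneg : ∑ d ∈ Finset.range (2 * j), pairForce (2 * d * Real.pi / (2 * j : ℕ)) *
          Real.sin (2 * m * d * Real.pi / (2 * j : ℕ)) =
          -∑ d ∈ Finset.range (2 * j), pairForce (2 * d * Real.pi / (2 * j : ℕ)) *
            Real.sin (2 * (1 : ℕ) * d * Real.pi / (2 * j : ℕ)) := by
        rw [← Finset.sum_neg_distrib]
        refine Finset.sum_congr rfl fun d _ => ?_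
        have hj0 : (j : ℝ) ≠ 0 := by positivity
        have e : 2 * (m : ℝ) * d * Real.pi / (2 * j : ℕ) =
            d * (2 * Real.pi) - 2 * (1 : ℕ) * d * Real.pi / (2 * j : ℕ) := by
          rw [hm3, Nat.cast_sub (by omega)]; push_cast; field_simp
        rw [e, Real.sin_nat_mul_two_pi_sub, mul_neg]
      rw [hneg, h1, neg_ne_zero, sub_ne_zero]
      exact h2.symm
    · exact sum_pairForce_mul_sin_ne_zero_of_two_le hm1 hm2 hmj
  · obtain rfl : m = 1 := by omega
    rw [h1, sub_ne_zero]
    exact h2.symm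

end HallRing

/-! ### The masses of a polygonal equilibrium alternate. -/

namespace HallRing

theorem pairForce_add_two_pi (φ : ℝ) : pairForce (φ + 2 * Real.pi) = pairForce φ := by
  rw [pairForce, pairForce, Real.sin_add_two_pi, show (φ + 2 * Real.pi) / 2 = φ / 2 + Real.pi by ring,
    Real.sin_add_pi, abs_neg]

theorem sum_zmod_val {n : ℕ} [NeZero n] {E : Type*} [AddCommMonoid E] (f : ℕ → E) :
    ∑ x : ZMod n, f x.val = ∑ i ∈ Finset.range n, f i := by
  rw [Finset.sum_range]
  refine Fintype.sum_bijective (fun x : ZMod n => (⟨x.val, ZMod.val_lt x⟩ : Fin n)) ?_ _ _ fun x => rfl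
  rw [Fintype.bijective_iff_injective_and_card]
  refine ⟨fun x y h => ZMod.val_injective n (Fin.mk.inj h), ?_⟩
  rw [ZMod.card, Fintype.card_fin]

open ZMod in
-- The transform of `M (x + q) - M x` is `χ_m(q) - 1` times that of `M`. Where the first factor is
-- nonzero, so is the transform of `Φ`, and then the transform of `M` vanishes.
theorem eq_add_of_convolution_eq_zero {n : ℕ} [NeZero n] (M Φ : ZMod n → ℂ) (q : ZMod n)
    (h : ∀ y, ∑ x, M x * Φ (x - y) = 0)
    (hΦ : ∀ m : ZMod n, stdAddChar (q * m) ≠ (1 : ℂ) → ∑ d, stdAddChar (d * m) * Φ d ≠ 0)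
    (x : ZMod n) : M (x + q) = M x := by
  have hM : ∀ m : ZMod n, (∑ x, stdAddChar (-(x * m)) * M x) *
      ∑ d, stdAddChar (d * m) * Φ d = 0 := by
    intro m
    have h1 : ∑ y, stdAddChar (-(y * m)) * ∑ x, M x * Φ (x - y) = (0 : ℂ) :=
      Finset.sum_eq_zero fun y _ => by rw [h, mul_zero]
    rw [← h1, Finset.sum_mul]
    simp only [Finset.mul_sum]
    conv_rhs => rw [Finset.sum_comm]
    refine Finset.sum_congr rfl fun x _ => ?_
    refine Fintype.sum_equiv (Equiv.subLeft x) _ _ fun d => ?_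
    have : stdAddChar (-((Equiv.subLeft x) d * m)) =
        (stdAddChar (-(x * m)) * stdAddChar (d * m) : ℂ) := by
      rw [← AddChar.map_add_eq_mul]
      congr 1
      simp only [Equiv.subLeft_apply]; ring
    rw [this]
    simp only [Equiv.subLeft_apply, sub_sub_cancel]
    ring
  have h0 : ZMod.dft (fun x => M (x + q) - M x) = 0 := by
    funext m
    rw [ZMod.dft_apply]
    simp only [smul_eq_mul, mul_sub, Finset.sum_sub_distrib, Pi.zero_apply]
    have h1 : ∑ x, stdAddChar (-(x * m)) * M (x + q) =
        stdAddChar (q * m) * ∑ x, (stdAddChar (-(x * m)) : ℂ) * M x := by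
      rw [Finset.mul_sum]
      refine Fintype.sum_equiv (Equiv.addRight q) _ _ fun x => ?_
      rw [← mul_assoc, ← AddChar.map_add_eq_mul]
      simp only [Equiv.coe_addRight]
      congr 2; ring
    rw [h1]
    by_cases hq : stdAddChar (q * m) = (1 : ℂ)
    · rw [hq, one_mul, sub_self]
    · rw [(mul_eq_zero.1 (hM m)).resolve_right (hΦ m hq), mul_zero, sub_zero]
  have := (LinearEquiv.map_eq_zero_iff _).1 h0
  exact sub_eq_zero.1 (congrFun this x)

/-- The infinitesimal masses of a relative equilibrium in the shape of a regular polygon with an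
even number of vertices alternate. -/
theorem exists_eq_alternatingMasses {j : ℕ} (hj : 2 ≤ j) {μ : Fin (2 * j) → ℝ}
    (hre : IsRelEqOneN μ (ngonAngles (2 * j))) :
    ∃ a b : ℝ, μ = alternatingMasses (2 * j) a b := by
  have hn : 0 < 2 * j := by omega
  have : NeZero (2 * j) := ⟨hn.ne'⟩
  have hj0 : (0 : ℝ) < j := by positivity
  set F : ℤ → ℝ := fun x => pairForce (2 * x * Real.pi / (2 * j : ℕ)) with hF
  have hFper : ∀ x, F (x + (2 * j : ℕ)) = F x := fun x => by
    rw [hF]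
    simp only
    rw [← pairForce_add_two_pi (2 * x * Real.pi / (2 * j : ℕ))]
    congr 1
    push_cast; field_simp
  have hFper' : ∀ x q : ℤ, F (x + (2 * j : ℕ) * q) = F x := by
    intro x q
    induction q using Int.induction_on with
    | zero => simp
    | succ i ih => rw [mul_add, ← add_assoc, mul_one, hFper, ih]
    | pred i ih => rw [← hFper, ← ih]; congr 1; ring
  set Φ : ZMod (2 * j) → ℂ := fun x => (F x.val : ℂ) with hΦ
  have hΦF : ∀ x : ℤ, Φ x = F x := fun x => by
    rw [hΦ]
    simp only
    rw [ZMod.val_intCast, ← hFper' _ (x / (2 * j : ℕ)), Int.emod_add_mul_ediv]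
  set M : ZMod (2 * j) → ℂ := fun x => (μ ⟨x.val, ZMod.val_lt x⟩ : ℂ) with hM
  -- The frequencies with trivial character at `q = 2` are `0` and `j`, exactly those left out in
  -- `sum_pairForce_mul_sin_ne_zero`.
  have key : ∀ x, M (x + 2) = M x := by
    refine eq_add_of_convolution_eq_zero M Φ 2 (fun y => ?_) fun m hm h0 => ?_
    · have h1 := sum_pairForce_eq_zero separated_ngonAngles hre ⟨y.val, ZMod.val_lt y⟩
      have h2 : ∑ x : ZMod (2 * j), M x * Φ (x - y) = ((∑ l : Fin (2 * j), μ l *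
          pairForce (ngonAngles (2 * j) l - ngonAngles (2 * j) ⟨y.val, ZMod.val_lt y⟩) : ℝ) : ℂ) := by
        push_cast
        refine Fintype.sum_bijective (fun x : ZMod (2 * j) => (⟨x.val, ZMod.val_lt x⟩ : Fin (2 * j)))
          ?_ _ _ fun x => ?_
        · rw [Fintype.bijective_iff_injective_and_card]
          refine ⟨fun x y h => ZMod.val_injective _ (Fin.mk.inj h), ?_⟩
          rw [ZMod.card, Fintype.card_fin]
        · rw [ngonAngles_sub, hM]
          congr 1
          have : x - y = (((x.val : ℤ) - (y.val : ℤ) : ℤ) : ZMod (2 * j)) := by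
            push_cast
            rw [ZMod.natCast_zmod_val, ZMod.natCast_zmod_val]
          rw [this, hΦF]
      rw [h2, h1, Complex.ofReal_zero]
    · have hm0 : ∀ q : ZMod (2 * j), q = ((q.val : ℤ) : ZMod (2 * j)) := fun q => by
        rw [Int.cast_natCast, ZMod.natCast_zmod_val]
      have hchar : ∀ x : ℤ, (ZMod.stdAddChar ((x : ZMod (2 * j)) * m) : ℂ) = ngonVertex (2 * j) (x * m.val) := by
        intro x
        rw [hm0 m, ← Int.cast_mul, ZMod.stdAddChar_coe, ngonVertex, ← hm0]
        congr 1
        push_cast; ring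
      have h2 := hchar 2
      push_cast at h2
      rw [h2, Ne, ngonVertex_eq_one_iff hn.ne'] at hm
      -- `Φ` is real, so the imaginary part of its transform is the sine sum.
      have h3 := congrArg Complex.im h0
      rw [Complex.im_sum, Complex.zero_im] at h3
      refine sum_pairForce_mul_sin_ne_zero hj (m := m.val) ?_ (ZMod.val_lt m) ?_ ?_
      · by_contra! hc
        exact hm (by rw [Nat.le_zero.1 hc]; simp)
      · intro hc
        exact hm ⟨1, by rw [hc]; push_cast; ring⟩
      · rw [← h3, ← sum_zmod_val (n := 2 * j)]
        refine Finset.sum_congr rfl fun d _ => ?_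
        have h4 := hchar d.val
        rw [← hm0] at h4
        rw [h4, ngonVertex, hΦ]
        simp only
        rw [Complex.im_mul_ofReal, Complex.exp_ofReal_mul_I_im, mul_comm, hF]
        simp only [Int.cast_natCast]
        congr 2
        push_cast; ring
  have hval : ∀ k : ℕ, ∀ hk : k < 2 * j, M (k : ZMod (2 * j)) = (μ ⟨k, hk⟩ : ℂ) := fun k hk => by
    rw [hM]
    simp only [ZMod.val_natCast_of_lt hk]
  have hpar : ∀ k : ℕ, M (k : ZMod (2 * j)) = if Even k then M (0 : ℕ) else M (1 : ℕ) := by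
    intro k
    induction k using Nat.twoStepInduction with
    | zero => simp
    | one => simp
    | more k ih _ =>
      have := key (k : ZMod (2 * j))
      rw [ih] at this
      push_cast at this ⊢
      rw [this]
      simp [Nat.even_add]
  refine ⟨μ ⟨0, by omega⟩, μ ⟨1, by omega⟩, funext fun k => ?_⟩
  have := hpar k
  rw [hval k k.2, hval 0 (by omega), hval 1 (by omega)] at this
  rw [alternatingMasses]
  split_ifs at this ⊢ <;> exact_mod_cast this

end HallRing

/-! ### The coefficients as sums of a positive kernel. -/

namespace HallRing

/-- The part of `hallF` that stems from the Newtonian attraction of the small bodies. -/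
noncomputable def hallKernel (φ : ℝ) : ℝ :=
  (2 / |Real.sin (φ / 2)| ^ 3 - 1 / |Real.sin (φ / 2)|) / 8

/-- This separates a positive kernel from the only source of negative directions, the cosine, which
has rank two as a matrix in the angles. -/
theorem hallF_eq (φ : ℝ) : hallF φ = hallKernel φ + Real.cos φ := by
  rw [hallF, hallKernel, ← sq_abs (Real.sin (φ / 2))]
  rcases eq_or_ne |Real.sin (φ / 2)| 0 with h | h
  · simp [h]
  · field_simp

theorem hallKernel_neg (φ : ℝ) : hallKernel (-φ) = hallKernel φ := by
  rw [hallKernel, hallKernel, neg_div, Real.sin_neg, abs_neg]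

theorem hallKernel_add_two_pi (φ : ℝ) : hallKernel (φ + 2 * Real.pi) = hallKernel φ := by
  rw [hallKernel, hallKernel, show (φ + 2 * Real.pi) / 2 = φ / 2 + Real.pi by ring,
    Real.sin_add_pi, abs_neg]

theorem hallKernel_pos {φ : ℝ} (h : Real.sin (φ / 2) ≠ 0) : 0 < hallKernel φ := by
  have h1 := abs_pos.2 h
  have h2 := Real.abs_sin_le_one (φ / 2)
  have e : hallKernel φ = (2 - |Real.sin (φ / 2)| ^ 2) / (8 * |Real.sin (φ / 2)| ^ 3) := by
    rw [hallKernel]; field_simp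
  rw [e]
  refine div_pos ?_ (by positivity)
  nlinarith

theorem hallKernel_nonneg (φ : ℝ) : 0 ≤ hallKernel φ := by
  rcases eq_or_ne (Real.sin (φ / 2)) 0 with h | h
  · simp [hallKernel, h]
  · exact (hallKernel_pos h).le

/-- Angles of the vertices of the regular `2j`-gon, with an arbitrary integer index. -/
noncomputable def ngonAngle (j : ℕ) (x : ℤ) : ℝ := 2 * x * Real.pi / (2 * j : ℕ)

theorem ngonVertex_re (j : ℕ) (x : ℤ) :
    (ngonVertex (2 * j) x).re = Real.cos (ngonAngle j x) := Complex.exp_ofReal_mul_I_re _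

theorem ngonVertex_im (j : ℕ) (x : ℤ) :
    (ngonVertex (2 * j) x).im = Real.sin (ngonAngle j x) := Complex.exp_ofReal_mul_I_im _

theorem hallKernel_ngonAngle_neg (j : ℕ) (x : ℤ) :
    hallKernel (ngonAngle j (-x)) = hallKernel (ngonAngle j x) := by
  rw [← hallKernel_neg]
  congr 1
  simp only [ngonAngle]; push_cast; ring

theorem hallKernel_ngonAngle_add {j : ℕ} (hj : j ≠ 0) (x : ℤ) :
    hallKernel (ngonAngle j (x + (2 * j : ℕ))) = hallKernel (ngonAngle j x) := by
  rw [← hallKernel_add_two_pi (ngonAngle j x)]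
  congr 1
  have : (j : ℝ) ≠ 0 := by exact_mod_cast hj
  simp only [ngonAngle]; push_cast; field_simp

/-- These three sums describe the kernel on the first harmonic, within one `j`-gon and between the
two. The term `d = 0` vanishes, as `hallKernel 0 = 0` by the convention for division by zero. -/
noncomputable def kernelSumEven (j : ℕ) : ℝ :=
  ∑ d ∈ Finset.range j, hallKernel (ngonAngle j (2 * d)) * (1 - Real.cos (ngonAngle j (2 * d)))

noncomputable def kernelSumOdd (j : ℕ) : ℝ :=
  ∑ d ∈ Finset.range j, hallKernel (ngonAngle j (2 * d + 1))

noncomputable def kernelSumOddCos (j : ℕ) : ℝ :=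
  ∑ d ∈ Finset.range j, hallKernel (ngonAngle j (2 * d + 1)) * Real.cos (ngonAngle j (2 * d + 1))

theorem kernelSumOdd_pos {j : ℕ} (hj : 0 < j) : 0 < kernelSumOdd j := by
  refine Finset.sum_pos (fun d hd => hallKernel_pos ?_) ⟨0, Finset.mem_range.2 hj⟩
  have hd := Finset.mem_range.1 hd
  refine (Real.sin_pos_of_pos_of_lt_pi ?_ ?_).ne'
  · simp only [ngonAngle]; push_cast; positivity
  · simp only [ngonAngle]
    have h1 : ((2 * d + 1 : ℕ) : ℝ) < (2 * j : ℕ) := by exact_mod_cast (by omega)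
    have h2 : (0 : ℝ) < j := by exact_mod_cast hj
    push_cast at h1 ⊢
    rw [div_div, div_lt_iff₀ (by positivity)]
    nlinarith [Real.pi_pos]

theorem abs_kernelSumOddCos_le (j : ℕ) : |kernelSumOddCos j| ≤ kernelSumOdd j := by
  refine (Finset.abs_sum_le_sum_abs _ _).trans (Finset.sum_le_sum fun d _ => ?_)
  rw [abs_mul, abs_of_nonneg (hallKernel_nonneg _)]
  exact mul_le_of_le_one_right (hallKernel_nonneg _) (Real.abs_cos_le_one _)

theorem kernelSumEven_pos {j : ℕ} (hj : 2 ≤ j) : 0 < kernelSumEven j := by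
  refine Finset.sum_pos' (fun d _ => mul_nonneg (hallKernel_nonneg _)
    (by linarith [Real.cos_le_one (ngonAngle j (2 * d))])) ⟨1, Finset.mem_range.2 (by omega), ?_⟩
  have hj0 : (0 : ℝ) < j := by positivity
  have h2 : (2 : ℝ) ≤ j := by exact_mod_cast hj
  have e : ngonAngle j (2 * (1 : ℕ)) = 2 * (Real.pi / j) := by
    simp only [ngonAngle]; push_cast; field_simp
  have hs : 0 < Real.sin (Real.pi / j) := Real.sin_pos_of_pos_of_lt_pi (by positivity) (by
    rw [div_lt_iff₀ hj0]; nlinarith [Real.pi_pos])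
  rw [e]
  refine mul_pos (hallKernel_pos ?_) ?_
  · rw [mul_div_cancel_left₀ _ two_ne_zero]; exact hs.ne'
  · rw [Real.cos_two_mul, Real.cos_sq']
    nlinarith

theorem sum_cos_even {j : ℕ} {q : ℤ} (hj : j ≠ 0) (hq : ¬ (j : ℤ) ∣ q) :
    ∑ d ∈ Finset.range j, Real.cos (q * ngonAngle j (2 * d)) = 0 := by
  rw [← sum_cos_eq_zero hj hq]
  refine Finset.sum_congr rfl fun d _ => ?_
  congr 1
  have : (j : ℝ) ≠ 0 := by exact_mod_cast hj
  simp only [ngonAngle]; push_cast; field_simp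

/-- The sum over all `2j` vertices minus the sum over the even ones. -/
theorem sum_cos_odd {j : ℕ} {q : ℤ} (hj : j ≠ 0) (hq : ¬ (j : ℤ) ∣ q) :
    ∑ d ∈ Finset.range j, Real.cos (q * ngonAngle j (2 * d + 1)) = 0 := by
  have h1 := sum_cos_eq_zero (n := 2 * j) (q := q) (by omega) fun h => hq (by
    obtain ⟨c, hc⟩ := h
    exact ⟨2 * c, by rw [hc]; push_cast; ring⟩)
  have h2 : ∀ d : ℕ, Real.cos (2 * q * d * Real.pi / (2 * j : ℕ)) = Real.cos (q * ngonAngle j d) := by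
    intro d; congr 1; simp only [ngonAngle]; push_cast; ring
  simp only [h2] at h1
  rw [sum_range_two_mul j (fun d : ℕ => Real.cos (q * ngonAngle j d)), Finset.sum_add_distrib] at h1
  push_cast at h1
  rw [sum_cos_even hj hq, zero_add] at h1
  exact h1

theorem sum_cos_sq_of_sum_cos_eq_zero {ι : Type*} (s : Finset ι) (φ : ι → ℝ)
    (h : ∑ d ∈ s, Real.cos ((2 : ℤ) * φ d) = 0) :
    ∑ d ∈ s, Real.cos (φ d) ^ 2 = s.card / 2 := by
  have : ∀ d, Real.cos (φ d) ^ 2 = 1 / 2 + 1 / 2 * Real.cos ((2 : ℤ) * φ d) := fun d => by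
    push_cast; rw [Real.cos_two_mul]; ring
  simp only [this, Finset.sum_add_distrib, ← Finset.mul_sum, h]
  simp; ring

theorem not_dvd_of_pos_of_lt {j : ℕ} {q : ℤ} (h0 : 0 < q) (h : q < j) : ¬ (j : ℤ) ∣ q := fun hd => by
  have := Int.le_of_dvd h0 hd
  omega

theorem g₁_eq_sum {j : ℕ} (hj : j ≠ 0) : g₁ j 2 = ∑ d ∈ Finset.range j,
    hallF (ngonAngle j (2 * d)) * (1 - Real.cos (ngonAngle j (2 * d))) := by
  have hj' : (j : ℝ) ≠ 0 := by exact_mod_cast hj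
  rw [Finset.range_eq_Ico, Finset.sum_eq_sum_Ico_succ_bot (by omega), g₁]
  have : ngonAngle j (2 * (0 : ℕ)) = 0 := by simp [ngonAngle]
  rw [this, Real.cos_zero, sub_self, mul_zero, zero_add]
  refine Finset.sum_congr rfl fun d _ => ?_
  have e1 : 2 * (d : ℝ) * Real.pi / j = ngonAngle j (2 * d) := by
    simp only [ngonAngle]; push_cast; field_simp
  have e2 : 2 * (((2 : ℕ) : ℝ) - 1) * d * Real.pi / j = ngonAngle j (2 * d) := by
    rw [← e1]; push_cast; ring
  rw [e1, e2]

theorem sum_Icc_eq_sum_range (j : ℕ) (u : ℕ → ℝ) :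
    ∑ k ∈ Finset.Icc 1 j, u k = ∑ d ∈ Finset.range j, u (d + 1) := by
  rw [← Finset.Ico_succ_right_eq_Icc, Finset.sum_Ico_eq_sum_range]
  simp [add_comm]

theorem g₂_eq_sum {j : ℕ} (hj : j ≠ 0) : g₂ j = ∑ d ∈ Finset.range j,
    hallF (ngonAngle j (2 * d + 1)) := by
  have hj' : (j : ℝ) ≠ 0 := by exact_mod_cast hj
  rw [g₂, sum_Icc_eq_sum_range]
  refine Finset.sum_congr rfl fun d _ => ?_
  congr 1
  simp only [ngonAngle]; push_cast; field_simp; ring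

theorem g₃_eq_sum {j : ℕ} (hj : j ≠ 0) : g₃ j 2 = ∑ d ∈ Finset.range j,
    hallF (ngonAngle j (2 * d + 1)) * Real.cos (ngonAngle j (2 * d + 1)) := by
  have hj' : (j : ℝ) ≠ 0 := by exact_mod_cast hj
  rw [g₃, sum_Icc_eq_sum_range]
  refine Finset.sum_congr rfl fun d _ => ?_
  have e1 : (2 * ((d + 1 : ℕ) : ℝ) - 1) / j * Real.pi = ngonAngle j (2 * d + 1) := by
    simp only [ngonAngle]; push_cast; field_simp; ring
  have e2 : (((2 : ℕ) : ℝ) - 1) * (2 * ((d + 1 : ℕ) : ℝ) - 1) / j * Real.pi =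
      ngonAngle j (2 * d + 1) := by
    rw [← e1]; push_cast; ring
  rw [e1, e2]

/-- The cosine part of `hallF` contributes `-∑ cos² = -j/2`; this value needs `j` not to divide 2,
hence `j ≥ 3`. -/
theorem g₁_eq {j : ℕ} (hj : 3 ≤ j) : g₁ j 2 = kernelSumEven j - j / 2 := by
  have hj0 : j ≠ 0 := by omega
  have h1 := sum_cos_even (q := 1) hj0 (not_dvd_of_pos_of_lt (by norm_num) (by omega))
  have h2 := sum_cos_sq_of_sum_cos_eq_zero (Finset.range j) (fun d => ngonAngle j (2 * d))
    (sum_cos_even (q := 2) hj0 (not_dvd_of_pos_of_lt (by norm_num) (by omega)))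
  simp only [Int.cast_one, one_mul, Finset.card_range] at h1 h2
  rw [g₁_eq_sum hj0, kernelSumEven, ← h2, ← zero_add (∑ d ∈ Finset.range j, hallKernel _ * _), ← h1,
    ← Finset.sum_add_distrib, ← Finset.sum_sub_distrib]
  refine Finset.sum_congr rfl fun d _ => ?_
  rw [hallF_eq]; ring

theorem g₂_eq {j : ℕ} (hj : 2 ≤ j) : g₂ j = kernelSumOdd j := by
  have hj0 : j ≠ 0 := by omega
  have h1 := sum_cos_odd (q := 1) hj0 (not_dvd_of_pos_of_lt (by norm_num) (by omega))
  simp only [Int.cast_one, one_mul] at h1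
  rw [g₂_eq_sum hj0, kernelSumOdd]
  simp only [hallF_eq, Finset.sum_add_distrib, h1, add_zero]

theorem g₃_eq {j : ℕ} (hj : 3 ≤ j) : g₃ j 2 = kernelSumOddCos j + j / 2 := by
  have hj0 : j ≠ 0 := by omega
  have h2 := sum_cos_sq_of_sum_cos_eq_zero (Finset.range j) (fun d => ngonAngle j (2 * d + 1))
    (sum_cos_odd (q := 2) hj0 (not_dvd_of_pos_of_lt (by norm_num) (by omega)))
  rw [Finset.card_range] at h2
  rw [g₃_eq_sum hj0, kernelSumOddCos, ← h2, ← Finset.sum_add_distrib]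
  refine Finset.sum_congr rfl fun d _ => ?_
  rw [hallF_eq]; ring

end HallRing

/-! ### The Hessian as a rank-two perturbation of a positive form. -/

namespace HallRing

variable {n : ℕ} {μ θ : Fin n → ℝ}

/-- The quadratic form of Hall's potential, without the contribution of the dominant body. -/
noncomputable def kernelForm (μ θ u v : Fin n → ℝ) : ℝ :=
  ∑ i, u i * ∑ k, μ i * μ k * hallKernel (θ i - θ k) * (v i - v k)

theorem kernelForm_eq (u v : Fin n → ℝ) : kernelForm μ θ u v =
    1 / 2 * ∑ i, ∑ k, μ i * μ k * hallKernel (θ i - θ k) * (u i - u k) * (v i - v k) := by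
  have e : ∑ i, ∑ k, u k * (μ i * μ k * hallKernel (θ i - θ k) * (v i - v k)) =
      -∑ i, ∑ k, u i * (μ i * μ k * hallKernel (θ i - θ k) * (v i - v k)) := by
    rw [Finset.sum_comm, ← Finset.sum_neg_distrib]
    refine Finset.sum_congr rfl fun i _ => ?_
    rw [← Finset.sum_neg_distrib]
    refine Finset.sum_congr rfl fun k _ => ?_
    rw [← neg_sub (θ i), hallKernel_neg]; ring
  have e2 : ∀ i k, μ i * μ k * hallKernel (θ i - θ k) * (u i - u k) * (v i - v k)
      = u i * (μ i * μ k * hallKernel (θ i - θ k) * (v i - v k))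
        - u k * (μ i * μ k * hallKernel (θ i - θ k) * (v i - v k)) := fun i k => by ring
  have e0 : kernelForm μ θ u v =
      ∑ i, ∑ k, u i * (μ i * μ k * hallKernel (θ i - θ k) * (v i - v k)) := by
    simp only [kernelForm, Finset.mul_sum]
  simp only [e2, Finset.sum_sub_distrib, e, e0]
  ring

theorem kernelForm_symm (u v : Fin n → ℝ) : kernelForm μ θ u v = kernelForm μ θ v u := by
  rw [kernelForm_eq, kernelForm_eq]
  congr 1
  exact Finset.sum_congr rfl fun _ _ => Finset.sum_congr rfl fun _ _ => by ring

theorem kernelForm_add_left (u u' v : Fin n → ℝ) :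
    kernelForm μ θ (u + u') v = kernelForm μ θ u v + kernelForm μ θ u' v := by
  simp only [kernelForm, Pi.add_apply, add_mul, Finset.sum_add_distrib]

theorem kernelForm_smul_left (c : ℝ) (u v : Fin n → ℝ) :
    kernelForm μ θ (c • u) v = c * kernelForm μ θ u v := by
  simp only [kernelForm, Pi.smul_apply, smul_eq_mul, mul_assoc, ← Finset.mul_sum]

theorem kernelForm_add_right (u v v' : Fin n → ℝ) :
    kernelForm μ θ u (v + v') = kernelForm μ θ u v + kernelForm μ θ u v' := by
  rw [kernelForm_symm, kernelForm_add_left, kernelForm_symm v, kernelForm_symm v']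

theorem kernelForm_smul_right (c : ℝ) (u v : Fin n → ℝ) :
    kernelForm μ θ u (c • v) = c * kernelForm μ θ u v := by
  rw [kernelForm_symm, kernelForm_smul_left, kernelForm_symm v]

theorem kernelForm_nonneg (hμ : ∀ k, 0 < μ k) (v : Fin n → ℝ) : 0 ≤ kernelForm μ θ v v := by
  rw [kernelForm_eq]
  refine mul_nonneg (by norm_num) (Finset.sum_nonneg fun i _ => Finset.sum_nonneg fun k _ => ?_)
  rw [mul_assoc]
  exact mul_nonneg (mul_nonneg (mul_pos (hμ i) (hμ k)).le (hallKernel_nonneg _)) (mul_self_nonneg _)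

theorem eq_of_kernelForm_eq_zero (hμ : ∀ k, 0 < μ k) (h : Separated θ) {v : Fin n → ℝ}
    (hv : kernelForm μ θ v v = 0) (i k : Fin n) : v i = v k := by
  have hnn : ∀ i k, 0 ≤ μ i * μ k * hallKernel (θ i - θ k) * (v i - v k) * (v i - v k) := by
    intro i k
    rw [mul_assoc]
    exact mul_nonneg (mul_nonneg (mul_pos (hμ i) (hμ k)).le (hallKernel_nonneg _))
      (mul_self_nonneg _)
  rcases eq_or_ne i k with rfl | hik
  · rfl
  rw [kernelForm_eq, mul_eq_zero, Finset.sum_eq_zero_iff_of_nonneg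
    (fun i _ => Finset.sum_nonneg fun k _ => hnn i k)] at hv
  have h1 := (hv.resolve_left (by norm_num)) i (Finset.mem_univ i)
  rw [Finset.sum_eq_zero_iff_of_nonneg (fun k _ => hnn i k)] at h1
  have h2 := h1 k (Finset.mem_univ k)
  have h3 : μ i * μ k * hallKernel (θ i - θ k) ≠ 0 :=
    (mul_pos (mul_pos (hμ i) (hμ k)) (hallKernel_pos (h i k hik))).ne'
  rw [mul_assoc, mul_eq_zero, mul_self_eq_zero] at h2
  exact sub_eq_zero.1 (h2.resolve_left h3)

/-- Expand `cos (θ i - θ k)`; the vanishing centre of mass removes the diagonal terms, and the rest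
is minus two squares. -/
theorem hallHessian_form_eq (h : Separated θ) (hc : ∑ k, μ k * Real.cos (θ k) = 0)
    (hs : ∑ k, μ k * Real.sin (θ k) = 0) (v : Fin n → ℝ) :
    dotProduct v ((hallHessian μ θ).mulVec v) = kernelForm μ θ v v -
      (∑ k, μ k * Real.cos (θ k) * v k) ^ 2 - (∑ k, μ k * Real.sin (θ k) * v k) ^ 2 := by
  have e1 : dotProduct v ((hallHessian μ θ).mulVec v) = kernelForm μ θ v v +
      ∑ i, v i * ∑ k, μ i * μ k * Real.cos (θ i - θ k) * (v i - v k) := by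
    simp only [dotProduct, hallHessian_mulVec h, kernelForm, hallF_eq, mul_add, add_mul,
      Finset.sum_add_distrib]
  have e2 : ∀ i, ∑ k, μ i * μ k * Real.cos (θ i - θ k) * (v i - v k) =
      -(μ i * Real.cos (θ i) * ∑ k, μ k * Real.cos (θ k) * v k) -
        μ i * Real.sin (θ i) * ∑ k, μ k * Real.sin (θ k) * v k := by
    intro i
    have : ∀ k, μ i * μ k * Real.cos (θ i - θ k) * (v i - v k) =
        μ i * Real.cos (θ i) * v i * (μ k * Real.cos (θ k)) +
        μ i * Real.sin (θ i) * v i * (μ k * Real.sin (θ k)) -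
        μ i * Real.cos (θ i) * (μ k * Real.cos (θ k) * v k) -
        μ i * Real.sin (θ i) * (μ k * Real.sin (θ k) * v k) := fun k => by
      rw [Real.cos_sub]; ring
    simp only [this, Finset.sum_add_distrib, Finset.sum_sub_distrib, ← Finset.mul_sum, hc, hs]
    ring
  rw [e1]
  simp only [e2]
  rw [sq, sq, Finset.sum_mul, Finset.sum_mul, sub_sub, ← Finset.sum_add_distrib, sub_eq_add_neg,
    ← Finset.sum_neg_distrib]
  congr 1
  exact Finset.sum_congr rfl fun i _ => by ring

/-- Solutions `p`, `q` of `kernelForm p = μ cos θ`, `kernelForm q = μ sin θ` diagonalize the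
indefinite part of Hall's Hessian. -/
theorem posSemidef_and_isNondegenerate_iff (hμ : ∀ k, 0 < μ k) (h : Separated θ)
    (hc : ∑ k, μ k * Real.cos (θ k) = 0) (hs : ∑ k, μ k * Real.sin (θ k) = 0)
    {p q : Fin n → ℝ} {ρ : ℝ}
    (hp : ∀ i, ∑ k, μ i * μ k * hallKernel (θ i - θ k) * (p i - p k) = μ i * Real.cos (θ i))
    (hq : ∀ i, ∑ k, μ i * μ k * hallKernel (θ i - θ k) * (q i - q k) = μ i * Real.sin (θ i))
    (hpc : ∑ k, μ k * Real.cos (θ k) * p k = ρ) (hps : ∑ k, μ k * Real.sin (θ k) * p k = 0)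
    (hqc : ∑ k, μ k * Real.cos (θ k) * q k = 0) (hqs : ∑ k, μ k * Real.sin (θ k) * q k = ρ)
    (hρ : 0 < ρ) (hp0 : ∑ k, p k = 0) :
    (hallHessian μ θ).PosSemidef ∧ IsNondegenerate μ θ ↔ ρ < 1 := by
  have hKp : ∀ v, kernelForm μ θ v p = ∑ k, μ k * Real.cos (θ k) * v k := fun v => by
    simp only [kernelForm, hp]
    exact Finset.sum_congr rfl fun _ _ => by ring
  have hKq : ∀ v, kernelForm μ θ v q = ∑ k, μ k * Real.sin (θ k) * v k := fun v => by
    simp only [kernelForm, hq]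
    exact Finset.sum_congr rfl fun _ _ => by ring
  constructor
  · rintro ⟨hP, hN⟩
    have hne : p ≠ 0 := by
      rintro rfl
      simp only [Pi.zero_apply, mul_zero, Finset.sum_const_zero] at hpc
      exact hρ.ne hpc
    -- The form takes the value `ρ - ρ²` at `p`, so positivity there forces `ρ < 1`.
    have := pos_of_posSemidef hP hN hne hp0
    rw [hallHessian_form_eq h hc hs, hKp, hpc, hps] at this
    nlinarith
  · intro hρ1
    have key : ∀ v, kernelForm μ θ v v - (∑ k, μ k * Real.cos (θ k) * v k) ^ 2 -
        (∑ k, μ k * Real.sin (θ k) * v k) ^ 2 ≥ (1 - ρ) * ((∑ k, μ k * Real.cos (θ k) * v k) ^ 2 +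
          (∑ k, μ k * Real.sin (θ k) * v k) ^ 2) := by
      intro v
      set C := ∑ k, μ k * Real.cos (θ k) * v k with hC
      set S := ∑ k, μ k * Real.sin (θ k) * v k with hS
      -- Completing the square: positivity of the kernel form at `v - C p - S q` bounds it at `v`
      -- below by `(2 - ρ)(C² + S²)`.
      have h0 := kernelForm_nonneg (θ := θ) hμ (v + ((-C) • p + (-S) • q))
      have hexp : kernelForm μ θ (v + ((-C) • p + (-S) • q)) (v + ((-C) • p + (-S) • q)) =
          kernelForm μ θ v v - 2 * (C ^ 2 + S ^ 2) + ρ * (C ^ 2 + S ^ 2) := by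
        simp only [kernelForm_add_left, kernelForm_add_right, kernelForm_smul_left,
          kernelForm_smul_right, kernelForm_symm p v, kernelForm_symm q v]
        simp only [hKp, hKq, hpc, hps, hqc, hqs, ← hC, ← hS]
        ring
      rw [hexp] at h0
      linarith
    have hnn : ∀ v, 0 ≤ dotProduct v ((hallHessian μ θ).mulVec v) := fun v => by
      rw [hallHessian_form_eq h hc hs]
      have := key v
      have : 0 ≤ (1 - ρ) * ((∑ k, μ k * Real.cos (θ k) * v k) ^ 2 +
          (∑ k, μ k * Real.sin (θ k) * v k) ^ 2) := mul_nonneg (by linarith) (by positivity)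
      linarith
    refine ⟨Matrix.PosSemidef.of_dotProduct_mulVec_nonneg (hallHessian_isHermitian h)
      fun v => by rw [star_trivial]; exact hnn v, fun v hv => ?_⟩
    have h0 : dotProduct v ((hallHessian μ θ).mulVec v) = 0 := by rw [hv, dotProduct_zero]
    rw [hallHessian_form_eq h hc hs] at h0
    have h1 := key v
    rw [h0] at h1
    have h2 : (∑ k, μ k * Real.cos (θ k) * v k) ^ 2 + (∑ k, μ k * Real.sin (θ k) * v k) ^ 2 = 0 := by
      refine le_antisymm ?_ (by positivity)
      by_contra! hlt
      have := mul_pos (sub_pos.2 hρ1) hlt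
      linarith
    have h3 := eq_of_kernelForm_eq_zero hμ h (v := v) (by linarith)
    rcases Nat.eq_zero_or_pos n with rfl | hn
    · exact ⟨0, funext fun k => k.elim0⟩
    · exact ⟨v ⟨0, hn⟩, funext fun k => h3 k _⟩

theorem ngonAngle_eq (j : ℕ) (k : Fin (2 * j)) : ngonAngles (2 * j) k = ngonAngle j (k : ℕ) := by
  simp [ngonAngles, ngonAngle]

theorem parityWeight_two_mul {α : Type*} (a b : α) (d : ℤ) : parityWeight a b (2 * d) = a := by
  simp [parityWeight]

theorem parityWeight_two_mul_add_one {α : Type*} (a b : α) (d : ℤ) :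
    parityWeight a b (2 * d + 1) = b := by
  simp [parityWeight]

/-- Vectors that equal `x` or `y`, according to parity, times the first harmonic form an invariant
subspace of the kernel operator up to the mass factor. The operator acts there by the 2 by 2 matrix
on the right. -/
theorem sum_hallKernel_parityWeight {j : ℕ} (hj : j ≠ 0) (a b x y : ℝ) (i : Fin (2 * j)) :
    (∑ l : Fin (2 * j), ((alternatingMasses (2 * j) a b i * alternatingMasses (2 * j) a b l *
        hallKernel (ngonAngles (2 * j) i - ngonAngles (2 * j) l) : ℝ) : ℂ) *
        (alternatingMasses (2 * j) x y i * ngonVertex (2 * j) (i : ℕ) -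
          alternatingMasses (2 * j) x y l * ngonVertex (2 * j) (l : ℕ))) =
      ((alternatingMasses (2 * j) a b i * alternatingMasses (2 * j)
        (a * x * kernelSumEven j + b * x * kernelSumOdd j - b * y * kernelSumOddCos j)
        (b * y * kernelSumEven j + a * y * kernelSumOdd j - a * x * kernelSumOddCos j) i : ℝ) : ℂ) *
        ngonVertex (2 * j) (i : ℕ) := by
  have h0 : 2 * j ≠ 0 := by omega
  have key := sum_parity_shift j (fun l d => ((parityWeight a b l * hallKernel (ngonAngle j d) : ℝ) : ℂ)
    * ((parityWeight x y (i : ℕ) : ℝ) - (parityWeight x y l : ℝ) * ngonVertex (2 * j) d))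
    (fun k x => by simp only [parityWeight_add_two])
    (fun k x => by simp only [ngonVertex_add_self h0, hallKernel_ngonAngle_add hj]) (i : ℕ)
  have hL : (∑ l : Fin (2 * j), ((alternatingMasses (2 * j) a b i * alternatingMasses (2 * j) a b l *
        hallKernel (ngonAngles (2 * j) i - ngonAngles (2 * j) l) : ℝ) : ℂ) *
        (alternatingMasses (2 * j) x y i * ngonVertex (2 * j) (i : ℕ) -
          alternatingMasses (2 * j) x y l * ngonVertex (2 * j) (l : ℕ))) =
      (alternatingMasses (2 * j) a b i : ℂ) * ngonVertex (2 * j) (i : ℕ) *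
      ∑ l ∈ Finset.range (2 * j), ((parityWeight a b l *
        hallKernel (ngonAngle j (l - (i : ℕ))) : ℝ) : ℂ) * ((parityWeight x y (i : ℕ) : ℝ) -
          (parityWeight x y l : ℝ) * ngonVertex (2 * j) (l - (i : ℕ))) := by
    rw [Finset.sum_range, Finset.mul_sum]
    refine Finset.sum_congr rfl fun l _ => ?_
    have e1 : ngonVertex (2 * j) (l : ℕ) = ngonVertex (2 * j) (i : ℕ) *
        ngonVertex (2 * j) ((l : ℕ) - (i : ℕ)) := by
      rw [← ngonVertex_add, add_sub_cancel]
    have e2 : hallKernel (ngonAngles (2 * j) i - ngonAngles (2 * j) l) =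
        hallKernel (ngonAngle j ((l : ℕ) - (i : ℕ))) := by
      rw [← hallKernel_neg, neg_sub, ngonAngles_sub]
      rfl
    rw [e1, e2]
    simp only [alternatingMasses_eq]
    push_cast; ring
  rw [hL, key]
  set X : ℂ := ∑ l ∈ Finset.range (2 * j), ((parityWeight a b (l + (i : ℕ)) *
    hallKernel (ngonAngle j l) : ℝ) : ℂ) * ((parityWeight x y (i : ℕ) : ℝ) -
      (parityWeight x y (l + (i : ℕ)) : ℝ) * ngonVertex (2 * j) l) with hX
  -- The substitution `l ↦ -l` preserves the kernel and the parities and changes the sign of the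
  -- sine.
  have him : X.im = 0 := by
    have h1 : X.im = -∑ l ∈ Finset.range (2 * j), parityWeight a b (l + (i : ℕ)) *
        hallKernel (ngonAngle j l) * parityWeight x y (l + (i : ℕ)) * (ngonVertex (2 * j) l).im := by
      rw [hX, Complex.im_sum, ← Finset.sum_neg_distrib]
      refine Finset.sum_congr rfl fun l _ => ?_
      rw [Complex.im_ofReal_mul, Complex.sub_im, Complex.ofReal_im, Complex.im_ofReal_mul]
      ring
    have h2 := sum_range_neg_int (2 * j) (h := fun l => parityWeight a b (l + (i : ℕ)) *
        hallKernel (ngonAngle j l) * parityWeight x y (l + (i : ℕ)) * (ngonVertex (2 * j) l).im)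
      (fun l => by
        have e : l + ((2 * j : ℕ) : ℤ) + (i : ℕ) = l + (i : ℕ) + (2 * j : ℕ) := by ring
        simp only [e, parityWeight_add_two_mul, ngonVertex_add_self h0, hallKernel_ngonAngle_add hj])
    simp only [parityWeight_add, parityWeight_neg, hallKernel_ngonAngle_neg, ngonVertex_neg,
      Complex.star_def, Complex.conj_im, mul_neg, Finset.sum_neg_distrib] at h1 h2
    linarith
  have hre : X.re = alternatingMasses (2 * j)
        (a * x * kernelSumEven j + b * x * kernelSumOdd j - b * y * kernelSumOddCos j)
        (b * y * kernelSumEven j + a * y * kernelSumOdd j - a * x * kernelSumOddCos j) i := by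
    have h1 : X.re = ∑ l ∈ Finset.range (2 * j), parityWeight a b (l + (i : ℕ)) *
        hallKernel (ngonAngle j l) * (parityWeight x y (i : ℕ) -
          parityWeight x y (l + (i : ℕ)) * Real.cos (ngonAngle j l)) := by
      rw [hX, Complex.re_sum]
      refine Finset.sum_congr rfl fun l _ => ?_
      rw [Complex.re_ofReal_mul, Complex.sub_re, Complex.ofReal_re, Complex.re_ofReal_mul,
        ngonVertex_re]
    rw [h1, sum_range_two_mul j (fun l : ℕ => parityWeight a b (l + (i : ℕ)) *
        hallKernel (ngonAngle j l) * (parityWeight x y (i : ℕ) -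
          parityWeight x y (l + (i : ℕ)) * Real.cos (ngonAngle j l))), Finset.sum_add_distrib]
    simp only [parityWeight_add]
    push_cast
    simp only [parityWeight_two_mul, parityWeight_two_mul_add_one, alternatingMasses_eq]
    rw [kernelSumEven, kernelSumOdd, kernelSumOddCos]
    by_cases hi : Even (((i : ℕ) : ℤ))
    · simp only [parityWeight, if_pos hi, Finset.mul_sum, ← Finset.sum_add_distrib,
        ← Finset.sum_sub_distrib]
      exact Finset.sum_congr rfl fun _ _ => by ring
    · simp only [parityWeight, if_neg hi, Finset.mul_sum, ← Finset.sum_add_distrib,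
        ← Finset.sum_sub_distrib]
      exact Finset.sum_congr rfl fun _ _ => by ring
  have hXe : X = (X.re : ℂ) := Complex.ext rfl (by rw [him, Complex.ofReal_im])
  rw [hXe, hre]
  push_cast; ring

end HallRing

/-! ### The stability criterion in terms of `χ`. -/

namespace HallRing

theorem sum_alternatingMasses {j : ℕ} (A B : ℝ) :
    ∑ k, alternatingMasses (2 * j) A B k = j * (A + B) := by
  simp only [alternatingMasses_eq]
  rw [← Finset.sum_range (fun k : ℕ => parityWeight A B k),
    sum_range_two_mul j (fun k : ℕ => parityWeight A B k)]
  push_cast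
  simp only [parityWeight_two_mul, parityWeight_two_mul_add_one]
  simp; ring

theorem sum_alternatingMasses_mul_ngonVertex {j : ℕ} (hj : 2 ≤ j) (A B : ℝ) :
    ∑ k : Fin (2 * j), (alternatingMasses (2 * j) A B k : ℂ) * ngonVertex (2 * j) (k : ℕ) = 0 := by
  rw [← sum_parityWeight_mul_ngonVertex hj (A : ℂ) (B : ℂ), Finset.sum_range]
  refine Finset.sum_congr rfl fun k _ => ?_
  rw [alternatingMasses_eq]
  congr 1
  simp only [parityWeight]
  split_ifs <;> rfl

/-- A rotation by two vertices now multiplies by `ngonVertex (2 * j) 4`, which differs from `1` only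
for `j ≥ 3`. The square is excluded from this method. -/
theorem sum_alternatingMasses_mul_ngonVertex_sq {j : ℕ} (hj : 3 ≤ j) (A B : ℝ) :
    ∑ k : Fin (2 * j), (alternatingMasses (2 * j) A B k : ℂ) * ngonVertex (2 * j) (k : ℕ) ^ 2 = 0 := by
  have h0 : 2 * j ≠ 0 := by omega
  simp only [alternatingMasses_eq]
  rw [← Finset.sum_range (fun k : ℕ => ((parityWeight A B k : ℝ) : ℂ) * ngonVertex (2 * j) k ^ 2)]
  have := sum_range_add_int (2 * j) (h := fun x => ((parityWeight A B x : ℝ) : ℂ) *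
    ngonVertex (2 * j) x ^ 2) (fun x => by
      rw [ngonVertex_add_self h0, parityWeight_add_two_mul]) 2
  simp only [parityWeight_add_two, ngonVertex_add, mul_pow, ← mul_assoc, ← Finset.sum_mul] at this
  have h1 : ngonVertex (2 * j) 2 ^ 2 ≠ 1 := by
    rw [sq, ← ngonVertex_add, Ne, ngonVertex_eq_one_iff h0]
    intro h
    have := Int.le_of_dvd (by norm_num) h
    push_cast at this
    omega
  by_contra hne
  exact h1 (mul_left_cancel₀ hne (this.trans (mul_one _).symm))

variable {j : ℕ}

theorem sum_alternatingMasses_mul_cos (hj : 2 ≤ j) (A B : ℝ) :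
    ∑ k, alternatingMasses (2 * j) A B k * Real.cos (ngonAngles (2 * j) k) = 0 := by
  have := congrArg Complex.re (sum_alternatingMasses_mul_ngonVertex hj A B)
  rw [Complex.re_sum, Complex.zero_re] at this
  rw [← this]
  refine Finset.sum_congr rfl fun k _ => ?_
  rw [Complex.re_ofReal_mul, ngonVertex_re, ngonAngle_eq]

theorem sum_alternatingMasses_mul_sin (hj : 2 ≤ j) (A B : ℝ) :
    ∑ k, alternatingMasses (2 * j) A B k * Real.sin (ngonAngles (2 * j) k) = 0 := by
  have := congrArg Complex.im (sum_alternatingMasses_mul_ngonVertex hj A B)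
  rw [Complex.im_sum, Complex.zero_im] at this
  rw [← this]
  refine Finset.sum_congr rfl fun k _ => ?_
  rw [Complex.im_ofReal_mul, ngonVertex_im, ngonAngle_eq]

theorem sum_alternatingMasses_mul_cos_sq_sub_sin_sq (hj : 3 ≤ j) (A B : ℝ) :
    ∑ k, alternatingMasses (2 * j) A B k * (Real.cos (ngonAngles (2 * j) k) ^ 2 -
      Real.sin (ngonAngles (2 * j) k) ^ 2) = 0 := by
  have := congrArg Complex.re (sum_alternatingMasses_mul_ngonVertex_sq hj A B)
  rw [Complex.re_sum, Complex.zero_re] at this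
  rw [← this]
  refine Finset.sum_congr rfl fun k _ => ?_
  rw [Complex.re_ofReal_mul, sq (ngonVertex _ _), Complex.mul_re, ngonVertex_re, ngonVertex_im,
    ngonAngle_eq]
  ring

theorem sum_alternatingMasses_mul_cos_mul_sin (hj : 3 ≤ j) (A B : ℝ) :
    ∑ k, alternatingMasses (2 * j) A B k * (Real.cos (ngonAngles (2 * j) k) *
      Real.sin (ngonAngles (2 * j) k)) = 0 := by
  have := congrArg Complex.im (sum_alternatingMasses_mul_ngonVertex_sq hj A B)
  rw [Complex.im_sum, Complex.zero_im] at this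
  have h2 : ∀ k : Fin (2 * j), ((alternatingMasses (2 * j) A B k : ℂ) *
      ngonVertex (2 * j) (k : ℕ) ^ 2).im = 2 * (alternatingMasses (2 * j) A B k *
      (Real.cos (ngonAngles (2 * j) k) * Real.sin (ngonAngles (2 * j) k))) := fun k => by
    rw [Complex.im_ofReal_mul, sq (ngonVertex _ _), Complex.mul_im, ngonVertex_re, ngonVertex_im,
      ngonAngle_eq]
    ring
  simp only [h2, ← Finset.mul_sum] at this
  linarith

theorem sum_alternatingMasses_mul_cos_sq (hj : 3 ≤ j) (A B : ℝ) :
    ∑ k, alternatingMasses (2 * j) A B k * Real.cos (ngonAngles (2 * j) k) ^ 2 =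
      j / 2 * (A + B) := by
  have h1 := sum_alternatingMasses_mul_cos_sq_sub_sin_sq hj A B
  have h2 := sum_alternatingMasses (j := j) A B
  have h3 : ∀ k, alternatingMasses (2 * j) A B k * Real.cos (ngonAngles (2 * j) k) ^ 2 =
      1 / 2 * (alternatingMasses (2 * j) A B k * (Real.cos (ngonAngles (2 * j) k) ^ 2 -
      Real.sin (ngonAngles (2 * j) k) ^ 2)) + 1 / 2 * alternatingMasses (2 * j) A B k := fun k => by
    rw [Real.sin_sq]; ring
  simp only [h3, Finset.sum_add_distrib, ← Finset.mul_sum, h1, h2]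
  ring

theorem sum_alternatingMasses_mul_sin_sq (hj : 3 ≤ j) (A B : ℝ) :
    ∑ k, alternatingMasses (2 * j) A B k * Real.sin (ngonAngles (2 * j) k) ^ 2 =
      j / 2 * (A + B) := by
  have h1 := sum_alternatingMasses_mul_cos_sq_sub_sin_sq hj A B
  have h2 := sum_alternatingMasses_mul_cos_sq hj A B
  simp only [mul_sub, Finset.sum_sub_distrib] at h1
  linarith

theorem alternatingMasses_mul (a b x y : ℝ) (k : Fin (2 * j)) :
    alternatingMasses (2 * j) a b k * alternatingMasses (2 * j) x y k =
      alternatingMasses (2 * j) (a * x) (b * y) k := by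
  simp only [alternatingMasses]
  split_ifs <;> rfl

/-- Stability of the regular `2j`-gon with alternating masses is decided by the sign of `chi`. -/
theorem posSemidef_and_isNondegenerate_iff_chi_pos (hj : 3 ≤ j) {a b : ℝ} (ha : 0 < a) (hb : 0 < b) :
    (hallHessian (alternatingMasses (2 * j) a b) (ngonAngles (2 * j))).PosSemidef ∧
      IsNondegenerate (alternatingMasses (2 * j) a b) (ngonAngles (2 * j)) ↔ 0 < chi a b j 2 := by
  have hj2 : 2 ≤ j := by omega
  have hj0 : (0 : ℝ) < j := by positivity
  have hE := kernelSumEven_pos hj2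
  have hO := kernelSumOdd_pos (j := j) (by omega)
  have hC := abs_kernelSumOddCos_le j
  rw [abs_le] at hC
  -- `χ` is the determinant of the 2 by 2 system below minus `j / 2 * T`, so `χ > 0` will turn out
  -- to be `ρ < 1`.
  have hchi : chi a b j 2 = ((a * kernelSumEven j + b * kernelSumOdd j) *
      (b * kernelSumEven j + a * kernelSumOdd j) - a * b * kernelSumOddCos j ^ 2) -
      j / 2 * (2 * a * b * (kernelSumEven j + kernelSumOddCos j) +
        (a ^ 2 + b ^ 2) * kernelSumOdd j) := by
    rw [chi, g₁_eq hj, g₂_eq hj2, g₃_eq hj]; ring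
  set E := kernelSumEven j with hEdef
  set O := kernelSumOdd j with hOdef
  set C := kernelSumOddCos j with hCdef
  set D := (a * E + b * O) * (b * E + a * O) - a * b * C ^ 2 with hD
  have hab := mul_pos ha hb
  have hDpos : 0 < D := by
    have h1 : 0 ≤ a * b * ((O - C) * (O + C)) := by
      refine mul_nonneg hab.le (mul_nonneg ?_ ?_) <;> linarith
    have h2 : 0 < (a ^ 2 + b ^ 2) * (E * O) := by positivity
    have h3 : 0 < a * b * E ^ 2 := by positivity
    rw [hD]
    nlinarith
  set T := 2 * a * b * (E + C) + (a ^ 2 + b ^ 2) * O with hT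
  have hTpos : 0 < T := by
    have h1 : 0 ≤ 2 * (a * b) * (O + C) := by
      refine mul_nonneg (by positivity) ?_; linarith
    have h2 : 0 ≤ (a - b) ^ 2 * O := by positivity
    have h3 : 0 < a * b * E := by positivity
    rw [hT]
    nlinarith
  -- Cramer's rule for the amplitudes whose image under the kernel operator is `μ` times the first
  -- harmonic.
  set x := (b * E + a * O + b * C) / D with hx
  set y := (a * E + b * O + a * C) / D with hy
  have hrow1 : a * x * E + b * x * O - b * y * C = 1 := by
    rw [hx, hy]; field_simp; rw [hD]; ring
  have hrow2 : b * y * E + a * y * O - a * x * C = 1 := by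
    rw [hx, hy]; field_simp; rw [hD]; ring
  have hρ : j / 2 * (a * x + b * y) = j / 2 * T / D := by
    rw [hx, hy, hT]; field_simp; ring
  have hsol := sum_hallKernel_parityWeight (j := j) (by omega) a b x y
  rw [← hEdef, ← hOdef, ← hCdef, hrow1, hrow2] at hsol
  have h1 : ∀ i, alternatingMasses (2 * j) (1 : ℝ) 1 i = 1 := fun i => by simp [alternatingMasses]
  rw [posSemidef_and_isNondegenerate_iff (ρ := j / 2 * (a * x + b * y))
    (p := fun k => alternatingMasses (2 * j) x y k * Real.cos (ngonAngles (2 * j) k))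
    (q := fun k => alternatingMasses (2 * j) x y k * Real.sin (ngonAngles (2 * j) k))
    (alternatingMasses_pos ha hb) separated_ngonAngles (sum_alternatingMasses_mul_cos hj2 a b)
    (sum_alternatingMasses_mul_sin hj2 a b)]
  · rw [hρ, div_lt_one hDpos, hchi, sub_pos]
  · intro i
    have := congrArg Complex.re (hsol i)
    simp only [Complex.re_sum, Complex.re_ofReal_mul, Complex.sub_re, h1, mul_one, ngonVertex_re,
      ← ngonAngle_eq] at this
    exact this
  · intro i
    have := congrArg Complex.im (hsol i)
    simp only [Complex.im_sum, Complex.im_ofReal_mul, Complex.sub_im, h1, mul_one, ngonVertex_im,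
      ← ngonAngle_eq] at this
    exact this
  · rw [← sum_alternatingMasses_mul_cos_sq hj]
    refine Finset.sum_congr rfl fun k _ => ?_
    rw [← alternatingMasses_mul]; ring
  · rw [← sum_alternatingMasses_mul_cos_mul_sin hj (a * x) (b * y)]
    refine Finset.sum_congr rfl fun k _ => ?_
    rw [← alternatingMasses_mul]; ring
  · rw [← sum_alternatingMasses_mul_cos_mul_sin hj (a * x) (b * y)]
    refine Finset.sum_congr rfl fun k _ => ?_
    rw [← alternatingMasses_mul]; ring
  · rw [← sum_alternatingMasses_mul_sin_sq hj]
    refine Finset.sum_congr rfl fun k _ => ?_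
    rw [← alternatingMasses_mul]; ring
  · rw [hρ]; positivity
  · exact sum_alternatingMasses_mul_cos hj2 x y

end HallRing

/-! ### Chord sums and the sign of `χ` for `j ≥ 7`, `j = 3` and `j = 2`. -/

namespace HallRing

/-- Insert `sin t > t - t³/6` with `t = y/2` into `cos y = 1 - 2 sin² t`. -/
theorem cos_le_quartic {y : ℝ} (h0 : 0 < y) (h : y ≤ 3) :
    Real.cos y ≤ 1 - y ^ 2 / 2 + y ^ 4 / 24 := by
  have h1 := Real.sin_gt_sub_cube (half_pos h0)
  have h2 : 0 ≤ y / 2 - (y / 2) ^ 3 / 6 := by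
    have : 0 ≤ y * (24 - y ^ 2) := mul_nonneg h0.le (by nlinarith)
    nlinarith
  have h3 : Real.cos y = 1 - 2 * Real.sin (y / 2) ^ 2 := by
    have := Real.cos_two_mul (y / 2)
    rw [mul_div_cancel₀ _ two_ne_zero, Real.cos_sq'] at this
    linarith
  have h4 := pow_le_pow_left₀ h2 h1.le 2
  have h5 : 0 ≤ y ^ 6 := by positivity
  rw [h3]
  nlinarith

/-- The function `6y - (6 + y²) sin y` vanishes at zero, and its derivative is at least `y⁴ (6 - y²)
/ 24`. -/
theorem inv_add_div_six_le_inv_sin {y : ℝ} (h0 : 0 < y) (h : y ≤ 2) :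
    1 / y + y / 6 ≤ 1 / Real.sin y := by
  have hmono : MonotoneOn (fun y : ℝ => 6 * y - (6 + y ^ 2) * Real.sin y) (Set.Icc 0 2) := by
    have hd : ∀ y : ℝ, HasDerivAt (fun y : ℝ => 6 * y - (6 + y ^ 2) * Real.sin y)
        (6 - (2 * y * Real.sin y + (6 + y ^ 2) * Real.cos y)) y := fun y => by
      have h1 := (hasDerivAt_id y).const_mul 6
      have h2 := ((hasDerivAt_id y).pow 2).const_add 6
      refine (h1.sub (h2.mul (Real.hasDerivAt_sin y))).congr_deriv ?_
      simp
    refine monotoneOn_of_deriv_nonneg (convex_Icc 0 2)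
      (fun y _ => (hd y).continuousAt.continuousWithinAt)
      (fun y _ => (hd y).differentiableAt.differentiableWithinAt) fun y hy => ?_
    rw [interior_Icc] at hy
    rw [(hd y).deriv]
    have h1 := mul_le_mul_of_nonneg_left (Real.sin_lt hy.1).le hy.1.le
    have h2 := mul_le_mul_of_nonneg_left (cos_le_quartic hy.1 (by linarith [hy.2]))
      (by positivity : (0 : ℝ) ≤ 6 + y ^ 2)
    have h3 : 0 ≤ y ^ 4 * (6 - y ^ 2) := mul_nonneg (by positivity) (by nlinarith [hy.1, hy.2])
    nlinarith
  have h1 := hmono (Set.left_mem_Icc.2 zero_le_two) ⟨h0.le, h⟩ h0.le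
  simp only [mul_zero, Real.sin_zero, sub_zero] at h1
  have hs : 0 < Real.sin y := Real.sin_pos_of_pos_of_lt_pi h0 (by linarith [Real.pi_gt_three])
  rw [le_div_iff₀ hs]
  have e : (1 / y + y / 6) * Real.sin y = (6 + y ^ 2) * Real.sin y / (6 * y) := by field_simp
  rw [e, div_le_one (by positivity)]
  linarith

/-- The sum of `2 / s - s` over the half chords `s` of a regular `N`-gon. -/
noncomputable def chordSum (N : ℕ) : ℝ :=
  ∑ k ∈ Finset.range N, (2 / Real.sin (k * Real.pi / N) - Real.sin (k * Real.pi / N))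

theorem sin_natCast_mul_pi_div_pos {k N : ℕ} (h0 : 0 < k) (h : k < N) :
    0 < Real.sin (k * Real.pi / N) := by
  have hN : (0 : ℝ) < N := by exact_mod_cast h0.trans h
  have hk : (0 : ℝ) < k := by exact_mod_cast h0
  refine Real.sin_pos_of_pos_of_lt_pi (by positivity) ?_
  rw [div_lt_iff₀ hN, mul_comm]
  exact mul_lt_mul_of_pos_left (by exact_mod_cast h) Real.pi_pos

theorem two_div_sub_anti {s t : ℝ} (hs : 0 < s) (h : s ≤ t) : 2 / t - t ≤ 2 / s - s := by
  have := div_le_div_of_nonneg_left (by norm_num : (0 : ℝ) ≤ 2) hs h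
  linarith

/-- Keep the three shortest chords on each side and bound the `N - 7` middle terms by `2/s - s ≥ 1`.
The term `k = 0` is zero by the convention for division by zero. -/
theorem le_chordSum {N : ℕ} (hN : 7 ≤ N) :
    2 * ∑ k ∈ Finset.Ico (1 : ℕ) 4, (2 / Real.sin (k * Real.pi / N) - Real.sin (k * Real.pi / N)) +
      (N - 7) ≤ chordSum N := by
  set u : ℕ → ℝ := fun k => 2 / Real.sin (k * Real.pi / N) - Real.sin (k * Real.pi / N) with hu
  have hN0 : (N : ℝ) ≠ 0 := by positivity
  have hsym : ∑ k ∈ Finset.Ico (N - 3) N, u k = ∑ k ∈ Finset.Ico 1 4, u k := by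
    have := Finset.sum_Ico_reflect u 1 (n := N) (m := 4) (by omega)
    rw [show N + 1 - 4 = N - 3 by omega, Nat.add_sub_cancel] at this
    rw [← this]
    refine Finset.sum_congr rfl fun k hk => ?_
    rw [Finset.mem_Ico] at hk
    have : ((N - k : ℕ) : ℝ) * Real.pi / N = Real.pi - k * Real.pi / N := by
      rw [Nat.cast_sub (by omega)]; field_simp
    simp only [hu, this, Real.sin_pi_sub]
  have hmid : ((N : ℝ) - 7) ≤ ∑ k ∈ Finset.Ico 4 (N - 3), u k := by
    have h1 : ∑ k ∈ Finset.Ico 4 (N - 3), (1 : ℝ) ≤ ∑ k ∈ Finset.Ico 4 (N - 3), u k := by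
      refine Finset.sum_le_sum fun k hk => ?_
      rw [Finset.mem_Ico] at hk
      have := two_div_sub_anti (sin_natCast_mul_pi_div_pos (k := k) (N := N) (by omega) (by omega))
        (Real.sin_le_one _)
      simp only [hu]; linarith
    have h2 : ((N - 3 - 4 : ℕ) : ℝ) = (N : ℝ) - 7 := by
      rw [Nat.sub_sub, Nat.cast_sub (by omega)]; norm_num
    simpa [h2] using h1
  have hsplit : chordSum N = u 0 + (∑ k ∈ Finset.Ico 1 4, u k +
      (∑ k ∈ Finset.Ico 4 (N - 3), u k + ∑ k ∈ Finset.Ico (N - 3) N, u k)) := by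
    rw [Finset.sum_Ico_consecutive u (by omega) (by omega),
      Finset.sum_Ico_consecutive u (by omega) (by omega), chordSum, Finset.range_eq_Ico,
      Finset.sum_eq_sum_Ico_succ_bot (by omega)]
  have hu0 : u 0 = 0 := by simp [hu]
  rw [hsplit, hsym, hu0]
  linarith

/-- This inequality is the source of the threshold 7 in the theorem; at `N = 7` it holds with little
room, so that case uses sharper bounds. -/
theorem chordSum_gt {N : ℕ} (hN : 7 ≤ N) : 2 * (N : ℝ) < chordSum N := by
  refine lt_of_lt_of_le ?_ (le_chordSum hN)
  have hpi := Real.pi_gt_d6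
  have hpi' := Real.pi_lt_d6
  have hb : ∀ k : ℕ, 0 < k → k < 4 → 2 * N / Real.pi * (1 / k) - 2 * Real.pi / (3 * N) * k ≤
      2 / Real.sin (k * Real.pi / N) - Real.sin (k * Real.pi / N) := by
    intro k h0 hk
    have hN' : (0 : ℝ) < N := by positivity
    have h7 : (7 : ℝ) ≤ N := by exact_mod_cast hN
    have hk' : (k : ℝ) ≤ 3 := by exact_mod_cast (by omega)
    have hy : (0 : ℝ) < k * Real.pi / N := by positivity
    have h1 := inv_add_div_six_le_inv_sin hy (by
      rw [div_le_iff₀ hN']; nlinarith)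
    have h2 := (Real.sin_lt hy).le
    have e : 2 * N / Real.pi * (1 / k) - 2 * Real.pi / (3 * N) * k =
        2 * (1 / (k * Real.pi / N) + k * Real.pi / N / 6) - k * Real.pi / N := by
      field_simp; ring
    have e2 : 2 / Real.sin (k * Real.pi / N) = 2 * (1 / Real.sin (k * Real.pi / N)) := by ring
    rw [e, e2]
    linarith
  rw [Finset.sum_Ico_succ_top (by norm_num), Finset.sum_Ico_succ_top (by norm_num),
    Finset.sum_Ico_succ_top (by norm_num), Finset.Ico_self, Finset.sum_empty, zero_add]
  have h1 := hb 1 (by norm_num) (by norm_num)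
  rcases hN.eq_or_lt with rfl | h8
  · have hc : ∀ y y₀ : ℝ, 0 < y₀ → y₀ ≤ y → y ≤ 3 → Real.cos y ≤ 1 - y₀ ^ 2 / 2 + y₀ ^ 4 / 24 :=
      fun y y₀ h0 h h' => (Real.cos_le_cos_of_nonneg_of_le_pi h0.le (by linarith) h).trans
        (cos_le_quartic h0 (h.trans h'))
    -- As cosines of small angles the two sines have accurate upper bounds.
    have e2 : Real.sin ((2 : ℕ) * Real.pi / (7 : ℕ)) = Real.cos (3 * Real.pi / 14) := by
      rw [← Real.cos_pi_div_two_sub]; congr 1; push_cast; ring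
    have e3 : Real.sin ((3 : ℕ) * Real.pi / (7 : ℕ)) = Real.cos (Real.pi / 14) := by
      rw [← Real.cos_pi_div_two_sub]; congr 1; push_cast; ring
    have h2 := two_div_sub_anti (sin_natCast_mul_pi_div_pos (k := 2) (N := 7) (by norm_num)
      (by norm_num)) (e2.le.trans (hc _ (3 * 3.1415 / 14) (by norm_num) (by linarith) (by linarith)))
    have h3 := two_div_sub_anti (sin_natCast_mul_pi_div_pos (k := 3) (N := 7) (by norm_num)
      (by norm_num)) (e3.le.trans (hc _ (3.1415 / 14) (by norm_num) (by linarith) (by linarith)))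
    have h4 : (4.4562 : ℝ) ≤ 2 * (7 : ℕ) / Real.pi * (1 / (1 : ℕ)) := by
      push_cast
      rw [div_one, mul_one, le_div_iff₀ Real.pi_pos]
      linarith
    have h5 : 2 * Real.pi / (3 * (7 : ℕ)) * (1 : ℕ) ≤ 0.2993 := by
      push_cast; linarith
    norm_num at h1 h2 h3 h4 h5 ⊢
    linarith
  · have h2 := hb 2 (by norm_num) (by norm_num)
    have h3 := hb 3 (by norm_num) (by norm_num)
    have h8' : (8 : ℝ) ≤ N := by exact_mod_cast h8
    -- Here `11/6 = 1 + 1/2 + 1/3` and `6 = 1 + 2 + 3`; the `7` on the left accounts for the middle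
    -- terms of `le_chordSum`.
    have h5 : (N : ℝ) + 7 < 2 * (2 * N / Real.pi * (11 / 6) - 2 * Real.pi / (3 * N) * 6) := by
      have h6 : 2 * Real.pi / (3 * N) * 6 ≤ 1.571 := by
        rw [div_mul_eq_mul_div, div_le_iff₀ (by positivity)]
        nlinarith
      have h7 : 1.167 * (N : ℝ) ≤ 2 * N / Real.pi * (11 / 6) := by
        rw [div_mul_eq_mul_div, le_div_iff₀ Real.pi_pos]
        nlinarith
      linarith
    push_cast at h1 h2 h3 ⊢
    linarith

theorem hallKernel_two_mul {y : ℝ} (h : 0 ≤ Real.sin y) :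
    hallKernel (2 * y) = (2 / Real.sin y ^ 3 - 1 / Real.sin y) / 8 := by
  rw [hallKernel, mul_div_cancel_left₀ y two_ne_zero, abs_of_nonneg h]

theorem hallKernel_two_mul_mul {y : ℝ} (h : 0 ≤ Real.sin y) :
    hallKernel (2 * y) * (1 - Real.cos (2 * y)) = 1 / 4 * (2 / Real.sin y - Real.sin y) := by
  rw [hallKernel_two_mul h, Real.cos_two_mul, Real.cos_sq']
  rcases h.eq_or_lt with h0 | h0
  · rw [← h0]; simp
  · field_simp; ring

theorem sin_nonneg_of_le {k N : ℕ} (h : k ≤ N) : 0 ≤ Real.sin (k * Real.pi / N) := by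
  rcases Nat.eq_zero_or_pos N with rfl | hN
  · simp
  have hN' : (0 : ℝ) < N := by exact_mod_cast hN
  refine Real.sin_nonneg_of_nonneg_of_le_pi (by positivity) ?_
  rw [div_le_iff₀ hN', mul_comm]
  exact mul_le_mul_of_nonneg_left (by exact_mod_cast h) Real.pi_pos.le

theorem ngonAngle_eq_two_mul (j k : ℕ) : ngonAngle j k = 2 * (k * Real.pi / (2 * j : ℕ)) := by
  simp only [ngonAngle]; push_cast; ring

theorem kernelSumEven_eq {j : ℕ} (hj : j ≠ 0) : kernelSumEven j = chordSum j / 4 := by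
  rw [kernelSumEven, chordSum, div_eq_inv_mul, Finset.mul_sum]
  refine Finset.sum_congr rfl fun d hd => ?_
  rw [Finset.mem_range] at hd
  have hj' : (j : ℝ) ≠ 0 := by exact_mod_cast hj
  have e : ngonAngle j (2 * d) = 2 * (d * Real.pi / j) := by
    simp only [ngonAngle]; push_cast; field_simp
  rw [e, hallKernel_two_mul_mul (sin_nonneg_of_le hd.le)]
  ring

theorem kernelSumOdd_sub {j : ℕ} : kernelSumOdd j - kernelSumOddCos j =
    1 / 4 * ∑ d ∈ Finset.range j, (2 / Real.sin ((2 * d + 1 : ℕ) * Real.pi / (2 * j : ℕ)) -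
      Real.sin ((2 * d + 1 : ℕ) * Real.pi / (2 * j : ℕ))) := by
  rw [kernelSumOdd, kernelSumOddCos, ← Finset.sum_sub_distrib, Finset.mul_sum]
  refine Finset.sum_congr rfl fun d hd => ?_
  rw [Finset.mem_range] at hd
  have := ngonAngle_eq_two_mul j (2 * d + 1)
  have e : ((2 * d + 1 : ℕ) : ℤ) = 2 * (d : ℤ) + 1 := by push_cast; ring
  rw [e] at this
  rw [this, ← hallKernel_two_mul_mul (sin_nonneg_of_le (by omega))]
  ring

theorem kernelSumOdd_eq {j : ℕ} : kernelSumOdd j =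
    1 / 8 * ∑ d ∈ Finset.range j, (2 / Real.sin ((2 * d + 1 : ℕ) * Real.pi / (2 * j : ℕ)) ^ 3 -
      1 / Real.sin ((2 * d + 1 : ℕ) * Real.pi / (2 * j : ℕ))) := by
  rw [kernelSumOdd, Finset.mul_sum]
  refine Finset.sum_congr rfl fun d hd => ?_
  rw [Finset.mem_range] at hd
  have := ngonAngle_eq_two_mul j (2 * d + 1)
  have e : ((2 * d + 1 : ℕ) : ℤ) = 2 * (d : ℤ) + 1 := by push_cast; ring
  rw [e] at this
  rw [this, hallKernel_two_mul (sin_nonneg_of_le (by omega))]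
  ring

/-- Split the chords of the `2j`-gon into those of the `j`-gon and those joining the two `j`-gons.
-/
theorem chordSum_two_mul {j : ℕ} (hj : j ≠ 0) :
    chordSum (2 * j) / 4 = kernelSumEven j + (kernelSumOdd j - kernelSumOddCos j) := by
  have hj' : (j : ℝ) ≠ 0 := by exact_mod_cast hj
  rw [kernelSumEven_eq hj, kernelSumOdd_sub, chordSum, sum_range_two_mul j (fun k : ℕ =>
    2 / Real.sin (k * Real.pi / (2 * j : ℕ)) - Real.sin (k * Real.pi / (2 * j : ℕ))),
    Finset.sum_add_distrib, chordSum]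
  have e : ∀ d : ℕ, ((2 * d : ℕ) : ℝ) * Real.pi / (2 * j : ℕ) = d * Real.pi / j := fun d => by
    push_cast; field_simp
  simp only [e]
  ring

/-- Write `a² + b² = (a - b)² + 2ab`. The coefficient of `ab` becomes `(g₁ + g₂)² - g₃²`, and its
two factors are the displayed ones. -/
theorem chi_eq {j : ℕ} (hj : 3 ≤ j) (a b : ℝ) : chi a b j 2 =
    a * b * ((chordSum (2 * j) / 4 - j) * (kernelSumEven j + kernelSumOdd j + kernelSumOddCos j)) +
      (a - b) ^ 2 * ((chordSum j / 4 - j / 2) * kernelSumOdd j) := by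
  rw [chordSum_two_mul (by omega), ← kernelSumEven_eq (by omega), chi, g₁_eq hj, g₂_eq (by omega),
    g₃_eq hj]
  ring

theorem kernelSum_pos {j : ℕ} (hj : 2 ≤ j) :
    0 < kernelSumEven j + kernelSumOdd j + kernelSumOddCos j := by
  have h1 := kernelSumEven_pos hj
  have h2 := abs_le.1 (abs_kernelSumOddCos_le j)
  linarith

theorem chi_pos_of_seven_le {j : ℕ} (hj : 7 ≤ j) {a b : ℝ} (ha : 0 < a) (hb : 0 < b) :
    0 < chi a b j 2 := by
  rw [chi_eq (by omega)]
  have h1 := chordSum_gt hj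
  have h2 := chordSum_gt (N := 2 * j) (by omega)
  have h3 := kernelSum_pos (j := j) (by omega)
  have h4 := kernelSumOdd_pos (j := j) (by omega)
  push_cast at h2
  refine add_pos_of_pos_of_nonneg (mul_pos (mul_pos ha hb) (mul_pos (by linarith) h3))
    (mul_nonneg (sq_nonneg _) (mul_nonneg (by linarith) h4.le))

/-- Both brackets in `chi_eq` are nonpositive, as `chordSum 3 ≤ 6` and `chordSum 6 ≤ 12`. -/
theorem chi_three_nonpos {a b : ℝ} (ha : 0 < a) (hb : 0 < b) : chi a b 3 2 ≤ 0 := by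
  rw [chi_eq le_rfl]
  have h3 := kernelSum_pos (j := 3) (by norm_num)
  have h4 := kernelSumOdd_pos (j := 3) (by norm_num)
  have hs : (2 : ℝ) * Real.pi / 3 = Real.pi - Real.pi / 3 := by ring
  have hs3 : (1.7 : ℝ) ≤ √3 := Real.le_sqrt_of_sq_le (by norm_num)
  have hinv : 2 / Real.sin (Real.pi / 3) - Real.sin (Real.pi / 3) ≤ 1.55 := by
    refine (two_div_sub_anti (s := 0.85) (by norm_num) ?_).trans (by norm_num)
    rw [Real.sin_pi_div_three]; linarith
  have h1 : chordSum 3 ≤ 6 := by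
    rw [chordSum, Finset.sum_range_succ, Finset.sum_range_succ, Finset.sum_range_succ]
    norm_num [hs, Real.sin_pi_sub]
    norm_num at hinv
    linarith
  have h2 : chordSum 6 ≤ 12 := by
    have e2 : (2 : ℝ) * Real.pi / 6 = Real.pi / 3 := by ring
    have e3 : (3 : ℝ) * Real.pi / 6 = Real.pi / 2 := by ring
    have e4 : (4 : ℝ) * Real.pi / 6 = Real.pi - Real.pi / 3 := by ring
    have e5 : (5 : ℝ) * Real.pi / 6 = Real.pi - Real.pi / 6 := by ring
    rw [chordSum]
    simp only [Finset.sum_range_succ, Finset.sum_range_zero]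
    norm_num [e2, e3, e4, e5, Real.sin_pi_sub]
    norm_num at hinv
    linarith
  have h5 : a * b * ((chordSum (2 * 3) / 4 - (3 : ℕ)) *
      (kernelSumEven 3 + kernelSumOdd 3 + kernelSumOddCos 3)) ≤ 0 := by
    refine mul_nonpos_of_nonneg_of_nonpos (mul_pos ha hb).le
      (mul_nonpos_of_nonpos_of_nonneg ?_ h3.le)
    norm_num; linarith
  have h6 : (a - b) ^ 2 * ((chordSum 3 / 4 - (3 : ℕ) / 2) * kernelSumOdd 3) ≤ 0 := by
    refine mul_nonpos_of_nonneg_of_nonpos (sq_nonneg _) (mul_nonpos_of_nonpos_of_nonneg ?_ h4.le)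
    norm_num; linarith
  exact add_nonpos h5 h6

/-- Testing the form on the antisymmetric displacement of each opposite pair gives `7a/8 < bF` and
`7b/8 < aF` with `F = hallF (π/2)`. Their sum contradicts `F < 7/8`. -/
theorem not_posSemidef_and_isNondegenerate_square {a b : ℝ} (ha : 0 < a) (hb : 0 < b) :
    ¬ ((hallHessian (alternatingMasses (2 * 2) a b) (ngonAngles (2 * 2))).PosSemidef ∧
      IsNondegenerate (alternatingMasses (2 * 2) a b) (ngonAngles (2 * 2))) := by
  rintro ⟨hP, hN⟩
  have hS : Separated (ngonAngles (2 * 2)) := separated_ngonAngles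
  have hne : ∀ k : Fin 4, ∀ v : Fin 4 → ℝ, v k = 1 → v ≠ 0 := fun k v hv h => by
    rw [h] at hv; exact zero_ne_one hv
  have h1 := pos_of_posSemidef hP hN (v := ![1, 0, -1, 0]) (hne 0 _ rfl)
    (by norm_num [Fin.sum_univ_succ])
  have h2 := pos_of_posSemidef hP hN (v := ![0, 1, 0, -1]) (hne 1 _ rfl)
    (by norm_num [Fin.sum_univ_succ])
  rw [hallHessian_form hS] at h1 h2
  have hθ : (ngonAngles (2 * 2) : Fin 4 → ℝ) = ![0, Real.pi / 2, Real.pi, 3 * Real.pi / 2] := by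
    funext k
    fin_cases k <;> simp [ngonAngles] <;> ring
  have hm : (alternatingMasses (2 * 2) a b : Fin 4 → ℝ) = ![a, b, a, b] := by
    funext k
    fin_cases k <;> simp [alternatingMasses]
    norm_num [Nat.even_iff]
  have fpi : hallF Real.pi = -7 / 8 := by
    rw [hallF, Real.sin_pi_div_two, Real.cos_pi]; norm_num
  have fpi' : hallF (-Real.pi) = -7 / 8 := by rw [hallF_neg, fpi]
  have fh : hallF (-(Real.pi / 2)) = hallF (Real.pi / 2) := hallF_neg _
  have f3 : hallF (3 * Real.pi / 2) = hallF (Real.pi / 2) := by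
    rw [hallF_eq, hallF_eq, show 3 * Real.pi / 2 = -(Real.pi / 2) + 2 * Real.pi by ring,
      hallKernel_add_two_pi, hallKernel_neg, Real.cos_add_two_pi, Real.cos_neg]
  have f3' : hallF (-(3 * Real.pi / 2)) = hallF (Real.pi / 2) := by rw [hallF_neg, f3]
  have fle : hallF (Real.pi / 2) < 7 / 8 := by
    have h2 : (1.4 : ℝ) ≤ √2 := Real.le_sqrt_of_sq_le (by norm_num)
    have h3 : (√2) ^ 2 = 2 := Real.sq_sqrt (by norm_num)
    have h4 : √2 ≤ 1.5 := Real.sqrt_le_iff.2 ⟨by norm_num, by norm_num⟩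
    have e : hallF (Real.pi / 2) = 3 * √2 / 8 := by
      rw [hallF, show Real.pi / 2 / 2 = Real.pi / 4 by ring, Real.sin_pi_div_four,
        Real.cos_pi_div_two, abs_of_nonneg (by positivity), div_pow, h3]
      field_simp
      rw [h3]; norm_num
    rw [e]; linarith
  have e1 : Real.pi / 2 - Real.pi = -(Real.pi / 2) := by ring
  have e2 : Real.pi / 2 - 3 * Real.pi / 2 = -Real.pi := by ring
  have e3 : Real.pi - Real.pi / 2 = Real.pi / 2 := by ring
  have e4 : Real.pi - 3 * Real.pi / 2 = -(Real.pi / 2) := by ring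
  have e5 : 3 * Real.pi / 2 - Real.pi / 2 = Real.pi := by ring
  have e6 : 3 * Real.pi / 2 - Real.pi = Real.pi / 2 := by ring
  change 0 < 1 / 2 * ∑ i : Fin 4, ∑ k : Fin 4, _ at h1 h2
  rw [hθ, hm] at h1 h2
  simp [Fin.sum_univ_four, e1, e2, e3, e4, e5, e6, fpi, fpi', fh, f3, f3'] at h1 h2
  set F := hallF (Real.pi / 2)
  have h3 : a * (7 / 8) < b * F := by nlinarith
  have h4 : b * (7 / 8) < a * F := by nlinarith
  nlinarith

end HallRing

/-! ### The roots of `χ`, and closed forms of the coefficients for `j = 4, 5, 6`. -/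

namespace HallRing

theorem mul_polynomial_eq {g h ρ : ℝ} (hg : g < 0) (h0 : 0 ≤ h ^ 2 - 4 * g ^ 2) :
    g * (ρ - (-h + √(h ^ 2 - 4 * g ^ 2)) / (2 * g)) * (ρ - (-h - √(h ^ 2 - 4 * g ^ 2)) / (2 * g)) =
      g * (ρ ^ 2 + 1) + h * ρ := by
  have hs := Real.sq_sqrt h0
  generalize √(h ^ 2 - 4 * g ^ 2) = r at hs
  have := hg.ne
  field_simp
  linear_combination (-1) * hs

variable {j : ℕ}

theorem ratioLower_eq (j : ℕ) : ratioLower j =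
    (-h₅ j + √(h₅ j ^ 2 - 4 * (g₁ j 2 * g₂ j) ^ 2)) / (2 * (g₁ j 2 * g₂ j)) := by
  rw [ratioLower, h₄, mul_assoc]

theorem ratioUpper_eq (j : ℕ) : ratioUpper j =
    (-h₅ j - √(h₅ j ^ 2 - 4 * (g₁ j 2 * g₂ j) ^ 2)) / (2 * (g₁ j 2 * g₂ j)) := by
  rw [ratioUpper, h₄, mul_assoc]

/-- The quadratic polynomial whose roots are the critical mass ratios. -/
noncomputable def ratioPoly (j : ℕ) (ρ : ℝ) : ℝ := g₁ j 2 * g₂ j * (ρ ^ 2 + 1) + h₅ j * ρ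

theorem chi_eq_ratioPoly (a : ℝ) {b : ℝ} (hb : 0 < b) : chi a b j 2 = b ^ 2 * ratioPoly j (a / b) := by
  rw [chi, ratioPoly, h₅]
  field_simp
  ring

/-- `h₄` factors as a difference of squares. The hypothesis `hd` says that `ratioPoly` is positive
at ratio one, the case of equal masses. -/
theorem h₄_pos (hg : g₁ j 2 * g₂ j < 0) (hd : 0 < h₅ j + 2 * (g₁ j 2 * g₂ j)) : 0 < h₄ j := by
  have : h₄ j = (h₅ j + 2 * (g₁ j 2 * g₂ j)) * (h₅ j - 2 * (g₁ j 2 * g₂ j)) := by rw [h₄]; ring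
  rw [this]
  exact mul_pos hd (by linarith)

theorem ratioPoly_eq (hg : g₁ j 2 * g₂ j < 0) (hd : 0 < h₅ j + 2 * (g₁ j 2 * g₂ j)) (ρ : ℝ) :
    ratioPoly j ρ = g₁ j 2 * g₂ j * (ρ - ratioLower j) * (ρ - ratioUpper j) := by
  rw [ratioPoly, ratioLower_eq, ratioUpper_eq, mul_polynomial_eq hg (h₄_pos hg hd).le]

/-- The denominator is negative, so the root with the plus sign is the smaller one. -/
theorem ratioLower_lt_ratioUpper (hg : g₁ j 2 * g₂ j < 0)
    (hd : 0 < h₅ j + 2 * (g₁ j 2 * g₂ j)) : ratioLower j < ratioUpper j := by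
  have := Real.sqrt_pos.2 (h₄_pos hg hd)
  rw [ratioLower, ratioUpper, mul_assoc]
  exact (div_lt_div_right_of_neg (by linarith)).2 (by linarith)

theorem ratioPoly_pos_iff (hg : g₁ j 2 * g₂ j < 0) (hd : 0 < h₅ j + 2 * (g₁ j 2 * g₂ j)) (ρ : ℝ) :
    0 < ratioPoly j ρ ↔ ρ ∈ Set.Ioo (ratioLower j) (ratioUpper j) := by
  have hlt := ratioLower_lt_ratioUpper hg hd
  rw [ratioPoly_eq hg hd, mul_assoc, Set.mem_Ioo]
  constructor
  · intro h
    have h' : (ρ - ratioLower j) * (ρ - ratioUpper j) < 0 := by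
      rcases mul_pos_iff.1 h with h | h
      · exact absurd h.1 hg.not_gt
      · exact h.2
    rcases mul_neg_iff.1 h' with h | h
    · exact ⟨by linarith, by linarith⟩
    · linarith
  · exact fun h => mul_pos_of_neg_of_neg hg (mul_neg_of_pos_of_neg (by linarith) (by linarith))

theorem chi_eq_zero_iff (hg : g₁ j 2 * g₂ j < 0) (hd : 0 < h₅ j + 2 * (g₁ j 2 * g₂ j)) (a : ℝ) {b : ℝ}
    (hb : 0 < b) : chi a b j 2 = 0 ↔ a / b = ratioLower j ∨ a / b = ratioUpper j := by
  rw [chi_eq_ratioPoly a hb, ratioPoly_eq hg hd, mul_eq_zero, mul_eq_zero, mul_eq_zero,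
    or_iff_right (pow_pos hb 2).ne', or_iff_right hg.ne, sub_eq_zero, sub_eq_zero]

theorem chi_pos_iff (hg : g₁ j 2 * g₂ j < 0) (hd : 0 < h₅ j + 2 * (g₁ j 2 * g₂ j)) (a : ℝ) {b : ℝ}
    (hb : 0 < b) : 0 < chi a b j 2 ↔ a / b ∈ Set.Ioo (ratioLower j) (ratioUpper j) := by
  rw [chi_eq_ratioPoly a hb, mul_pos_iff_of_pos_left (pow_pos hb 2), ratioPoly_pos_iff hg hd]

/-- Sign changes of `ratioPoly` enclose its roots. -/
theorem abs_ratio_sub_lt (hg : g₁ j 2 * g₂ j < 0) (hd : 0 < h₅ j + 2 * (g₁ j 2 * g₂ j))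
    {c d δ : ℝ} (hδ : 0 < δ) (h1 : ratioPoly j (c - δ) < 0) (h2 : 0 < ratioPoly j (c + δ))
    (h3 : 0 < ratioPoly j (d - δ)) (h4 : ratioPoly j (d + δ) < 0) :
    |ratioLower j - c| < δ ∧ |ratioUpper j - d| < δ := by
  rw [ratioPoly_pos_iff hg hd] at h2 h3
  have h1' : c - δ < ratioLower j := by
    by_contra! hc
    rw [ratioPoly_eq hg hd] at h1
    have := mul_nonneg_of_nonpos_of_nonpos (mul_nonpos_of_nonpos_of_nonneg hg.le (sub_nonneg.2 hc))
      (by linarith [h2.2] : c - δ - ratioUpper j ≤ 0)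
    linarith
  have h4' : ratioUpper j < d + δ := by
    by_contra! hc
    rw [ratioPoly_eq hg hd] at h4
    have := mul_nonneg_of_nonpos_of_nonpos (mul_nonpos_of_nonpos_of_nonneg hg.le
      (by linarith [h3.1] : 0 ≤ d + δ - ratioLower j)) (sub_nonpos.2 hc)
    linarith
  rw [abs_lt, abs_lt]
  exact ⟨⟨by linarith, by linarith [h2.1]⟩, by linarith [h3.2], by linarith⟩

/-- Enclosures of the three coefficients. -/
structure CoeffBounds (j : ℕ) (l₁ u₁ l₂ u₂ l₃ u₃ : ℝ) : Prop where
  le₁ : l₁ ≤ g₁ j 2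
  ge₁ : g₁ j 2 ≤ u₁
  le₂ : l₂ ≤ g₂ j
  ge₂ : g₂ j ≤ u₂
  le₃ : l₃ ≤ g₃ j 2
  ge₃ : g₃ j 2 ≤ u₃
  neg : u₁ < 0
  pos₂ : 0 < l₂
  pos₃ : 0 < l₃

namespace CoeffBounds

variable {l₁ u₁ l₂ u₂ l₃ u₃ : ℝ}

theorem mul_neg (h : CoeffBounds j l₁ u₁ l₂ u₂ l₃ u₃) : g₁ j 2 * g₂ j < 0 :=
  mul_neg_of_neg_of_pos (h.ge₁.trans_lt h.neg) (h.pos₂.trans_le h.le₂)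

theorem mul_bounds (h : CoeffBounds j l₁ u₁ l₂ u₂ l₃ u₃) :
    l₁ * u₂ ≤ g₁ j 2 * g₂ j ∧ g₁ j 2 * g₂ j ≤ u₁ * l₂ := by
  have h1 := h.ge₁.trans_lt h.neg
  have h2 := h.pos₂.trans_le h.le₂
  have h3 := h.le₁.trans_lt h1
  constructor
  · nlinarith [h.le₁, h.ge₂]
  · nlinarith [h.ge₁, h.le₂, h.neg]

theorem h₅_bounds (h : CoeffBounds j l₁ u₁ l₂ u₂ l₃ u₃) :
    u₁ ^ 2 + l₂ ^ 2 - u₃ ^ 2 ≤ h₅ j ∧ h₅ j ≤ l₁ ^ 2 + u₂ ^ 2 - l₃ ^ 2 := by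
  have h1 := pow_le_pow_left₀ h.pos₂.le h.le₂ 2
  have h2 := pow_le_pow_left₀ (h.pos₂.le.trans h.le₂) h.ge₂ 2
  have h3 := pow_le_pow_left₀ h.pos₃.le h.le₃ 2
  have h4 := pow_le_pow_left₀ (h.pos₃.le.trans h.le₃) h.ge₃ 2
  -- `g₁` is negative, so its endpoints exchange roles under squaring.
  have h5 := pow_le_pow_left₀ (neg_pos.2 h.neg).le (neg_le_neg h.ge₁) 2
  have h6 := pow_le_pow_left₀ (neg_pos.2 (h.ge₁.trans_lt h.neg)).le (neg_le_neg h.le₁) 2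
  simp only [neg_sq] at h5 h6
  rw [h₅]
  constructor <;> linarith

theorem ratioPoly_pos (h : CoeffBounds j l₁ u₁ l₂ u₂ l₃ u₃)
    {ρ : ℝ} (hρ : 0 ≤ ρ)
    (hp : 0 < l₁ * u₂ * (ρ ^ 2 + 1) + (u₁ ^ 2 + l₂ ^ 2 - u₃ ^ 2) * ρ) : 0 < ratioPoly j ρ := by
  have h1 := mul_le_mul_of_nonneg_right h.mul_bounds.1 (by positivity : 0 ≤ ρ ^ 2 + 1)
  have h2 := mul_le_mul_of_nonneg_right h.h₅_bounds.1 hρ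
  rw [ratioPoly]
  linarith

theorem ratioPoly_neg (h : CoeffBounds j l₁ u₁ l₂ u₂ l₃ u₃)
    {ρ : ℝ} (hρ : 0 ≤ ρ)
    (hp : u₁ * l₂ * (ρ ^ 2 + 1) + (l₁ ^ 2 + u₂ ^ 2 - l₃ ^ 2) * ρ < 0) : ratioPoly j ρ < 0 := by
  have h1 := mul_le_mul_of_nonneg_right h.mul_bounds.2 (by positivity : 0 ≤ ρ ^ 2 + 1)
  have h2 := mul_le_mul_of_nonneg_right h.h₅_bounds.2 hρ
  rw [ratioPoly]
  linarith

end CoeffBounds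

theorem g₁_eq_chordSum (hj : 3 ≤ j) : g₁ j 2 = chordSum j / 4 - j / 2 := by
  rw [g₁_eq hj, kernelSumEven_eq (by omega)]

theorem g₃_eq_sub (hj : 3 ≤ j) :
    g₃ j 2 = kernelSumOdd j - (kernelSumOdd j - kernelSumOddCos j) + j / 2 := by
  rw [g₃_eq hj]; ring

theorem chordSum_four : chordSum 4 = 3 * √2 + 1 := by
  have h2 : √2 ^ 2 = 2 := Real.sq_sqrt (by norm_num)
  have e2 : (2 : ℝ) * Real.pi / 4 = Real.pi / 2 := by ring
  have e3 : (3 : ℝ) * Real.pi / 4 = Real.pi - Real.pi / 4 := by ring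
  rw [chordSum]
  simp only [Finset.sum_range_succ, Finset.sum_range_zero]
  norm_num [e2, e3, Real.sin_pi_sub]
  field_simp
  linarith

theorem coeff_four : g₁ 4 2 = (3 * √2 + 1) / 4 - 2 ∧
    g₂ 4 = Real.cos (Real.pi / 8) * (15 - 4 * √2) ∧
    g₃ 4 2 = Real.cos (Real.pi / 8) * (11 - 7 / 2 * √2) + 2 := by
  have h4 : √2 ^ 2 = 2 := Real.sq_sqrt (by norm_num)
  have hc0 : Real.cos (Real.pi / 8) ≠ 0 := by
    rw [Real.cos_pi_div_eight]; positivity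
  have hc : Real.cos (Real.pi / 8) ^ 2 = (2 + √2) / 4 := by
    rw [Real.cos_pi_div_eight, div_pow, Real.sq_sqrt (by positivity)]; norm_num
  have hsc : 2 * Real.sin (Real.pi / 8) * Real.cos (Real.pi / 8) = √2 / 2 := by
    rw [← Real.sin_two_mul, ← Real.sin_pi_div_four]; congr 1; ring
  have v0 : Real.sin ((2 * 0 + 1 : ℕ) * Real.pi / (2 * 4 : ℕ)) = Real.sin (Real.pi / 8) := by
    congr 1; push_cast; ring
  have v1 : Real.sin ((2 * 1 + 1 : ℕ) * Real.pi / (2 * 4 : ℕ)) = Real.cos (Real.pi / 8) := by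
    rw [← Real.cos_pi_div_two_sub]; congr 1; push_cast; ring
  have v2 : Real.sin ((2 * 2 + 1 : ℕ) * Real.pi / (2 * 4 : ℕ)) = Real.cos (Real.pi / 8) := by
    rw [← v1, ← Real.sin_pi_sub]; congr 1; push_cast; ring
  have v3 : Real.sin ((2 * 3 + 1 : ℕ) * Real.pi / (2 * 4 : ℕ)) = Real.sin (Real.pi / 8) := by
    rw [← Real.sin_pi_sub]; congr 1; push_cast; ring
  set s := Real.sin (Real.pi / 8)
  set c := Real.cos (Real.pi / 8)
  -- With `s` and both inverses expressed as multiples of `c`, the sums become `c` times an element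
  -- of `ℚ(√2)`.
  have hs : s = (√2 - 1) * c := by
    refine mul_right_cancel₀ hc0 ?_
    linear_combination hsc / 2 + (1 - √2) * hc - h4 / 4
  have is : s⁻¹ = 2 * √2 * c := inv_eq_of_mul_eq_one_right (by
    linear_combination √2 * hsc + h4 / 2)
  have ic : c⁻¹ = (4 - 2 * √2) * c := inv_eq_of_mul_eq_one_right (by
    linear_combination (4 - 2 * √2) * hc - h4 / 2)
  have hO : kernelSumOdd 4 = c * (15 - 4 * √2) := by
    rw [kernelSumOdd_eq]
    simp only [Finset.sum_range_succ, Finset.sum_range_zero, v0, v1, v2, v3,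
      div_eq_mul_inv (2 : ℝ), one_div s, one_div c, ← inv_pow, is, ic]
    have e : c ^ 3 = c * (2 + √2) / 4 := by linear_combination c * hc
    linear_combination ((16 * √2 ^ 3 + 2 * (4 - 2 * √2) ^ 3) / 4) * e + 6 * √2 * c * h4
  have hQ : kernelSumOdd 4 - kernelSumOddCos 4 = c * (4 - √2 / 2) := by
    rw [kernelSumOdd_sub]
    simp only [Finset.sum_range_succ, Finset.sum_range_zero, v0, v1, v2, v3,
      div_eq_mul_inv (2 : ℝ), is, ic]
    rw [hs]
    ring
  refine ⟨?_, ?_, ?_⟩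
  · rw [g₁_eq_chordSum (by norm_num), chordSum_four]; norm_num
  · rw [g₂_eq (by norm_num), hO]
  · rw [g₃_eq_sub (by norm_num), hQ, hO]; push_cast; ring

theorem chordSum_five : chordSum 5 = 2 * ((Real.sin (Real.pi / 5) + Real.sin (2 * Real.pi / 5)) *
    (8 / 5 * √5 - 1)) := by
  have h5 : √5 ^ 2 = 5 := Real.sq_sqrt (by norm_num)
  have e3 : (3 : ℝ) * Real.pi / 5 = Real.pi - 2 * Real.pi / 5 := by ring
  have e4 : (4 : ℝ) * Real.pi / 5 = Real.pi - Real.pi / 5 := by ring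
  have hb : Real.sin (2 * Real.pi / 5) = 2 * Real.sin (Real.pi / 5) * Real.cos (Real.pi / 5) := by
    rw [← Real.sin_two_mul]; congr 1; ring
  have ha := Real.sin_sq_add_cos_sq (Real.pi / 5)
  rw [Real.cos_pi_div_five] at hb ha
  -- The product of the two sines turns each reciprocal into a multiple of the other sine.
  have hab : Real.sin (Real.pi / 5) * Real.sin (2 * Real.pi / 5) = √5 / 4 := by
    rw [hb]
    linear_combination (1 + √5) / 2 * ha - (√5 + 3) / 32 * h5
  have ia : (Real.sin (Real.pi / 5))⁻¹ = 4 / 5 * √5 * Real.sin (2 * Real.pi / 5) :=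
    inv_eq_of_mul_eq_one_right (by linear_combination 4 / 5 * √5 * hab + h5 / 5)
  have ib : (Real.sin (2 * Real.pi / 5))⁻¹ = 4 / 5 * √5 * Real.sin (Real.pi / 5) :=
    inv_eq_of_mul_eq_one_right (by linear_combination 4 / 5 * √5 * hab + h5 / 5)
  rw [chordSum]
  simp only [Finset.sum_range_succ, Finset.sum_range_zero, div_eq_mul_inv (2 : ℝ)]
  norm_num [e3, e4, Real.sin_pi_sub, ia, ib]
  ring

theorem coeff_five : g₁ 5 2 = (Real.sin (Real.pi / 5) + Real.sin (2 * Real.pi / 5)) *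
      (4 / 5 * √5 - 1 / 2) - 5 / 2 ∧ g₂ 5 = (60 * √5 + 1) / 8 ∧
      g₃ 5 2 = (46 * √5 + 19) / 8 := by
  have h5 : √5 ^ 2 = 5 := Real.sq_sqrt (by norm_num)
  have hc2 : Real.cos (2 * Real.pi / 5) = (√5 - 1) / 4 := by
    rw [show 2 * Real.pi / 5 = 2 * (Real.pi / 5) by ring, Real.cos_two_mul, Real.cos_pi_div_five]
    linear_combination h5 / 8
  have v0 : Real.sin ((2 * 0 + 1 : ℕ) * Real.pi / (2 * 5 : ℕ)) = (√5 - 1) / 4 := by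
    rw [← hc2, ← Real.cos_pi_div_two_sub]; congr 1; push_cast; ring
  have v1 : Real.sin ((2 * 1 + 1 : ℕ) * Real.pi / (2 * 5 : ℕ)) = (1 + √5) / 4 := by
    rw [← Real.cos_pi_div_five, ← Real.cos_pi_div_two_sub]; congr 1; push_cast; ring
  have v2 : Real.sin ((2 * 2 + 1 : ℕ) * Real.pi / (2 * 5 : ℕ)) = 1 := by
    rw [← Real.sin_pi_div_two]; congr 1; push_cast; ring
  have v3 : Real.sin ((2 * 3 + 1 : ℕ) * Real.pi / (2 * 5 : ℕ)) = (1 + √5) / 4 := by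
    rw [← v1, ← Real.sin_pi_sub]; congr 1; push_cast; ring
  have v4 : Real.sin ((2 * 4 + 1 : ℕ) * Real.pi / (2 * 5 : ℕ)) = (√5 - 1) / 4 := by
    rw [← v0, ← Real.sin_pi_sub]; congr 1; push_cast; ring
  have i1 : ((√5 - 1) / 4)⁻¹ = √5 + 1 := inv_eq_of_mul_eq_one_right (by linear_combination h5 / 4)
  have i2 : ((1 + √5) / 4)⁻¹ = √5 - 1 := inv_eq_of_mul_eq_one_right (by linear_combination h5 / 4)
  have hO : kernelSumOdd 5 = (60 * √5 + 1) / 8 := by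
    rw [kernelSumOdd_eq]
    simp only [Finset.sum_range_succ, Finset.sum_range_zero, v0, v1, v2, v3, v4, div_eq_mul_inv (2 : ℝ),
      one_div (_ / _ : ℝ), ← inv_pow, i1, i2]
    norm_num
    linear_combination √5 * h5
  have hQ : kernelSumOdd 5 - kernelSumOddCos 5 = (7 * √5 + 1) / 4 := by
    rw [kernelSumOdd_sub]
    simp only [Finset.sum_range_succ, Finset.sum_range_zero, v0, v1, v2, v3, v4, div_eq_mul_inv (2 : ℝ),
      i1, i2]
    norm_num
    ring
  refine ⟨?_, ?_, ?_⟩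
  · rw [g₁_eq_chordSum (by norm_num), chordSum_five]; push_cast; ring
  · rw [g₂_eq (by norm_num), hO]
  · rw [g₃_eq_sub (by norm_num), hQ, hO]; push_cast; ring

theorem chordSum_six : chordSum 6 = 5 / 3 * √3 + 8 := by
  have h3 : √3 ^ 2 = 3 := Real.sq_sqrt (by norm_num)
  have e2 : (2 : ℝ) * Real.pi / 6 = Real.pi / 3 := by ring
  have e3 : (3 : ℝ) * Real.pi / 6 = Real.pi / 2 := by ring
  have e4 : (4 : ℝ) * Real.pi / 6 = Real.pi - Real.pi / 3 := by ring
  have e5 : (5 : ℝ) * Real.pi / 6 = Real.pi - Real.pi / 6 := by ring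
  rw [chordSum]
  simp only [Finset.sum_range_succ, Finset.sum_range_zero]
  norm_num [e2, e3, e4, e5, Real.sin_pi_sub]
  field_simp
  linarith

theorem coeff_six : g₁ 6 2 = 5 / 12 * √3 - 1 ∧ g₂ 6 = (46 * √6 + 3 * √2) / 4 ∧
    g₃ 6 2 = 39 / 4 * √6 + 3 := by
  have h2 : √2 ^ 2 = 2 := Real.sq_sqrt (by norm_num)
  have h3 : √3 ^ 2 = 3 := Real.sq_sqrt (by norm_num)
  have h6 : √6 = √2 * √3 := by
    rw [← Real.sqrt_mul (by norm_num)]; norm_num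
  have v0 : Real.sin ((2 * 0 + 1 : ℕ) * Real.pi / (2 * 6 : ℕ)) = √2 * (√3 - 1) / 4 := by
    rw [show ((2 * 0 + 1 : ℕ) : ℝ) * Real.pi / (2 * 6 : ℕ) = Real.pi / 3 - Real.pi / 4 by push_cast; ring,
      Real.sin_sub, Real.sin_pi_div_three, Real.cos_pi_div_four, Real.cos_pi_div_three,
      Real.sin_pi_div_four]
    ring
  have v1 : Real.sin ((2 * 1 + 1 : ℕ) * Real.pi / (2 * 6 : ℕ)) = √2 / 2 := by
    rw [← Real.sin_pi_div_four]; congr 1; push_cast; ring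
  have v2 : Real.sin ((2 * 2 + 1 : ℕ) * Real.pi / (2 * 6 : ℕ)) = √2 * (√3 + 1) / 4 := by
    rw [show ((2 * 2 + 1 : ℕ) : ℝ) * Real.pi / (2 * 6 : ℕ) = Real.pi / 4 + Real.pi / 6 by push_cast; ring,
      Real.sin_add, Real.sin_pi_div_six, Real.cos_pi_div_four, Real.cos_pi_div_six,
      Real.sin_pi_div_four]
    ring
  have v3 : Real.sin ((2 * 3 + 1 : ℕ) * Real.pi / (2 * 6 : ℕ)) = √2 * (√3 + 1) / 4 := by
    rw [← v2, ← Real.sin_pi_sub]; congr 1; push_cast; ring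
  have v4 : Real.sin ((2 * 4 + 1 : ℕ) * Real.pi / (2 * 6 : ℕ)) = √2 / 2 := by
    rw [← v1, ← Real.sin_pi_sub]; congr 1; push_cast; ring
  have v5 : Real.sin ((2 * 5 + 1 : ℕ) * Real.pi / (2 * 6 : ℕ)) = √2 * (√3 - 1) / 4 := by
    rw [← v0, ← Real.sin_pi_sub]; congr 1; push_cast; ring
  have i0 : (√2 * (√3 - 1) / 4)⁻¹ = √2 * (√3 + 1) := inv_eq_of_mul_eq_one_right (by
    linear_combination (√3 ^ 2 - 1) / 4 * h2 + h3 / 2)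
  have i1 : (√2 / 2)⁻¹ = √2 := inv_eq_of_mul_eq_one_right (by linear_combination h2 / 2)
  have i2 : (√2 * (√3 + 1) / 4)⁻¹ = √2 * (√3 - 1) := inv_eq_of_mul_eq_one_right (by
    linear_combination (√3 ^ 2 - 1) / 4 * h2 + h3 / 2)
  have hO : kernelSumOdd 6 = (46 * √6 + 3 * √2) / 4 := by
    rw [kernelSumOdd_eq]
    simp only [Finset.sum_range_succ, Finset.sum_range_zero, v0, v1, v2, v3, v4, v5,
      div_eq_mul_inv (2 : ℝ), one_div (_ / _ : ℝ), ← inv_pow, i0, i1, i2]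
    rw [h6]
    have e : √2 ^ 3 = 2 * √2 := by linear_combination √2 * h2
    have e' : √3 ^ 3 = 3 * √3 := by linear_combination √3 * h3
    linear_combination (√3 ^ 3 + 3 * √3 + 1 / 2) * e + 2 * √2 * e'
  have hQ : kernelSumOdd 6 - kernelSumOddCos 6 = 7 / 4 * √6 + 3 / 4 * √2 := by
    rw [kernelSumOdd_sub]
    simp only [Finset.sum_range_succ, Finset.sum_range_zero, v0, v1, v2, v3, v4, v5,
      div_eq_mul_inv (2 : ℝ), i0, i1, i2]
    rw [h6]
    ring
  refine ⟨?_, ?_, ?_⟩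
  · rw [g₁_eq_chordSum (by norm_num), chordSum_six]; push_cast; ring
  · rw [g₂_eq (by norm_num), hO]
  · rw [g₃_eq_sub (by norm_num), hQ, hO]; push_cast; ring

end HallRing

/-! ### Numerical enclosures. -/

namespace HallRing

theorem sqrt_two_bounds : (1.414213562373095048 : ℝ) ≤ √2 ∧ √2 ≤ 1.414213562373095049 :=
  ⟨Real.le_sqrt_of_sq_le (by norm_num), Real.sqrt_le_iff.2 ⟨by norm_num, by norm_num⟩⟩

theorem sqrt_three_bounds : (1.732050807568877293 : ℝ) ≤ √3 ∧ √3 ≤ 1.732050807568877294 :=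
  ⟨Real.le_sqrt_of_sq_le (by norm_num), Real.sqrt_le_iff.2 ⟨by norm_num, by norm_num⟩⟩

theorem sqrt_five_bounds : (2.236067977499789696 : ℝ) ≤ √5 ∧ √5 ≤ 2.236067977499789697 :=
  ⟨Real.le_sqrt_of_sq_le (by norm_num), Real.sqrt_le_iff.2 ⟨by norm_num, by norm_num⟩⟩

theorem sqrt_six_bounds : (2.449489742783178098 : ℝ) ≤ √6 ∧ √6 ≤ 2.449489742783178099 :=
  ⟨Real.le_sqrt_of_sq_le (by norm_num), Real.sqrt_le_iff.2 ⟨by norm_num, by norm_num⟩⟩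

theorem cos_pi_div_eight_bounds :
    (0.923879532511286756 : ℝ) ≤ Real.cos (Real.pi / 8) ∧ Real.cos (Real.pi / 8) ≤ 0.923879532511286757 := by
  have h := sqrt_two_bounds
  rw [Real.cos_pi_div_eight, le_div_iff₀ two_pos, div_le_iff₀ two_pos]
  exact ⟨Real.le_sqrt_of_sq_le (by norm_num at h ⊢; linarith),
    Real.sqrt_le_iff.2 ⟨by norm_num, by norm_num at h ⊢; linarith⟩⟩

theorem sin_pi_div_five_add_bounds :
    (1.538841768587626701 : ℝ) ≤ Real.sin (Real.pi / 5) + Real.sin (2 * Real.pi / 5) ∧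
      Real.sin (Real.pi / 5) + Real.sin (2 * Real.pi / 5) ≤ 1.538841768587626702 := by
  have h := sqrt_five_bounds
  have h5 : √5 ^ 2 = 5 := Real.sq_sqrt (by norm_num)
  have hb : Real.sin (2 * Real.pi / 5) = 2 * Real.sin (Real.pi / 5) * Real.cos (Real.pi / 5) := by
    rw [← Real.sin_two_mul]; congr 1; ring
  have ha := Real.sin_sq_add_cos_sq (Real.pi / 5)
  have hpos : 0 ≤ Real.sin (Real.pi / 5) := Real.sin_nonneg_of_nonneg_of_le_pi (by positivity)
    (by linarith [Real.pi_pos])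
  rw [Real.cos_pi_div_five] at hb ha
  -- The square of the sum is `(5 + 2√5)/4`, so one enclosure of `√5` suffices.
  have hS : Real.sin (Real.pi / 5) + Real.sin (2 * Real.pi / 5) = √((5 + 2 * √5) / 4) := by
    rw [eq_comm, Real.sqrt_eq_iff_mul_self_eq (by positivity) (by rw [hb]; positivity), hb]
    linear_combination (√5 ^ 2 + 8 * √5 + 11) / 64 * h5 - (3 / 2 + √5 / 2) ^ 2 * ha
  rw [hS]
  exact ⟨Real.le_sqrt_of_sq_le (by norm_num at h ⊢; linarith),
    Real.sqrt_le_iff.2 ⟨by norm_num, by norm_num at h ⊢; linarith⟩⟩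

/-- Enclosures of width `10⁻¹⁶` determine the sign of `ratioPoly` at distance `10⁻¹³` from the
stated decimals. -/
theorem coeffBounds_four : CoeffBounds 4 (-0.6893398282201788) (-0.6893398282201787)
    8.6319411281637952 8.6319411281637953 7.5897044805568364 7.5897044805568365 := by
  obtain ⟨e1, e2, e3⟩ := coeff_four
  have h2 := sqrt_two_bounds
  have hc := cos_pi_div_eight_bounds
  refine ⟨?_, ?_, ?_, ?_, ?_, ?_, by norm_num, by norm_num, by norm_num⟩
  · rw [e1]; norm_num at h2 ⊢; linarith
  · rw [e1]; norm_num at h2 ⊢; linarith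
  · rw [e2]
    exact le_trans (by norm_num) (mul_le_mul hc.1 (sub_le_sub_left (mul_le_mul_of_nonneg_left h2.2
      (by norm_num : (0 : ℝ) ≤ 4)) 15) (by norm_num) (by linarith [hc.1]))
  · rw [e2]
    exact le_trans (mul_le_mul hc.2 (sub_le_sub_left (mul_le_mul_of_nonneg_left h2.1
      (by norm_num : (0 : ℝ) ≤ 4)) 15) (by linarith [h2.2]) (by norm_num)) (by norm_num)
  · rw [e3]
    refine le_trans ?_ (add_le_add_left (mul_le_mul hc.1 (sub_le_sub_left (mul_le_mul_of_nonneg_left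
      h2.2 (by norm_num : (0 : ℝ) ≤ 7 / 2)) 11) (by norm_num) (by linarith [hc.1])) 2)
    norm_num
  · rw [e3]
    refine le_trans (add_le_add_left (mul_le_mul hc.2 (sub_le_sub_left (mul_le_mul_of_nonneg_left
      h2.1 (by norm_num : (0 : ℝ) ≤ 7 / 2)) 11) (by linarith [h2.2]) (by norm_num)) 2) ?_
    norm_num

theorem coeffBounds_five : CoeffBounds 5 (-0.5166570433514663) (-0.5166570433514662)
    16.8955098312484227 16.8955098312484228 15.2323908706237907 15.2323908706237908 := by
  obtain ⟨e1, e2, e3⟩ := coeff_five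
  have h5 := sqrt_five_bounds
  have hS := sin_pi_div_five_add_bounds
  refine ⟨?_, ?_, ?_, ?_, ?_, ?_, by norm_num, by norm_num, by norm_num⟩
  · rw [e1]
    refine le_trans ?_ (sub_le_sub_right (mul_le_mul hS.1 (sub_le_sub_right
      (mul_le_mul_of_nonneg_left h5.1 (by norm_num : (0 : ℝ) ≤ 4 / 5)) (1 / 2)) (by norm_num)
      (by linarith [hS.1])) (5 / 2))
    norm_num
  · rw [e1]
    refine le_trans (sub_le_sub_right (mul_le_mul hS.2 (sub_le_sub_right
      (mul_le_mul_of_nonneg_left h5.2 (by norm_num : (0 : ℝ) ≤ 4 / 5)) (1 / 2))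
      (by linarith [h5.1]) (by norm_num)) (5 / 2)) ?_
    norm_num
  all_goals first | rw [e2] | rw [e3]
  all_goals norm_num at h5 ⊢
  all_goals linarith

theorem coeffBounds_six : CoeffBounds 6 (-0.2783121635129678) (-0.2783121635129677)
    29.2297922137863694 29.2297922137863695 26.8825249921359864 26.8825249921359865 := by
  obtain ⟨e1, e2, e3⟩ := coeff_six
  have h2 := sqrt_two_bounds
  have h3 := sqrt_three_bounds
  have h6 := sqrt_six_bounds
  norm_num at h2 h3 h6
  refine ⟨?_, ?_, ?_, ?_, ?_, ?_, by norm_num, by norm_num, by norm_num⟩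
  all_goals first | rw [e1] | rw [e2] | rw [e3]
  all_goals norm_num
  all_goals linarith

namespace CoeffBounds

variable {j : ℕ} {l₁ u₁ l₂ u₂ l₃ u₃ : ℝ}

theorem discriminant_pos (h : CoeffBounds j l₁ u₁ l₂ u₂ l₃ u₃)
    (hp : 0 < u₁ ^ 2 + l₂ ^ 2 - u₃ ^ 2 + 2 * (l₁ * u₂)) : 0 < h₅ j + 2 * (g₁ j 2 * g₂ j) := by
  have h1 := h.mul_bounds.1
  have h2 := h.h₅_bounds.1
  linarith

end CoeffBounds

theorem discriminant_pos_four : 0 < h₅ 4 + 2 * (g₁ 4 2 * g₂ 4) :=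
  coeffBounds_four.discriminant_pos (by norm_num)

theorem ratio_bounds_four : |ratioLower 4 - 0.39601454048825| < 1 / 10 ^ 13 ∧
    |ratioUpper 4 - 2.525159805412902| < 1 / 10 ^ 13 := by
  have h := coeffBounds_four
  exact abs_ratio_sub_lt h.mul_neg discriminant_pos_four (by norm_num)
    (h.ratioPoly_neg (by norm_num) (by norm_num)) (h.ratioPoly_pos (by norm_num) (by norm_num))
    (h.ratioPoly_pos (by norm_num) (by norm_num)) (h.ratioPoly_neg (by norm_num) (by norm_num))

theorem discriminant_pos_five : 0 < h₅ 5 + 2 * (g₁ 5 2 * g₂ 5) :=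
  coeffBounds_five.discriminant_pos (by norm_num)

theorem ratio_bounds_five : |ratioLower 5 - 0.16709497914366| < 1 / 10 ^ 13 ∧
    |ratioUpper 5 - 5.984620274797297| < 1 / 10 ^ 13 := by
  have h := coeffBounds_five
  exact abs_ratio_sub_lt h.mul_neg discriminant_pos_five (by norm_num)
    (h.ratioPoly_neg (by norm_num) (by norm_num)) (h.ratioPoly_pos (by norm_num) (by norm_num))
    (h.ratioPoly_pos (by norm_num) (by norm_num)) (h.ratioPoly_neg (by norm_num) (by norm_num))

theorem discriminant_pos_six : 0 < h₅ 6 + 2 * (g₁ 6 2 * g₂ 6) :=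
  coeffBounds_six.discriminant_pos (by norm_num)

theorem ratio_bounds_six : |ratioLower 6 - 0.061964963348688| < 1 / 10 ^ 13 ∧
    |ratioUpper 6 - 16.13815204525851| < 1 / 10 ^ 13 := by
  have h := coeffBounds_six
  exact abs_ratio_sub_lt h.mul_neg discriminant_pos_six (by norm_num)
    (h.ratioPoly_neg (by norm_num) (by norm_num)) (h.ratioPoly_pos (by norm_num) (by norm_num))
    (h.ratioPoly_pos (by norm_num) (by norm_num)) (h.ratioPoly_neg (by norm_num) (by norm_num))

/-- For `j = 4, 5, 6` the polynomial `ratioPoly` is concave and has two distinct roots. -/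
theorem mul_neg_and_discriminant_pos {j : ℕ} (hj : j = 4 ∨ j = 5 ∨ j = 6) :
    g₁ j 2 * g₂ j < 0 ∧ 0 < h₅ j + 2 * (g₁ j 2 * g₂ j) := by
  rcases hj with rfl | rfl | rfl
  · exact ⟨coeffBounds_four.mul_neg, discriminant_pos_four⟩
  · exact ⟨coeffBounds_five.mul_neg, discriminant_pos_five⟩
  · exact ⟨coeffBounds_six.mul_neg, discriminant_pos_six⟩

end HallRing

/-! ### Assembly of the theorem. -/

theorem theorem4p5 :
    (∀ j : ℕ, 2 ≤ j →
      -- the masses for which the regular `2j`-gon is a relative equilibrium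
      (∀ μ : Fin (2 * j) → ℝ, (∀ k, 0 < μ k) →
        (IsRelEqOneN μ (ngonAngles (2 * j)) ↔
          ∃ a b : ℝ, μ = alternatingMasses (2 * j) a b)) ∧
      (∀ μ₁ μ₂ : ℝ, 0 < μ₁ → 0 < μ₂ →
        -- linear stability
        (IsLinearlyStableOneN (alternatingMasses (2 * j) μ₁ μ₂) (ngonAngles (2 * j)) ↔
          7 ≤ j ∨ ((j = 4 ∨ j = 5 ∨ j = 6) ∧
            μ₁ / μ₂ ∈ Set.Ioo (ratioLower j) (ratioUpper j))) ∧
        -- the same in terms of the Hessian of Hall's potential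
        (IsLinearlyStableOneN (alternatingMasses (2 * j) μ₁ μ₂) (ngonAngles (2 * j)) ↔
          (hallHessian (alternatingMasses (2 * j) μ₁ μ₂) (ngonAngles (2 * j))).PosSemidef ∧
          IsNondegenerate (alternatingMasses (2 * j) μ₁ μ₂) (ngonAngles (2 * j))))) ∧
    -- the end points of the intervals are the roots of `χ(j, 2) = 0`
    (∀ j : ℕ, j = 4 ∨ j = 5 ∨ j = 6 →
      0 < h₄ j ∧ ∀ μ₁ μ₂ : ℝ, 0 < μ₁ → 0 < μ₂ →
        (chi μ₁ μ₂ j 2 = 0 ↔ μ₁ / μ₂ = ratioLower j ∨ μ₁ / μ₂ = ratioUpper j)) ∧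
    -- numerical values of the end points
    (|ratioLower 4 - 0.39601454048825| < 1 / 10 ^ 13 ∧
      |ratioUpper 4 - 2.525159805412902| < 1 / 10 ^ 13 ∧
      |ratioLower 5 - 0.16709497914366| < 1 / 10 ^ 13 ∧
      |ratioUpper 5 - 5.984620274797297| < 1 / 10 ^ 13 ∧
      |ratioLower 6 - 0.061964963348688| < 1 / 10 ^ 13 ∧
      |ratioUpper 6 - 16.13815204525851| < 1 / 10 ^ 13) := by
  refine ⟨fun j hj => ⟨fun μ _ => ⟨HallRing.exists_eq_alternatingMasses hj, ?_⟩,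
    fun μ₁ μ₂ h₁ h₂ => ?_⟩, fun j hj => ?_, HallRing.ratio_bounds_four.1,
    HallRing.ratio_bounds_four.2, HallRing.ratio_bounds_five.1, HallRing.ratio_bounds_five.2,
    HallRing.ratio_bounds_six.1, HallRing.ratio_bounds_six.2⟩
  · rintro ⟨a, b, rfl⟩
    exact HallRing.isRelEqOneN_alternatingMasses hj a b
  · have hst := HallRing.isLinearlyStableOneN_iff (HallRing.alternatingMasses_pos h₁ h₂)
      HallRing.separated_ngonAngles (HallRing.isRelEqOneN_alternatingMasses hj μ₁ μ₂)
    refine ⟨?_, hst⟩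
    rw [hst]
    rcases hj.eq_or_lt with rfl | hj3
    · exact iff_of_false (HallRing.not_posSemidef_and_isNondegenerate_square h₁ h₂) (by omega)
    rw [HallRing.posSemidef_and_isNondegenerate_iff_chi_pos hj3 h₁ h₂]
    by_cases h7 : 7 ≤ j
    · exact iff_of_true (HallRing.chi_pos_of_seven_le h7 h₁ h₂) (Or.inl h7)
    rcases Nat.eq_or_lt_of_le hj3 with rfl | hj4
    · exact iff_of_false (HallRing.chi_three_nonpos h₁ h₂).not_gt (by omega)
    · have h456 : j = 4 ∨ j = 5 ∨ j = 6 := by omega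
      obtain ⟨hg, hd⟩ := HallRing.mul_neg_and_discriminant_pos h456
      rw [HallRing.chi_pos_iff hg hd μ₁ h₂, or_iff_right h7, and_iff_right h456]
  · obtain ⟨hg, hd⟩ := HallRing.mul_neg_and_discriminant_pos hj
    exact ⟨HallRing.h₄_pos hg hd, fun μ₁ μ₂ _ h₂ => HallRing.chi_eq_zero_iff hg hd μ₁ h₂⟩
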